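/- Let $\mathfrak T$ be a homogeneous tree of degree $q\ge 2$ (a tree in which every vertex has exactly $q+1$ neighbours) with distance $d$ and a fixed vertex $o$; put $|x|=d(x,o)$, $\tau=2\pi/\log q$, $\mathbb T=\mathbb R/\tau\mathbb Z$, and, for $p\in[1,\infty)$, $\delta(p)=|1/p-1/2|$. For $t>0$ let $\mathbf S_t=\{z\in\mathbb C:|\operatorname{Im}z|<t\}$. For a radial function $k$ on $\mathfrak T$, $k(x)=\kappa(|x|)$, let $\|k\|_{Cv_p(\mathfrak T)}\in[0,\infty]$ be the norm on $L^p(\mathfrak T)$ (counting measure) of the operator $f\mapsto f*k$, $(f*k)(x)=\sum_y f(y)\,\kappa(d(x,y))$, and write $k\in Cv_p(\mathfrak T)$ if it is finite. For a distribution $u$ on $\mathbb T$ let $\|u\|_{M_p(\mathbb T)}\in[0,\infty]$ be the norm on $\ell^p(\mathbb Z)$ of convolution by $\mathcal F^{-1}u(d)=\tau^{-1}\langle u,q^{id\,\cdot}\rangle$, and write $u\in M_p(\mathbb T)$ if it is finite. The spherical functions are $\phi_z(x)=\mathbf c(z)q^{(iz-1/2)|x|}+\mathbf c(-z)q^{(-iz-1/2)|x|}$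 for $z\notin(\tau/2)\mathbb Z$, where $\mathbf c(z)=\frac{q^{1/2}}{q+1}\,\frac{q^{1/2+iz}-q^{-1/2-iz}}{q^{iz}-q^{-iz}}$; for $z\in\tau\mathbb Z$ and $z\in\tau/2+\tau\mathbb Z$ they are $\big(1+\frac{q-1}{q+1}|x|\big)q^{-|x|/2}$ and $(-1)^{|x|}\big(1+\frac{q-1}{q+1}|x|\big)q^{-|x|/2}$, respectively. The spherical Fourier transform of a radial function $k$ is $\widetilde k(s)=\sum_{x}k(x)\phi_s(x)$, $s\in\mathbb T$, the series being understood in the sense of distributions on $\mathbb T$. A holomorphic function $m$ on $\mathbf S_t$ is Weyl-invariant if $m(-z)=m(z)$ and $m(z+\tau)=m(z)$ for $z\in\mathbf S_t$; it extends $\widetilde k$ if it agrees with $\widetilde k$ on the real axis. In that case the extension is again denoted by $\widetilde k$, and $\widetilde k_t$ denotes its boundary value $\lim_{v\to t^-}\widetilde k(\cdot+iv)$ in the sense of distributions on $\mathbb T$, when it exists. **Theorem.** Let $p\in[1,\infty)\setminus\{2\}$. For every radial function $k$ on $\mathfrak T$ the following are equivalent: 1. $k\in Cv_p(\mathfrak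 T)$; 2. $\widetilde k$ extends to a holomorphic Weyl-invariant function on $\mathbf S_{\delta(p)}$, the boundary value $\widetilde k_{\delta(p)}$ exists in the sense of distributions, and $\widetilde k_{\delta(p)}\in M_p(\mathbb T)$. Moreover, if these conditions hold, then $\sum_x k(x)\phi_z(x)$ converges absolutely to $\widetilde k(z)$ for every $z\in\mathbf S_{\delta(p)}$, and $$c\,\|\widetilde k_{\delta(p)}\|_{M_p(\mathbb T)}\le\|k\|_{Cv_p(\mathfrak T)}\le C\,\|\widetilde k_{\delta(p)}\|_{M_p(\mathbb T)},$$ where $c,C>0$ are constants that do not depend on $k$. -/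

import Mathlib

open scoped ENNReal NNReal

namespace HomTree

/-! ### Operators on `ℓ^p` given by kernels -/

/-- The `ℓ^p` norm (possibly infinite) of a complex function on a discrete set carrying the
counting measure. -/
noncomputable def ellNorm {ι : Type*} (p : ℝ) (g : ι → ℂ) : ℝ≥0∞ :=
  (∑' x, ‖g x‖ₑ ^ p) ^ (1 / p)

/-- The operator norm on `ℓ^p(ι)`, `1 ≤ p < ∞`, of the operator
`f ↦ (x ↦ ∑ y, f y * K x y)`: the least `B ∈ [0, ∞]` that bounds it on the dense subspace of
finitely supported functions. The operator is bounded on `ℓ^p(ι)` if and only if this is finite. -/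
noncomputable def opNorm {ι : Type*} (p : ℝ) (K : ι → ι → ℂ) : ℝ≥0∞ :=
  sInf {B : ℝ≥0∞ | ∀ f : ι →₀ ℂ,
    ellNorm p (fun x => f.sum fun y a => a * K x y) ≤ B * ellNorm p f}

/-! ### The homogeneous tree and its convolutors -/

/-- `T` is a homogeneous tree of degree `q`: a tree in which every vertex has exactly `q + 1`
neighbours. -/
def IsHomogeneousTree {V : Type*} (T : SimpleGraph V) (q : ℕ) : Prop :=
  T.IsTree ∧ ∀ v, (T.neighborSet v).ncard = q + 1

/-- A function is radial if its value at `x` depends only on the distance of `x` from `o`. -/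
def IsRadial {V : Type*} (T : SimpleGraph V) (o : V) (k : V → ℂ) : Prop :=
  ∀ x y, T.dist o x = T.dist o y → k x = k y

/-- The function `κ` on `ℕ` such that `k x = κ (dist o x)`, for `k` radial. -/
noncomputable def profile {V : Type*} (T : SimpleGraph V) (o : V) (k : V → ℂ) : ℕ → ℂ :=
  Function.extend (fun x => T.dist o x) k 0

/-- The kernel of right convolution by a radial function `k`. If `g` is an isometry with
`g o = y`, then `k (g⁻¹ x)` is the value of `k` at distance `dist o (g⁻¹ x) = dist y x`, so that
`(f * k) x = ∑ y, f y * κ (dist y x)`, where `κ` is the profile of `k`. -/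
noncomputable def treeKernel {V : Type*} (T : SimpleGraph V) (o : V) (k : V → ℂ) (x y : V) : ℂ :=
  profile T o k (T.dist y x)

/-- The norm (possibly infinite) of a radial function `k` in `Cv_p(T)`: the norm on `ℓ^p(T)` of
right convolution by `k`. -/
noncomputable def cvNorm {V : Type*} (T : SimpleGraph V) (o : V) (p : ℝ) (k : V → ℂ) : ℝ≥0∞ :=
  opNorm p (treeKernel T o k)

/-- The radial function `k` is in `Cv_p(T)`. -/
def MemCv {V : Type*} (T : SimpleGraph V) (o : V) (p : ℝ) (k : V → ℂ) : Prop :=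
  IsRadial T o k ∧ cvNorm T o p k < ∞

/-! ### Spherical functions -/

/-- `τ = 2π / log q`. -/
noncomputable def tau (q : ℕ) : ℝ := 2 * Real.pi / Real.log q

/-- The function `c` (used away from `(τ/2)ℤ` only). -/
noncomputable def cFun (q : ℕ) (z : ℂ) : ℂ :=
  (q : ℂ) ^ (1 / 2 : ℂ) / ((q : ℂ) + 1) *
    (((q : ℂ) ^ (1 / 2 + Complex.I * z) - (q : ℂ) ^ (-(1 / 2) - Complex.I * z)) /
      ((q : ℂ) ^ (Complex.I * z) - (q : ℂ) ^ (-(Complex.I * z))))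

open Classical in
/-- The value of the spherical function `φ_z` at distance `n` from the origin. -/
noncomputable def sphericalFun (q : ℕ) (z : ℂ) (n : ℕ) : ℂ :=
  if ∃ j : ℤ, z = j * (tau q : ℂ) then
    (1 + ((q : ℂ) - 1) / ((q : ℂ) + 1) * n) * (q : ℂ) ^ (-(n : ℂ) / 2)
  else if ∃ j : ℤ, z = (tau q : ℂ) / 2 + j * (tau q : ℂ) then
    (1 + ((q : ℂ) - 1) / ((q : ℂ) + 1) * n) * (q : ℂ) ^ (-(n : ℂ) / 2) * (-1) ^ n
  else
    cFun q z * (q : ℂ) ^ ((Complex.I * z - 1 / 2) * n) +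
      cFun q (-z) * (q : ℂ) ^ ((-(Complex.I * z) - 1 / 2) * n)

/-- `δ(p) = |1/p - 1/2|`. -/
noncomputable def delta (p : ℝ) : ℝ := |1 / p - 1 / 2|

/-- The open strip `{z : |Im z| < t}`. -/
def strip (t : ℝ) : Set ℂ := {z | |z.im| < t}

/-! ### Distributions and multipliers on the torus `ℝ / τℤ` -/

/-- Test functions on `ℝ / τℤ`: smooth `τ`-periodic functions on `ℝ`. -/
def TestFun (τ : ℝ) : Submodule ℂ (ℝ → ℂ) where
  carrier := {ψ | ContDiff ℝ ((⊤ : ℕ∞) : WithTop ℕ∞) ψ ∧ Function.Periodic ψ τ}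
  add_mem' := fun ha hb => ⟨ha.1.add hb.1, ha.2.add hb.2⟩
  zero_mem' := ⟨contDiff_const, fun _ => rfl⟩
  smul_mem' := fun c _ ha => ⟨contDiff_const.smul ha.1, ha.2.smul c⟩

/-- Distributions on `ℝ / τℤ`: linear functionals on the test functions that are bounded by
finitely many of the seminorms `sup |ψ⁽ʲ⁾|`. -/
structure TorusDistribution (τ : ℝ) where
  toFun : TestFun τ →ₗ[ℂ] ℂ
  continuous' : ∃ (N : ℕ) (B : ℝ), ∀ (ψ : TestFun τ) (M : ℝ),
    (∀ j ≤ N, ∀ s : ℝ, ‖iteratedDeriv j (ψ : ℝ → ℂ) s‖ ≤ M) → ‖toFun ψ‖ ≤ B * M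

theorem character_mem (q : ℕ) (d : ℤ) :
    (fun s : ℝ => Complex.exp (Complex.I * d * s * Real.log q)) ∈ TestFun (tau q) := by
  refine ⟨?_, ?_⟩
  · have h : ContDiff ℝ ((⊤ : ℕ∞) : WithTop ℕ∞) (fun s : ℝ => (s : ℂ)) :=
      Complex.ofRealCLM.contDiff
    exact ((contDiff_const.mul h).mul contDiff_const).cexp
  · intro s
    by_cases hq : Real.log q = 0
    · simp [hq]
    · have hq' : ((Real.log q : ℝ) : ℂ) ≠ 0 := by exact_mod_cast hq
      have h : Complex.I * d * ((s + tau q : ℝ) : ℂ) * (Real.log q : ℝ) =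
          Complex.I * d * s * (Real.log q : ℝ) + d * (2 * Real.pi * Complex.I) := by
        simp only [tau]
        push_cast at hq' ⊢
        field_simp
      simp only [h]
      exact Complex.exp_periodic.int_mul d _

/-- The character `s ↦ q ^ (i d s)` of `ℝ / τℤ`, as a test function. -/
noncomputable def character (q : ℕ) (d : ℤ) : TestFun (tau q) :=
  ⟨fun s : ℝ => Complex.exp (Complex.I * d * s * Real.log q), character_mem q d⟩

/-- The inverse Fourier transform of a distribution on the torus:
`F(d) = τ⁻¹ ∫ u(s) q^{ids} ds`. -/
noncomputable def invFourier (q : ℕ) (u : TorusDistribution (tau q)) (d : ℤ) : ℂ :=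
  (tau q : ℂ)⁻¹ * u.toFun (character q d)

/-- The norm (possibly infinite) of a distribution `u` in `M_p(ℝ / τℤ)`: the norm on `ℓ^p(ℤ)` of
convolution by the inverse Fourier transform of `u`. -/
noncomputable def mpNorm (q : ℕ) (p : ℝ) (u : TorusDistribution (tau q)) : ℝ≥0∞ :=
  opNorm p (fun n j : ℤ => invFourier q u (n - j))

/-- The distribution `u` is in `M_p(ℝ / τℤ)`. -/
def MemMp (q : ℕ) (p : ℝ) (u : TorusDistribution (tau q)) : Prop :=
  mpNorm q p u < ∞

/-- `u` is the boundary value `f_t` of `f` on the line `Im z = t`, in the sense of distributions: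
`f(· + iv) → u` as `v` increases to `t`. -/
def IsBoundaryValue (q : ℕ) (f : ℂ → ℂ) (t : ℝ) (u : TorusDistribution (tau q)) : Prop :=
  ∀ ψ : TestFun (tau q), Filter.Tendsto
    (fun v : ℝ => ∫ s in (-(tau q) / 2)..(tau q / 2),
      f ((s : ℂ) + v * Complex.I) * (ψ : ℝ → ℂ) s)
    (nhdsWithin t (Set.Iio t)) (nhds (u.toFun ψ))

/-! ### The spherical Fourier transform and its extension to a strip -/

/-- `f` is holomorphic and Weyl-invariant (even and `τ`-periodic) in the strip `|Im z| < t`. -/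
def IsHolomorphicWeylInvariant (q : ℕ) (t : ℝ) (f : ℂ → ℂ) : Prop :=
  DifferentiableOn ℂ f (strip t) ∧
    ∀ z ∈ strip t, f (-z) = f z ∧ f (z + tau q) = f z

/-- On the real axis, `m` is the spherical Fourier transform `∑ x, k x * φ_s x` of `k`, where the
series is understood in the sense of distributions on `ℝ / τℤ`. (Thus no summability of `k` is
presupposed; if the series converges absolutely at `s = 0`, it does so uniformly in `s`, and the
sum is the usual one.) -/
def IsSphericalTransform {V : Type*} (T : SimpleGraph V) (o : V) (q : ℕ) (k : V → ℂ)
    (m : ℂ → ℂ) : Prop :=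
  ∀ ψ : TestFun (tau q), HasSum
    (fun x : V => k x * ∫ s in (-(tau q) / 2)..(tau q / 2),
      sphericalFun q (s : ℂ) (T.dist o x) * (ψ : ℝ → ℂ) s)
    (∫ s in (-(tau q) / 2)..(tau q / 2), m (s : ℂ) * (ψ : ℝ → ℂ) s)

/-- The spherical Fourier transform of `k` extends to the holomorphic Weyl-invariant function `m`
on the strip `|Im z| < t`. -/
def SphericalTransformExtends {V : Type*} (T : SimpleGraph V) (o : V) (q : ℕ) (k : V → ℂ)
    (t : ℝ) (m : ℂ → ℂ) : Prop :=
  IsSphericalTransform T o q k m ∧ IsHolomorphicWeylInvariant q t m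

end HomTree

open scoped ENNReal NNReal

namespace HomTree

/-! ### Operator norms on ℓ^p: limits, convolutions on ℤ, duality. -/

section OperatorNorm

variable {ι : Type*} {p : ℝ}

/-! Both norms are unchanged when p is replaced by its conjugate exponent: the kernel on the tree is
symmetric, and transposing a convolution on ℤ is a reflection. So let p < 2 and δ = 1/p - 1/2.

Write κ for the profile of k. The spherical function at distance n, times the size of the sphere, is
q^{n/2} times a Laurent polynomial in q^{iz} (`sphereCard_mul_sphericalFun`). Hence the spherical
transform is ∑ a(d) q^{idz}, where a is the even sequence `abelTransform`, and a is inverted by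
q^{e/2}(κ(e) - κ(e+2)) = a(e) - a(e+2) (`abelTransform_sub`). Moving the contour to Im z = δ and
using that a is even, the boundary value acts on ℤ as convolution by F(d) = q^{δd} a(d)
(`invFourier_eq_abelTransform`). What remains is to compare convolution by k on the tree with
convolution by F on ℤ.

Fix an end of the tree and let P be the step towards it. If P^{i₀}x = P^{j₀}y is the first common
ancestor, then d(x,y) = i₀ + j₀, and the other common ancestors are P^{i₀+l}x = P^{j₀+l}y.
Telescoping κ with step 2 therefore writes κ(d(x,y)) as a sum over common ancestors
(`tendsto_sum_ancestorKernel`).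

Upper bound (`exists_cvNorm_le`): the j-th term is the map induced by P^j, of norm at most
q^{j(1-1/p)}, followed by an operator along ascending rays, which is dominated by a one-sided
convolution on ℤ (`opNorm_ancestorKernel_le`). That convolution is q^{-j/p} times the restriction to
d ≥ 0 of F(d+j) - r F(d+j+2), with r = q^{1-2/p} < 1. Since F(-d) = r^d F(d) for d ≥ 0, the
restriction costs only a factor linear in j (`opNorm_truncation_le`), and the total weight r^j makes
the series converge.

Lower bound, with constant 1 (`opNorm_le_cvNorm`): on functions that are constant on the levels
below a vertex, convolution by k tends to convolution by F as the levels sink.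

Analytically, k ∈ Cv_p forces |κ(n)| ≤ C q^{-n/p}. This gives convergence of the series in the strip
and a boundary value. Conversely, the distributional transform alone already forces ∑ q^{n/2}|κ(n)|
< ∞ (`summable_normProfile_of_transform`), so the two inequalities need no decay assumed beforehand.
-/

theorem ellNorm_rpow (hp : 1 ≤ p) (g : ι → ℂ) : ellNorm p g ^ p = ∑' x, ‖g x‖ₑ ^ p := by
  rw [ellNorm, ← ENNReal.rpow_mul, one_div_mul_cancel (by linarith), ENNReal.rpow_one]

theorem ellNorm_le_iff (hp : 1 ≤ p) (g : ι → ℂ) (B : ℝ≥0∞) :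
    ellNorm p g ≤ B ↔ ∑' x, ‖g x‖ₑ ^ p ≤ B ^ p := by
  rw [← ellNorm_rpow hp, ENNReal.rpow_le_rpow_iff (by linarith)]

theorem ellNorm_eq_eLpNorm (hp : 1 ≤ p) (g : ι → ℂ) :
    ellNorm p g = MeasureTheory.eLpNorm g (ENNReal.ofReal p) (@MeasureTheory.Measure.count ι ⊤) := by
  let _ : MeasurableSpace ι := ⊤
  have h0 : ENNReal.ofReal p ≠ 0 := by simp; linarith
  rw [MeasureTheory.eLpNorm_eq_lintegral_rpow_enorm_toReal h0 ENNReal.ofReal_ne_top,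
    MeasureTheory.lintegral_count, ENNReal.toReal_ofReal (by linarith), ellNorm]

theorem ellNorm_add_le (hp : 1 ≤ p) (g h : ι → ℂ) :
    ellNorm p (fun x => g x + h x) ≤ ellNorm p g + ellNorm p h := by
  let _ : MeasurableSpace ι := ⊤
  simp only [ellNorm_eq_eLpNorm hp]
  exact MeasureTheory.eLpNorm_add_le (f := g) (g := h)
    (measurable_from_top).stronglyMeasurable.aestronglyMeasurable
    (measurable_from_top).stronglyMeasurable.aestronglyMeasurable (by simpa using hp)

theorem ellNorm_const_mul (hp : 1 ≤ p) (c : ℂ) (g : ι → ℂ) :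
    ellNorm p (fun x => c * g x) = ‖c‖ₑ * ellNorm p g := by
  have hp0 : 0 < p := by linarith
  simp only [ellNorm, enorm_mul, ENNReal.mul_rpow_of_nonneg _ _ hp0.le, ENNReal.tsum_mul_left]
  rw [ENNReal.mul_rpow_of_nonneg _ _ (by positivity), ← ENNReal.rpow_mul,
    mul_one_div_cancel hp0.ne', ENNReal.rpow_one]

theorem ellNorm_comp_equiv {κ : Type*} (e : κ ≃ ι) (g : ι → ℂ) :
    ellNorm p (fun x => g (e x)) = ellNorm p g := by
  simp only [ellNorm]
  rw [e.tsum_eq (fun x => ‖g x‖ₑ ^ p)]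

theorem enorm_le_ellNorm (hp : 1 ≤ p) (g : ι → ℂ) (x : ι) : ‖g x‖ₑ ≤ ellNorm p g := by
  rw [← ENNReal.rpow_le_rpow_iff (z := p) (by linarith), ellNorm_rpow hp]
  exact ENNReal.le_tsum x

theorem ellNorm_eq_zero (hp : 1 ≤ p) {g : ι → ℂ} (h : ellNorm p g = 0) : g = 0 := by
  funext x
  have := enorm_le_ellNorm hp g x
  simpa [h] using this

theorem ellNorm_zero (hp : 1 ≤ p) : ellNorm p (fun _ : ι => (0 : ℂ)) = 0 := by
  have hp0 : 0 < p := by linarith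
  simp [ellNorm, hp0]

theorem ellNorm_finsupp_ne_top (hp : 1 ≤ p) (f : ι →₀ ℂ) : ellNorm p f ≠ ∞ := by
  have hp0 : 0 < p := by linarith
  refine ENNReal.rpow_ne_top_of_nonneg (by positivity) ?_
  rw [tsum_eq_sum (s := f.support) (fun x hx => by
    simp only [Finsupp.notMem_support_iff] at hx; simp [hx, hp0])]
  exact (ENNReal.sum_lt_top.2 fun x _ =>
    ENNReal.rpow_lt_top_of_nonneg hp0.le (by simp)).ne

theorem ellNorm_single (hp : 1 ≤ p) (y : ι) (a : ℂ) : ellNorm p (Finsupp.single y a) = ‖a‖ₑ := by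
  have hp0 : 0 < p := by linarith
  rw [ellNorm, tsum_eq_single y]
  · rw [Finsupp.single_eq_same, ← ENNReal.rpow_mul, mul_one_div_cancel hp0.ne', ENNReal.rpow_one]
  · intro x hx
    simp [Finsupp.single_eq_of_ne hx, hp0]

/-- Fatou for counting measure: the bound passes to the limit in each finite partial sum. -/
theorem ellNorm_le_of_tendsto (hp : 1 ≤ p) {α : Type*} {l : Filter α} [l.NeBot]
    {G : α → ι → ℂ} {g : ι → ℂ} {B : ℝ≥0∞} (hB : ∀ a, ellNorm p (G a) ≤ B)
    (h : ∀ x, Filter.Tendsto (fun a => G a x) l (nhds (g x))) : ellNorm p g ≤ B := by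
  rw [ellNorm_le_iff hp, ENNReal.tsum_eq_iSup_sum]
  refine iSup_le fun s => ?_
  have ht : Filter.Tendsto (fun a => ∑ x ∈ s, ‖G a x‖ₑ ^ p) l (nhds (∑ x ∈ s, ‖g x‖ₑ ^ p)) :=
    tendsto_finsetSum _ fun x _ => (h x).enorm.ennrpow_const p
  refine le_of_tendsto' ht fun a => ?_
  exact (ENNReal.sum_le_tsum s).trans ((ellNorm_le_iff hp _ _).1 (hB a))

theorem opNorm_le {K : ι → ι → ℂ} {B : ℝ≥0∞}
    (h : ∀ f : ι →₀ ℂ, ellNorm p (fun x => f.sum fun y a => a * K x y) ≤ B * ellNorm p f) :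
    opNorm p K ≤ B := sInf_le h

/-- The infimum is attained: unless f = 0, its norm is finite and nonzero and can be divided out. -/
theorem ellNorm_le_opNorm_mul (hp : 1 ≤ p) (K : ι → ι → ℂ) (f : ι →₀ ℂ) :
    ellNorm p (fun x => f.sum fun y a => a * K x y) ≤ opNorm p K * ellNorm p f := by
  by_cases hf : ellNorm p f = 0
  · have : f = 0 := DFunLike.coe_injective (ellNorm_eq_zero hp hf)
    subst this
    simp [ellNorm_zero hp]
  · rw [← ENNReal.div_le_iff hf (ellNorm_finsupp_ne_top hp f)]
    exact le_sInf fun B hB => ENNReal.div_le_of_le_mul (hB f)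

/-- Test on a point mass. On the tree this yields k ∈ ℓ^p, on ℤ a uniform bound for the convolution
kernel. -/
theorem ellNorm_column_le (hp : 1 ≤ p) (K : ι → ι → ℂ) (y : ι) :
    ellNorm p (fun x => K x y) ≤ opNorm p K := by
  have := ellNorm_le_opNorm_mul hp K (Finsupp.single y 1)
  rw [ellNorm_single hp] at this
  simpa using this

theorem opNorm_add_le (hp : 1 ≤ p) (K L : ι → ι → ℂ) :
    opNorm p (fun x y => K x y + L x y) ≤ opNorm p K + opNorm p L := by
  refine opNorm_le fun f => ?_
  simp only [mul_add, Finsupp.sum_add, add_mul]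
  exact (ellNorm_add_le hp _ _).trans
    (add_le_add (ellNorm_le_opNorm_mul hp K f) (ellNorm_le_opNorm_mul hp L f))

theorem opNorm_const_mul_le (hp : 1 ≤ p) (c : ℂ) (K : ι → ι → ℂ) :
    opNorm p (fun x y => c * K x y) ≤ ‖c‖ₑ * opNorm p K := by
  refine opNorm_le fun f => ?_
  simp only [mul_left_comm _ c, ← Finsupp.mul_sum]
  rw [ellNorm_const_mul hp, mul_assoc]
  gcongr
  exact ellNorm_le_opNorm_mul hp K f

theorem opNorm_zero (hp : 1 ≤ p) : opNorm p (fun _ _ : ι => (0 : ℂ)) = 0 := by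
  refine le_antisymm (opNorm_le fun f => ?_) bot_le
  simp [ellNorm_zero hp]

theorem opNorm_sub_le (hp : 1 ≤ p) (K L : ι → ι → ℂ) :
    opNorm p (fun x y => K x y - L x y) ≤ opNorm p K + opNorm p L := by
  have h := opNorm_add_le hp K (fun x y => (-1) * L x y)
  have h2 := opNorm_const_mul_le hp (-1) L
  simp only [neg_mul, one_mul, ← sub_eq_add_neg] at h h2
  exact h.trans (by gcongr; simpa using h2)

theorem opNorm_sum_le (hp : 1 ≤ p) {α : Type*} (s : Finset α) (K : α → ι → ι → ℂ) :
    opNorm p (fun x y => ∑ a ∈ s, K a x y) ≤ ∑ a ∈ s, opNorm p (K a) := by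
  classical
  induction s using Finset.induction_on with
  | empty => simp [opNorm_zero hp]
  | insert a s ha ih =>
    simp only [Finset.sum_insert ha]
    exact (opNorm_add_le hp _ _).trans (by gcongr)

/-- Only finitely supported f are tested, so entrywise convergence of the kernels suffices. -/
theorem opNorm_le_of_tendsto (hp : 1 ≤ p) {α : Type*} {l : Filter α} [l.NeBot]
    {G : α → ι → ι → ℂ} {K : ι → ι → ℂ} {B : ℝ≥0∞} (hB : ∀ a, opNorm p (G a) ≤ B)
    (h : ∀ x y, Filter.Tendsto (fun a => G a x y) l (nhds (K x y))) : opNorm p K ≤ B := by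
  refine opNorm_le fun f => ?_
  refine ellNorm_le_of_tendsto hp (l := l) (G := fun a x => f.sum fun y b => b * G a x y)
    (fun a => (ellNorm_le_opNorm_mul hp _ f).trans (by gcongr; exact hB a)) fun x => ?_
  exact tendsto_finsetSum _ fun y _ => (h x y).const_mul _

theorem opNorm_reindex_le (hp : 1 ≤ p) (e e' : ι ≃ ι) (K : ι → ι → ℂ) :
    opNorm p (fun x y => K (e x) (e' y)) ≤ opNorm p K := by
  refine opNorm_le fun f => ?_
  have h := ellNorm_le_opNorm_mul hp K (Finsupp.equivMapDomain e' f)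
  have h1 : ellNorm p (Finsupp.equivMapDomain e' f) = ellNorm p f := by
    rw [← ellNorm_comp_equiv e']
    simp
  rw [h1, ← ellNorm_comp_equiv e] at h
  convert h using 3 with x
  rw [Finsupp.equivMapDomain_eq_mapDomain, Finsupp.sum_mapDomain_index_inj e'.injective]

/-- Young's inequality: the convolution is a limit of finite combinations of translations, which are
isometries. -/
theorem opNorm_convolution_le (hp : 1 ≤ p) (G : ℤ → ℂ) :
    opNorm p (fun n j : ℤ => G (n - j)) ≤ ∑' d, ‖G d‖ₑ := by
  refine opNorm_le_of_tendsto hp (l := (Filter.atTop : Filter (Finset ℤ)))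
    (G := fun s n j => ∑ d ∈ s, if n - j = d then G d else 0) (fun s => ?_) fun n j => ?_
  · refine (opNorm_sum_le hp s _).trans
      (le_trans (Finset.sum_le_sum fun d _ => ?_) (ENNReal.sum_le_tsum s))
    refine opNorm_le fun f => le_of_eq ?_
    have h : ∀ n : ℤ, (f.sum fun j a => a * if n - j = d then G d else 0) =
        G d * f (n - d) := by
      intro n
      rw [Finsupp.sum, Finset.sum_eq_single (n - d)]
      · simp [mul_comm]
      · intro j _ hj
        rw [if_neg (by omega), mul_zero]
      · intro h
        simp only [Finsupp.notMem_support_iff] at h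
        simp [h]
    simp only [h]
    rw [ellNorm_const_mul hp]
    congr 1
    exact ellNorm_comp_equiv (Equiv.subRight d) f
  · refine tendsto_const_nhds.congr' ?_
    filter_upwards [Filter.eventually_ge_atTop {n - j}] with s hs
    rw [Finset.sum_eq_single (n - j)]
    · simp
    · intro b _ hb
      rw [if_neg (Ne.symm hb)]
    · intro h
      exact absurd (hs (Finset.mem_singleton_self _)) h

/-- Pair the output g = Kf, on a finite set s, with its extremal dual function, move K to the other
side and apply Hölder. -/
theorem opNorm_le_opNorm_transpose {p' : ℝ} (hpp' : p.HolderConjugate p') (K : ι → ι → ℂ) :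
    opNorm p K ≤ opNorm p' (fun x y => K y x) := by
  have hp : 1 ≤ p := hpp'.lt.le
  have hp' : 1 ≤ p' := hpp'.symm.lt.le
  have hp0 : 0 < p := by linarith
  have hp0' : 0 < p' := by linarith
  refine opNorm_le fun f => ?_
  set B := opNorm p' (fun x y => K y x)
  set g : ι → ℂ := fun x => f.sum fun y a => a * K x y with hg
  rw [ellNorm_le_iff hp, ENNReal.tsum_eq_iSup_sum]
  refine iSup_le fun s => ?_
  set S : ℝ≥0∞ := ∑ x ∈ s, ‖g x‖ₑ ^ p with hS
  have hStop : S ≠ ∞ := (ENNReal.sum_lt_top.2 fun x _ =>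
    ENNReal.rpow_lt_top_of_nonneg hp0.le (by simp)).ne
  rcases eq_or_ne S 0 with h0 | h0
  · rw [h0]; exact bot_le
  -- The extremal dual function: w g = |g|^p and |w|^{p'} = |g|^p, with value 0 where g vanishes.
  let w : ι → ℂ := fun x => (starRingEnd ℂ (g x)) * ((‖g x‖ ^ (p - 2) : ℝ) : ℂ)
  classical
  let φ : ι →₀ ℂ := Finsupp.onFinset s (fun x => if x ∈ s then w x else 0)
    (fun x hx => by by_contra h; simp [h] at hx)
  have hw : ∀ x, ‖w x‖ = ‖g x‖ ^ (p - 1) := by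
    intro x
    simp only [w, norm_mul, RCLike.norm_conj, Complex.norm_real, Real.norm_eq_abs]
    rcases eq_or_lt_of_le (norm_nonneg (g x)) with h | h
    · rw [← h, zero_mul, Real.zero_rpow (by linarith [hpp'.lt])]
    · rw [abs_of_pos (by positivity)]
      nth_rewrite 1 [← Real.rpow_one ‖g x‖]
      rw [← Real.rpow_add h]
      congr 1; ring
  have hwg : ∀ x, w x * g x = ((‖g x‖ ^ p : ℝ) : ℂ) := by
    intro x
    have h1 : w x * g x = ((‖g x‖ ^ 2 * ‖g x‖ ^ (p - 2) : ℝ) : ℂ) := by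
      simp only [w]
      rw [mul_right_comm, mul_comm (starRingEnd ℂ _), Complex.mul_conj, Complex.normSq_eq_norm_sq]
      push_cast; ring
    rw [h1]
    congr 1
    rcases eq_or_lt_of_le (norm_nonneg (g x)) with h | h
    · rw [← h, Real.zero_rpow hp0.ne']; simp
    · rw [← Real.rpow_natCast, ← Real.rpow_add h]
      congr 1; push_cast; ring
  have hφ : ellNorm p' φ = S ^ (1 / p') := by
    rw [ellNorm, tsum_eq_sum (s := s)]
    · congr 1
      refine Finset.sum_congr rfl fun x hx => ?_
      simp only [φ, Finsupp.onFinset_apply, hx, if_true]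
      rw [← ofReal_norm, ← ofReal_norm, hw, ENNReal.ofReal_rpow_of_nonneg (by positivity) hp0'.le,
        ENNReal.ofReal_rpow_of_nonneg (by positivity) hp0.le, ← Real.rpow_mul (norm_nonneg _),
        hpp'.sub_one_mul_conj]
    · intro x hx
      simp [φ, hx, hp0']
  set ψ : ι → ℂ := fun y => φ.sum fun x a => a * K x y with hψ
  have hψB : ellNorm p' ψ ≤ B * ellNorm p' φ :=
    ellNorm_le_opNorm_mul hp' (fun x y => K y x) φ
  have hswap : ((∑ x ∈ s, ‖g x‖ ^ p : ℝ) : ℂ) = ∑ y ∈ f.support, f y * ψ y := by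
    push_cast
    have h1 : ∀ y, ψ y = ∑ x ∈ s, w x * K x y := by
      intro y
      simp only [hψ]
      rw [Finsupp.sum_of_support_subset _ (s := s) Finsupp.support_onFinset_subset _ (by simp)]
      exact Finset.sum_congr rfl fun x hx => by simp [hx]
    simp only [h1, Finset.mul_sum]
    rw [Finset.sum_comm]
    refine Finset.sum_congr rfl fun x _ => ?_
    have := hwg x
    rw [← this, hg]
    simp only [Finsupp.sum, Finset.mul_sum]
    exact Finset.sum_congr rfl fun y _ => by ring
  have hSle : S ≤ ellNorm p f * (B * S ^ (1 / p')) := by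
    have h1 : S = ENNReal.ofReal (∑ x ∈ s, ‖g x‖ ^ p) := by
      rw [hS, ENNReal.ofReal_sum_of_nonneg fun _ _ => by positivity]
      refine Finset.sum_congr rfl fun x _ => ?_
      rw [← ofReal_norm, ENNReal.ofReal_rpow_of_nonneg (by positivity) hp0.le]
    have h2 : S = ‖((∑ x ∈ s, ‖g x‖ ^ p : ℝ) : ℂ)‖ₑ := by
      rw [h1, ← ofReal_norm, Complex.norm_real, Real.norm_of_nonneg]
      exact Finset.sum_nonneg fun _ _ => by positivity
    calc S ≤ ∑ y ∈ f.support, ‖f y * ψ y‖ₑ := by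
          rw [h2, hswap]; exact enorm_sum_le _ _
      _ = ∑ y ∈ f.support, ‖f y‖ₑ * ‖ψ y‖ₑ := by simp only [enorm_mul]
      _ ≤ (∑ y ∈ f.support, ‖f y‖ₑ ^ p) ^ (1 / p) * (∑ y ∈ f.support, ‖ψ y‖ₑ ^ p') ^ (1 / p') :=
          ENNReal.inner_le_Lp_mul_Lq _ _ _ hpp'
      _ ≤ ellNorm p f * ellNorm p' ψ := by
          gcongr
          · exact ENNReal.rpow_le_rpow (ENNReal.sum_le_tsum _) (by positivity)
          · exact ENNReal.rpow_le_rpow (ENNReal.sum_le_tsum _) (by positivity)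
      _ ≤ _ := by
          gcongr
          rwa [← hφ]
  -- Cancel S^{1/p'}, which is finite and nonzero because s is finite and S ≠ 0.
  have hS1 : S ^ (1 / p) ≤ B * ellNorm p f := by
    have h3 : S ^ (1 / p') ≠ 0 := by simp [h0, hStop]
    have h4 : S ^ (1 / p') ≠ ∞ := ENNReal.rpow_ne_top_of_nonneg (by positivity) hStop
    have h5 : S = S ^ (1 / p) * S ^ (1 / p') := by
      rw [← ENNReal.rpow_add _ _ h0 hStop]
      have : 1 / p + 1 / p' = 1 := by simpa using hpp'.inv_add_inv_eq_one
      rw [this, ENNReal.rpow_one]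
    rw [← ENNReal.mul_le_mul_iff_left h3 h4, ← h5]
    calc S ≤ _ := hSle
      _ = _ := by ring
  calc S = (S ^ (1 / p)) ^ p := by
        rw [← ENNReal.rpow_mul, one_div_mul_cancel hp0.ne', ENNReal.rpow_one]
    _ ≤ _ := ENNReal.rpow_le_rpow hS1 hp0.le

theorem opNorm_eq_opNorm_transpose {p' : ℝ} (hpp' : p.HolderConjugate p') (K : ι → ι → ℂ) :
    opNorm p K = opNorm p' (fun x y => K y x) :=
  le_antisymm (opNorm_le_opNorm_transpose hpp' K)
    (opNorm_le_opNorm_transpose hpp'.symm fun x y => K y x)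

end OperatorNorm

/-! ### Ends, horocyclic height, and counting of vertices. -/

section Horocycles

variable {V : Type*} {T : SimpleGraph V} {q : ℕ}

/-- Two neighbours of y nearer to o would extend to two different paths from o to y. -/
theorem exists_rootParent (hT : T.IsTree) (o : V) : ∃ P : V → V,
    (∀ x, x ≠ o → T.Adj (P x) x ∧ T.dist o x = T.dist o (P x) + 1) ∧
      ∀ x y, T.Adj x y → T.dist o y = T.dist o x + 1 → P y = x := by
  have hc := hT.connected
  have hex : ∀ y, ∃ x, y ≠ o → T.Adj x y ∧ T.dist o y = T.dist o x + 1 := by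
    intro y
    by_cases hy : y = o
    · exact ⟨o, fun h => absurd hy h⟩
    obtain ⟨w, hw⟩ := hc.exists_walk_length_eq_dist o y
    have hnil : ¬ w.Nil := fun h => hy h.eq.symm
    have hadj := w.adj_penultimate hnil
    refine ⟨w.penultimate, fun _ => ⟨hadj, ?_⟩⟩
    have h1 : T.dist o w.penultimate ≤ w.dropLast.length := SimpleGraph.dist_le _
    have h2 : w.dropLast.length + 1 = w.length := SimpleGraph.Walk.length_dropLast_add_one hnil
    rcases hT.dist_eq_dist_add_one_of_adj o hadj with h | h <;> omega
  choose P hP using hex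
  have huniq : ∀ x x' y, T.Adj x y → T.Adj x' y → T.dist o y = T.dist o x + 1 →
      T.dist o y = T.dist o x' + 1 → x = x' := by
    intro x x' y h h' hd hd'
    obtain ⟨w, hw⟩ := hc.exists_walk_length_eq_dist o x
    obtain ⟨w', hw'⟩ := hc.exists_walk_length_eq_dist o x'
    have hp : (w.concat h).IsPath := SimpleGraph.Walk.isPath_of_length_eq_dist _ (by simp; omega)
    have hp' : (w'.concat h').IsPath :=
      SimpleGraph.Walk.isPath_of_length_eq_dist _ (by simp; omega)
    have he : w.concat h = w'.concat h' :=
      congrArg Subtype.val ((hT.isAcyclic.subsingleton_path o y).elim ⟨_, hp⟩ ⟨_, hp'⟩)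
    have := congrArg SimpleGraph.Walk.penultimate he
    simpa using this
  refine ⟨P, hP, fun x y hxy hd => ?_⟩
  have hy : y ≠ o := by rintro rfl; simp at hd
  exact huniq _ _ y (hP y hy).1 hxy (hP y hy).2 hd

/-- `P` sends each vertex to its neighbour in the direction of a fixed end of the tree, and `h` is
the corresponding horocyclic height. -/
structure IsHoroParent (T : SimpleGraph V) (P : V → V) (h : V → ℤ) : Prop where
  adj : ∀ x, T.Adj x (P x)
  edge : ∀ x y, T.Adj x y → P x = y ∨ P y = x
  height : ∀ x, h (P x) = h x + 1

/-- The end is that of a geodesic ray v issuing from o. `P` follows the ray at its vertices and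
moves towards o elsewhere. -/
theorem exists_isHoroParent (hq : 2 ≤ q) (hT : IsHomogeneousTree T q) (o : V) :
    ∃ P h, IsHoroParent T P h := by
  classical
  obtain ⟨P₀, hP₀, hP₀'⟩ := exists_rootParent hT.1 o
  -- Only one neighbour is nearer to o and there are q + 1 > 1 of them, so the ray can always be
  -- prolonged.
  have hchild : ∀ x, ∃ y, T.Adj x y ∧ T.dist o y = T.dist o x + 1 := by
    intro x
    by_contra! hcon
    have hsub : T.neighborSet x ⊆ {P₀ x} := by
      intro y hy
      rcases hT.1.dist_eq_dist_add_one_of_adj o hy with h | h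
      · exact (hP₀' y x (SimpleGraph.Adj.symm hy) h).symm
      · exact absurd h (hcon y hy)
    have h1 := Set.ncard_le_ncard hsub
    rw [hT.2 x, Set.ncard_singleton] at h1
    omega
  choose next hnext hnextd using hchild
  let v : ℕ → V := fun n => next^[n] o
  have hv : ∀ n, v (n + 1) = next (v n) := fun n => Function.iterate_succ_apply' _ _ _
  have hvd : ∀ n, T.dist o (v n) = n := by
    intro n
    induction n with
    | zero => simp [v]
    | succ n ih => rw [hv, hnextd, ih]
  let P : V → V := fun x => if v (T.dist o x) = x then v (T.dist o x + 1) else P₀ x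
  -- The height is built by recursion on the distance from o: an outward edge gains 1 if it ends on
  -- the ray and loses 1 otherwise.
  let H : ℕ → V → ℤ := fun n => Nat.rec (fun _ => 0)
    (fun n g x => g (P₀ x) + if v (n + 1) = x then 1 else -1) n
  have hH : ∀ x y, T.Adj x y → T.dist o y = T.dist o x + 1 →
      H (T.dist o y) y = H (T.dist o x) x + if v (T.dist o y) = y then 1 else -1 := by
    intro x y hxy hd
    rw [← hP₀' x y hxy hd] at *
    rw [hd]
  have hedge : ∀ x y, T.Adj x y → T.dist o y = T.dist o x + 1 →
      (v (T.dist o y) = y ∧ P x = y) ∨ (v (T.dist o y) ≠ y ∧ P y = x) := by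
    intro x y hxy hd
    by_cases hy : v (T.dist o y) = y
    · left
      refine ⟨hy, ?_⟩
      have hx : P₀ y = v (T.dist o x) := by
        refine hP₀' _ _ ?_ ?_
        · rw [← hy, hd, hv]; exact hnext _
        · rw [hvd, hd]
      rw [hP₀' x y hxy hd] at hx
      simp only [P]
      rw [if_pos hx.symm, ← hd, hy]
    · right
      refine ⟨hy, ?_⟩
      simp only [P]
      rw [if_neg hy, hP₀' x y hxy hd]
  have hPx : ∀ x, T.Adj x (P x) ∧
      ((T.dist o (P x) = T.dist o x + 1 ∧ v (T.dist o (P x)) = P x) ∨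
        (T.dist o x = T.dist o (P x) + 1 ∧ v (T.dist o x) ≠ x)) := by
    intro x
    by_cases hx : v (T.dist o x) = x
    · have : P x = next x := by
        simp only [P]; rw [if_pos hx, hv, hx]
      refine ⟨this ▸ hnext x, Or.inl ⟨this ▸ hnextd x, ?_⟩⟩
      rw [this, hnextd, hv, hx]
    · have hPP : P x = P₀ x := by simp only [P]; rw [if_neg hx]
      have hxo : x ≠ o := by
        rintro rfl
        simp [v] at hx
      have := hP₀ x hxo
      refine ⟨hPP ▸ this.1.symm, Or.inr ⟨hPP ▸ this.2, hx⟩⟩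
  refine ⟨P, fun x => H (T.dist o x) x, fun x => (hPx x).1, fun x y hxy => ?_, fun x => ?_⟩
  · rcases hT.1.dist_eq_dist_add_one_of_adj o hxy with h | h
    · rcases hedge y x hxy.symm h with h1 | h1
      · exact Or.inr h1.2
      · exact Or.inl h1.2
    · rcases hedge x y hxy h with h1 | h1
      · exact Or.inl h1.2
      · exact Or.inr h1.2
  · obtain ⟨hadj, h | h⟩ := hPx x
    · rw [hH _ _ hadj h.1, if_pos h.2]
    · rw [hH _ _ hadj.symm h.1, if_neg h.2]
      ring

namespace IsHoroParent

variable {P : V → V} {h : V → ℤ}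

theorem height_iterate (hP : IsHoroParent T P h) (i : ℕ) (x : V) : h (P^[i] x) = h x + i := by
  induction i with
  | zero => simp
  | succ i ih => rw [Function.iterate_succ_apply', hP.height, ih]; push_cast; ring

/-- The children of v are all its neighbours but `P v`, which cannot be a child because its height
is larger. -/
theorem fiber_ncard (hP : IsHoroParent T P h) (hT : IsHomogeneousTree T q) (v : V) :
    {y | P y = v}.ncard = q := by
  have : {y | P y = v} = T.neighborSet v \ {P v} := by
    ext y
    simp only [Set.mem_ofPred_eq, Set.mem_sdiff, SimpleGraph.mem_neighborSet, Set.mem_singleton_iff]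
    constructor
    · rintro rfl
      refine ⟨(hP.adj y).symm, fun h' => ?_⟩
      have h1 := congrArg h h'
      rw [hP.height, hP.height] at h1
      omega
    · rintro ⟨h1, h2⟩
      rcases hP.edge v y h1 with h3 | h3
      · exact absurd h3.symm h2
      · exact h3
  have hmem : P v ∈ T.neighborSet v := hP.adj v
  rw [this, Set.ncard_sdiff_singleton_of_mem hmem, hT.2 v]
  rfl

theorem exists_iterate_eq_of_walk (hP : IsHoroParent T P h) {x y : V} (w : T.Walk x y) :
    ∃ i j, P^[i] x = P^[j] y ∧ i + j ≤ w.length := by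
  induction w with
  | nil => exact ⟨0, 0, rfl, le_rfl⟩
  | @cons x x' y hadj w ih =>
    obtain ⟨i, j, hij, hle⟩ := ih
    rw [SimpleGraph.Walk.length_cons]
    rcases hP.edge x x' hadj with h1 | h1
    · exact ⟨i + 1, j, by rw [Function.iterate_succ_apply, h1, hij], by omega⟩
    -- Here the walk first descends to a child x'. If x' is itself the meeting point, ascend once
    -- more on the other side; otherwise the ascent from x' begins by undoing the step.
    · rcases i with _ | i
      · refine ⟨0, j + 1, ?_, by omega⟩
        rw [Function.iterate_succ_apply', ← hij]
        exact h1.symm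
      · refine ⟨i, j, ?_, by omega⟩
        rw [← hij, Function.iterate_succ_apply, h1]

theorem dist_iterate_le (hP : IsHoroParent T P h) (hc : T.Connected) (i : ℕ) (x : V) :
    T.dist x (P^[i] x) ≤ i := by
  induction i with
  | zero => simp
  | succ i ih =>
    rw [Function.iterate_succ_apply']
    have h1 : T.dist (P^[i] x) (P (P^[i] x)) = 1 := SimpleGraph.dist_eq_one_iff_adj.2 (hP.adj _)
    have h2 := hc.dist_triangle (u := x) (v := P^[i] x) (w := P (P^[i] x))
    omega

/-- Choose j₀ minimal. Heights fix i - j at every meeting point, so all meeting points lie above the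
first. A geodesic from x to y, resolved into ascents, shows that i₀ + j₀ does not exceed the
distance. -/
theorem exists_confluent (hP : IsHoroParent T P h) (hc : T.Connected) (x y : V) :
    ∃ i₀ j₀, T.dist x y = i₀ + j₀ ∧
      ∀ i j, P^[i] x = P^[j] y ↔ ∃ l, i = i₀ + l ∧ j = j₀ + l := by
  classical
  have hheight : ∀ {i j}, P^[i] x = P^[j] y → h x + i = h y + j := by
    intro i j hij
    rw [← hP.height_iterate, ← hP.height_iterate, hij]
  obtain ⟨w, hw⟩ := hc.exists_walk_length_eq_dist x y
  obtain ⟨i₁, j₁, h₁, hle⟩ := hP.exists_iterate_eq_of_walk w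
  have hex : ∃ j, ∃ i, P^[i] x = P^[j] y := ⟨j₁, i₁, h₁⟩
  obtain ⟨i₀, h₀⟩ := Nat.find_spec hex
  set j₀ := Nat.find hex
  have key : ∀ i j, P^[i] x = P^[j] y → ∃ l, i = i₀ + l ∧ j = j₀ + l := by
    intro i j hij
    have hj : j₀ ≤ j := Nat.find_min' hex ⟨i, hij⟩
    have e1 := hheight h₀
    have e2 := hheight hij
    exact ⟨j - j₀, by omega, by omega⟩
  refine ⟨i₀, j₀, ?_, fun i j => ⟨key i j, ?_⟩⟩
  · apply le_antisymm
    · have t1 := hc.dist_triangle (u := x) (v := P^[i₀] x) (w := y)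
      have t2 := hP.dist_iterate_le hc i₀ x
      have t3 := hP.dist_iterate_le hc j₀ y
      rw [← h₀, SimpleGraph.dist_comm] at t3
      omega
    · obtain ⟨l, e1, e2⟩ := key _ _ h₁
      omega
  · rintro ⟨l, rfl, rfl⟩
    rw [add_comm, Function.iterate_add_apply, h₀, ← Function.iterate_add_apply, add_comm]

end IsHoroParent

theorem tsum_comp_of_ncard_fiber {P : V → V} (hq : q ≠ 0)
    (hP : ∀ v, {y | P y = v}.ncard = q) (φ : V → ℝ≥0∞) :
    ∑' y, φ (P y) = q * ∑' v, φ v := by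
  rw [← ENNReal.tsum_fiberwise _ P, ← ENNReal.tsum_mul_left]
  refine tsum_congr fun v => ?_
  have hfin : {y | P y = v}.Finite := Set.finite_of_ncard_ne_zero (by rw [hP]; exact hq)
  have : ∀ y : P ⁻¹' {v}, φ (P y) = φ v := fun y => congrArg φ y.2
  simp only [this]
  rw [ENNReal.tsum_const]
  congr 1
  have h1 : ENat.card (P ⁻¹' {v}) = ({y | P y = v}.ncard : ℕ∞) := by
    rw [hfin.cast_ncard_eq]; rfl
  rw [h1, hP]
  rfl

theorem tsum_comp_iterate {P : V → V} (hq : q ≠ 0)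
    (hP : ∀ v, {y | P y = v}.ncard = q) (m : ℕ) (φ : V → ℝ≥0∞) :
    ∑' y, φ (P^[m] y) = q ^ m * ∑' v, φ v := by
  induction m generalizing φ with
  | zero => simp
  | succ m ih =>
    simp only [Function.iterate_succ_apply']
    rw [ih (fun y => φ (P y)), tsum_comp_of_ncard_fiber hq hP, pow_succ, mul_assoc]

/-- Apply the change of variables y ↦ P^m y, which multiplies sums by q^m, to the indicator of v. -/
theorem encard_iterate_fiber {P : V → V} (hq : q ≠ 0)
    (hP : ∀ v, {y | P y = v}.ncard = q) (m : ℕ) (v : V) :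
    {y | P^[m] y = v}.encard = (q ^ m : ℕ) := by
  classical
  have h := tsum_comp_iterate hq hP m (Set.indicator {v} 1)
  have h1 : ∑' y, Set.indicator {v} (1 : V → ℝ≥0∞) (P^[m] y) =
      ∑' y, Set.indicator {y | P^[m] y = v} (fun _ => (1 : ℝ≥0∞)) y := by
    refine tsum_congr fun y => ?_
    simp [Set.indicator_apply]
  rw [h1, ← tsum_subtype, ENNReal.tsum_const, ← tsum_subtype] at h
  simp only [mul_one, Pi.one_apply, tsum_fintype, Finset.univ_unique, Finset.sum_singleton] at h
  have h2 : (({y | P^[m] y = v}.encard : ℕ∞) : ℝ≥0∞) = (((q ^ m : ℕ) : ℕ∞) : ℝ≥0∞) := by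
    rw [Set.encard, h]; simp
  exact_mod_cast h2

theorem finite_iterate_fiber {P : V → V} (hq : q ≠ 0)
    (hP : ∀ v, {y | P y = v}.ncard = q) (m : ℕ) (v : V) : {y | P^[m] y = v}.Finite :=
  Set.finite_of_encard_eq_coe (encard_iterate_fiber hq hP m v)

theorem ncard_iterate_fiber {P : V → V} (hq : q ≠ 0)
    (hP : ∀ v, {y | P y = v}.ncard = q) (m : ℕ) (v : V) : {y | P^[m] y = v}.ncard = q ^ m := by
  rw [Set.ncard, encard_iterate_fiber hq hP m v]; rfl

/-- The number of vertices at distance `n` from a given one. -/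
def sphereCard (q n : ℕ) : ℕ := if n = 0 then 1 else (q + 1) * q ^ (n - 1)

/-- Partition the sphere of radius n + 1 by parents: o has q + 1 outward neighbours, every other
vertex has q. -/
theorem encard_sphere (hT : IsHomogeneousTree T q) (o : V) (n : ℕ) :
    {x | T.dist o x = n}.encard = (sphereCard q n : ℕ∞) := by
  classical
  obtain ⟨P₀, hP₀, hP₀'⟩ := exists_rootParent hT.1 o
  have hnf : ∀ v, (T.neighborSet v).Finite := fun v =>
    Set.finite_of_ncard_ne_zero (by rw [hT.2]; omega)
  induction n with
  | zero =>
    have : {x | T.dist o x = 0} = {o} := by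
      ext x; simp [hT.1.connected.dist_eq_zero_iff, eq_comm]
    rw [this]; simp [sphereCard]
  | succ n ih =>
    have hfin : {x | T.dist o x = n}.Finite := Set.finite_of_encard_eq_coe ih
    let s := hfin.toFinset
    have hs : (s.card : ℕ∞) = sphereCard q n := by
      rw [← ih, hfin.encard_eq_coe_toFinset_card]
    have hs' : s.card = sphereCard q n := by exact_mod_cast hs
    let C : V → Set V := fun v => {y | T.Adj v y ∧ T.dist o y = n + 1}
    have hC : ∀ v ∈ s, (C v).Finite ∧ (C v).ncard = if n = 0 then q + 1 else q := by
      intro v hv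
      have hv : T.dist o v = n := by simpa [s] using hv
      refine ⟨(hnf v).subset fun y hy => hy.1, ?_⟩
      by_cases hn : n = 0
      · have hvo : v = o := by
          rw [hn] at hv
          exact (hT.1.connected.dist_eq_zero_iff.1 hv).symm
        have : C v = T.neighborSet v := by
          ext y
          refine ⟨fun hy => hy.1, fun hy => ⟨hy, ?_⟩⟩
          rw [← hvo, hn, zero_add]
          exact SimpleGraph.dist_eq_one_iff_adj.2 hy
        rw [this, hT.2, if_pos hn]
      · have hvo : v ≠ o := by rintro rfl; simp at hv; omega
        have hpv := hP₀ v hvo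
        have : C v = T.neighborSet v \ {P₀ v} := by
          ext y
          simp only [C, Set.mem_ofPred_eq, Set.mem_sdiff, SimpleGraph.mem_neighborSet,
            Set.mem_singleton_iff]
          refine and_congr_right fun hy => ⟨?_, fun hne => ?_⟩
          · rintro hd rfl
            omega
          · rcases hT.1.dist_eq_dist_add_one_of_adj o hy with h | h
            · exact absurd (hP₀' y v hy.symm h).symm hne
            · omega
        have hmem : P₀ v ∈ T.neighborSet v := hpv.1.symm
        rw [this, Set.ncard_sdiff_singleton_of_mem hmem, hT.2, if_neg hn]
        rfl
    have hU : {x | T.dist o x = n + 1} = ⋃ v ∈ s, C v := by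
      ext y
      simp only [Set.mem_ofPred_eq, Set.mem_iUnion, C]
      constructor
      · intro hy
        have hyo : y ≠ o := by rintro rfl; simp at hy
        refine ⟨P₀ y, ?_, (hP₀ y hyo).1, hy⟩
        have := (hP₀ y hyo).2
        simp only [s, Set.Finite.mem_toFinset, Set.mem_ofPred_eq]
        omega
      · rintro ⟨v, _, _, hy⟩
        exact hy
    have hUf : {x | T.dist o x = n + 1}.Finite := by
      rw [hU]
      exact s.finite_toSet.biUnion fun v hv => (hC v hv).1
    have hcard : hUf.toFinset.card = ∑ v ∈ s, if n = 0 then q + 1 else q := by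
      rw [Finset.card_eq_sum_card_fiberwise (f := P₀) (t := s)]
      · refine Finset.sum_congr rfl fun v hv => ?_
        rw [← (hC v hv).2, ← Set.ncard_coe_finset]
        congr 1
        have hv : T.dist o v = n := by simpa [s] using hv
        ext y
        simp only [Finset.coe_filter, Set.Finite.mem_toFinset, Set.mem_ofPred_eq, C]
        constructor
        · rintro ⟨hy, rfl⟩
          have hyo : y ≠ o := by rintro rfl; simp at hy
          exact ⟨(hP₀ y hyo).1, hy⟩
        · rintro ⟨hy, hd⟩
          exact ⟨hd, hP₀' v y hy (by omega)⟩
      · intro y hy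
        have hy : T.dist o y = n + 1 := by simpa using hy
        have hyo : y ≠ o := by rintro rfl; simp at hy
        have := (hP₀ y hyo).2
        simp only [s, Set.Finite.coe_toFinset, Set.mem_ofPred_eq]
        omega
    rw [hUf.encard_eq_coe_toFinset_card, hcard, Finset.sum_const, hs', smul_eq_mul]
    congr 1
    rcases n with _ | n
    · simp [sphereCard]
    · simp only [sphereCard, Nat.add_eq_zero_iff, one_ne_zero, and_false, if_false,
        Nat.add_sub_cancel]
      ring

theorem pow_le_sphereCard (n : ℕ) : q ^ n ≤ sphereCard q n := by
  unfold sphereCard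
  rcases n with _ | n
  · simp
  · simp only [Nat.add_eq_zero_iff, one_ne_zero, and_false, if_false, Nat.add_sub_cancel]
    rw [pow_succ']
    gcongr
    omega

theorem profile_dist {o : V} {k : V → ℂ} (hk : IsRadial T o k) (x : V) :
    profile T o k (T.dist o x) = k x := by
  have : Function.FactorsThrough k (fun x => T.dist o x) := fun x y h => hk x y h
  exact this.extend_apply 0 x

theorem tsum_radial_enorm (hT : IsHomogeneousTree T q) (o : V) (g : ℕ → ℝ≥0∞) :
    ∑' x, g (T.dist o x) = ∑' n, sphereCard q n * g n := by
  rw [← ENNReal.tsum_fiberwise _ (fun x => T.dist o x)]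
  refine tsum_congr fun n => ?_
  have : ∀ y : (fun x => T.dist o x) ⁻¹' {n}, g (T.dist o y) = g n := fun y => congrArg g y.2
  simp only [this]
  rw [ENNReal.tsum_const]
  congr 1
  have h1 : ENat.card ((fun x => T.dist o x) ⁻¹' {n}) = (sphereCard q n : ℕ∞) :=
    encard_sphere hT o n
  rw [h1]
  rfl

theorem summable_radial_iff (hT : IsHomogeneousTree T q) (o : V) (g : ℕ → ℂ) :
    Summable (fun x => g (T.dist o x)) ↔ Summable fun n => sphereCard q n * ‖g n‖ := by
  rw [← summable_norm_iff]
  have hA : ∀ (ι : Type _) (F : ι → ℂ), (Summable fun x => ‖F x‖) ↔ ∑' x, ‖F x‖ₑ ≠ ∞ := by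
    intro ι F
    constructor
    · intro hF
      have := hF.tsum_ofReal_ne_top
      simpa using this
    · intro hF
      have : ∀ x, ‖F x‖ = (‖F x‖ₑ).toReal := by simp
      simp only [this]
      exact ENNReal.summable_toReal hF
  have hB : ∀ n, (sphereCard q n : ℝ) * ‖g n‖ = ‖(sphereCard q n : ℂ) * g n‖ := by simp
  simp only [hB]
  rw [hA, ← summable_norm_iff (f := fun n => ‖(sphereCard q n : ℂ) * g n‖)]
  simp only [norm_norm]
  have hA' := fun F => hA (ULift ℕ) F
  have hN : (Summable fun n => ‖(sphereCard q n : ℂ) * g n‖) ↔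
      ∑' n, ‖(sphereCard q n : ℂ) * g n‖ₑ ≠ ∞ := by
    rw [← Equiv.ulift.summable_iff, ← Equiv.ulift.tsum_eq]
    exact hA' fun n => (sphereCard q n.down : ℂ) * g n.down
  rw [hN, tsum_radial_enorm hT o fun n => ‖g n‖ₑ]
  simp only [enorm_mul]
  have : ∀ n, ‖(sphereCard q n : ℂ)‖ₑ = sphereCard q n := by
    intro n
    simp [enorm, nnnorm]
  simp only [this]

theorem hasSum_radial (hT : IsHomogeneousTree T q) (o : V) {g : ℕ → ℂ}
    (hg : Summable fun n => sphereCard q n * ‖g n‖) :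
    HasSum (fun x => g (T.dist o x)) (∑' n, sphereCard q n * g n) := by
  have hs := (summable_radial_iff hT o g).2 hg
  have h1 := (Equiv.sigmaFiberEquiv (fun x => T.dist o x)).hasSum_iff.2 hs.hasSum
  have h2 : ∀ n, HasSum (fun y : {x // T.dist o x = n} => g (T.dist o y))
      (sphereCard q n * g n) := by
    intro n
    have hcard : ({x | T.dist o x = n} : Set V).ncard = sphereCard q n := by
      rw [Set.ncard, encard_sphere hT]; rfl
    have : Finite {x // T.dist o x = n} := Set.finite_of_encard_eq_coe (encard_sphere hT o n)
    have := Fintype.ofFinite {x // T.dist o x = n}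
    convert hasSum_fintype _
    rw [Finset.sum_congr rfl fun y _ => congrArg g y.2, Finset.sum_const, nsmul_eq_mul, ← hcard,
      Finset.card_univ, ← Nat.card_eq_fintype_card]
    rfl
  have h3 := h1.sigma h2
  rw [h3.tsum_eq]
  exact hs.hasSum

end Horocycles

/-! ### Upper bound: factorization through ancestors and transference to ℤ. -/

section UpperBound

variable {V : Type*} {T : SimpleGraph V} {q : ℕ} {p : ℝ} {P : V → V} {h : V → ℤ}

theorem enorm_ofReal_of_nonneg {x : ℝ} (hx : 0 ≤ x) : ‖(x : ℂ)‖ₑ = ENNReal.ofReal x := by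
  rw [← ofReal_norm, Complex.norm_real, Real.norm_of_nonneg hx]

open Classical in
/-- The kernel of `g ↦ (x ↦ ∑ i, c i * g (P^[i] x))`. -/
noncomputable def ancestorKernel (P : V → V) (h : V → ℤ) (c : ℕ → ℂ) (x w : V) : ℂ :=
  if ∃ i, P^[i] x = w then c (h w - h x).toNat else 0

/-- The weighted one-sided convolution kernel on `ℤ` attached to `c`. -/
noncomputable def weightedKernel (q : ℕ) (p : ℝ) (c : ℕ → ℂ) (d : ℤ) : ℂ :=
  if 0 ≤ d then (((q : ℝ) ^ ((d : ℝ) / p) : ℝ) : ℂ) * c d.toNat else 0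

/-- A vertex of height N + m lies on the ascending rays of exactly q^m vertices of height N, and the
weight q^{-m} compensates. This splits an ℓ^p norm on the tree into weighted norms along rays. -/
theorem tsum_height_ge (hP : IsHoroParent T P h) (hq : q ≠ 0)
    (hf : ∀ v, {y | P y = v}.ncard = q) (N : ℤ) (φ : V → ℝ≥0∞) :
    ∑' x, (if N ≤ h x then φ x else 0) =
      ∑' ξ, if h ξ = N then ∑' m : ℕ, ((q : ℝ≥0∞) ^ m)⁻¹ * φ (P^[m] ξ) else 0 := by
  have hlevel : ∀ m : ℕ, ∑' ξ, (if h ξ = N then ((q : ℝ≥0∞) ^ m)⁻¹ * φ (P^[m] ξ) else 0) =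
      ∑' x, if h x = N + m then φ x else 0 := by
    intro m
    have h1 := tsum_comp_iterate hq hf m
      (fun x => if h x = N + m then ((q : ℝ≥0∞) ^ m)⁻¹ * φ x else 0)
    simp only [hP.height_iterate, add_left_inj] at h1
    rw [h1, ← ENNReal.tsum_mul_left]
    refine tsum_congr fun x => ?_
    split_ifs
    · rw [← mul_assoc, ENNReal.mul_inv_cancel (by positivity) (by finiteness), one_mul]
    · simp
  have h2 : ∀ x, (if N ≤ h x then φ x else 0) = ∑' m : ℕ, if h x = N + m then φ x else 0 := by
    intro x
    by_cases hx : N ≤ h x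
    · rw [if_pos hx, tsum_eq_single (h x - N).toNat]
      · rw [if_pos (by omega)]
      · intro m hm
        rw [if_neg (by omega)]
    · rw [if_neg hx]
      symm
      refine ENNReal.tsum_eq_zero.2 fun m => if_neg (by omega)
  simp only [h2]
  rw [ENNReal.tsum_comm]
  simp only [← hlevel]
  rw [ENNReal.tsum_comm]
  refine tsum_congr fun ξ => ?_
  split_ifs <;> simp

theorem enorm_weight_rpow (hq : q ≠ 0) (hp : 1 ≤ p) (m : ℕ) (z : ℂ) :
    ‖(((q : ℝ) ^ (-(m : ℝ) / p) : ℝ) : ℂ) * z‖ₑ ^ p = ((q : ℝ≥0∞) ^ m)⁻¹ * ‖z‖ₑ ^ p := by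
  have hp0 : 0 < p := by linarith
  have hq0 : (0 : ℝ) < q := by positivity
  rw [enorm_mul, ENNReal.mul_rpow_of_nonneg _ _ hp0.le, enorm_ofReal_of_nonneg (by positivity),
    ENNReal.ofReal_rpow_of_pos (by positivity), ← Real.rpow_mul hq0.le,
    div_mul_cancel₀ _ hp0.ne', Real.rpow_neg hq0.le, Real.rpow_natCast,
    ENNReal.ofReal_inv_of_pos (by positivity), ENNReal.ofReal_pow hq0.le, ENNReal.ofReal_natCast]

/-- The values of the operator with kernel `ancestorKernel` along an ascending ray are given by a
convolution on `ℤ`. -/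
theorem tsum_ray_le (hP : IsHoroParent T P h) (hq : q ≠ 0) (hp : 1 ≤ p) (c : ℕ → ℂ)
    (g : V →₀ ℂ) (ξ : V) :
    ∑' m : ℕ, ((q : ℝ≥0∞) ^ m)⁻¹ *
        ‖g.sum fun w a => a * ancestorKernel P h c (P^[m] ξ) w‖ₑ ^ p ≤
      opNorm p (fun n j : ℤ => weightedKernel q p c (n - j)) ^ p *
        ∑' m : ℕ, ((q : ℝ≥0∞) ^ m)⁻¹ * ‖g (P^[m] ξ)‖ₑ ^ p := by
  classical
  have hp0 : 0 < p := by linarith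
  have hq0 : (0 : ℝ) < q := by positivity
  have hξ : ∀ m, h (P^[m] ξ) = h ξ + m := fun m => hP.height_iterate m ξ
  -- The values of g on the ray, P^m ξ being placed at -m. The weight q^{-m/p} turns the weighted
  -- norm of the ray into the ℓ^p norm on ℤ.
  let γ : ℤ →₀ ℂ := Finsupp.onFinset (g.support.image fun w => h ξ - h w)
    (fun j => if j ≤ 0 then (((q : ℝ) ^ ((j : ℝ) / p) : ℝ) : ℂ) * g (P^[(-j).toNat] ξ) else 0) (by
      intro j hj
      by_cases hj0 : j ≤ 0
      · simp only [hj0, if_true] at hj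
        refine Finset.mem_image.2 ⟨P^[(-j).toNat] ξ, ?_, ?_⟩
        · exact Finsupp.mem_support_iff.2 (right_ne_zero_of_mul hj)
        · rw [hξ]; omega
      · simp [hj0] at hj)
  have hγ : ∀ m : ℕ, γ (-(m : ℤ)) = (((q : ℝ) ^ (-(m : ℝ) / p) : ℝ) : ℂ) * g (P^[m] ξ) := by
    intro m
    simp only [γ, Finsupp.onFinset_apply]
    rw [if_pos (by omega)]
    simp
  have hγ0 : ∀ j : ℤ, 0 < j → γ j = 0 := by
    intro j hj
    simp only [γ, Finsupp.onFinset_apply]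
    rw [if_neg (by omega)]
  -- Ascending i steps from P^m ξ changes the weight by q^{-(i+m)/p} = q^{-m/p} q^{-i/p}; the factor
  -- q^{i/p} in `weightedKernel` makes up for it.
  have hout : ∀ m : ℕ, (γ.sum fun j a => a * weightedKernel q p c (-(m : ℤ) - j)) =
      (((q : ℝ) ^ (-(m : ℝ) / p) : ℝ) : ℂ) *
        g.sum fun w a => a * ancestorKernel P h c (P^[m] ξ) w := by
    intro m
    rw [Finsupp.sum, Finsupp.sum, Finset.mul_sum]
    have hanc : ∀ w, ancestorKernel P h c (P^[m] ξ) w ≠ 0 → ∃ i : ℕ, P^[i + m] ξ = w ∧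
        ancestorKernel P h c (P^[m] ξ) w = c i := by
      intro w hw
      unfold ancestorKernel at hw ⊢
      by_cases hi : ∃ i, P^[i] (P^[m] ξ) = w
      · rw [if_pos hi]
        obtain ⟨i, hi⟩ := hi
        rw [← Function.iterate_add_apply] at hi
        refine ⟨i, hi, ?_⟩
        rw [← hi, hξ, hξ]
        congr 1
        push_cast
        omega
      · exact absurd (if_neg hi) hw
    symm
    refine Finset.sum_bij_ne_zero (fun w _ _ => h ξ - h w) ?_ ?_ ?_ ?_
    · intro w hw hne
      obtain ⟨i, rfl, -⟩ := hanc w (right_ne_zero_of_mul (right_ne_zero_of_mul hne))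
      rw [Finsupp.mem_support_iff, hξ, show h ξ - (h ξ + ((i + m : ℕ) : ℤ)) = -((i + m : ℕ) : ℤ)
        by ring, hγ]
      refine mul_ne_zero ?_ (Finsupp.mem_support_iff.1 hw)
      exact_mod_cast (Real.rpow_pos_of_pos hq0 _).ne'
    · intro w₁ _ hne₁ w₂ _ hne₂ heq
      obtain ⟨i₁, rfl, -⟩ := hanc w₁ (right_ne_zero_of_mul (right_ne_zero_of_mul hne₁))
      obtain ⟨i₂, rfl, -⟩ := hanc w₂ (right_ne_zero_of_mul (right_ne_zero_of_mul hne₂))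
      rw [hξ, hξ] at heq
      have : i₁ = i₂ := by omega
      rw [this]
    · intro j hj hne
      have hw : 0 ≤ -(m : ℤ) - j := by
        by_contra hcon
        apply right_ne_zero_of_mul hne
        rw [weightedKernel, if_neg hcon]
      obtain ⟨i, hi⟩ : ∃ i : ℕ, j = -((i + m : ℕ) : ℤ) := ⟨(-(m : ℤ) - j).toNat, by omega⟩
      have hg : g (P^[i + m] ξ) ≠ 0 := by
        rw [hi, hγ] at hne
        exact right_ne_zero_of_mul (left_ne_zero_of_mul hne)
      refine ⟨P^[i + m] ξ, Finsupp.mem_support_iff.2 hg, ?_, by rw [hξ]; omega⟩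
      refine mul_ne_zero (by exact_mod_cast (Real.rpow_pos_of_pos hq0 _).ne')
        (mul_ne_zero hg ?_)
      have h1 := right_ne_zero_of_mul hne
      rw [weightedKernel, if_pos hw] at h1
      have h2 : ancestorKernel P h c (P^[m] ξ) (P^[i + m] ξ) = c i := by
        rw [ancestorKernel, if_pos ⟨i, by rw [← Function.iterate_add_apply]⟩, hξ, hξ]
        congr 1
        push_cast
        omega
      rw [h2]
      have h3 : (-(m : ℤ) - j).toNat = i := by omega
      rw [h3] at h1
      exact right_ne_zero_of_mul h1
    · intro w hw hne
      obtain ⟨i, rfl, hi⟩ := hanc w (right_ne_zero_of_mul (right_ne_zero_of_mul hne))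
      rw [hi, hξ, show h ξ - (h ξ + ((i + m : ℕ) : ℤ)) = -((i + m : ℕ) : ℤ) by ring, hγ,
        show -(m : ℤ) - -((i + m : ℕ) : ℤ) = i by push_cast; ring, weightedKernel,
        if_pos (by omega), Int.toNat_natCast]
      have : (q : ℝ) ^ (-(m : ℝ) / p) =
          (q : ℝ) ^ (-((i + m : ℕ) : ℝ) / p) * (q : ℝ) ^ (((i : ℤ) : ℝ) / p) := by
        rw [← Real.rpow_add hq0]
        congr 1
        push_cast
        ring
      rw [this]
      push_cast
      ring
  have hneg : Function.Injective fun m : ℕ => -(m : ℤ) := fun a b hab => by simpa using hab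
  have h1 := ellNorm_le_opNorm_mul hp (fun n j : ℤ => weightedKernel q p c (n - j)) γ
  rw [ellNorm_le_iff hp, ENNReal.mul_rpow_of_nonneg _ _ hp0.le, ellNorm_rpow hp] at h1
  have h2 : ∑' j, ‖γ j‖ₑ ^ p = ∑' m : ℕ, ((q : ℝ≥0∞) ^ m)⁻¹ * ‖g (P^[m] ξ)‖ₑ ^ p := by
    rw [← hneg.tsum_eq]
    · simp only [hγ, enorm_weight_rpow hq hp]
    · intro j hj
      by_cases hj0 : j ≤ 0
      · exact ⟨(-j).toNat, by simp only; omega⟩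
      · exact absurd (by simp [hγ0 j (by omega), hp0]) hj
  rw [h2] at h1
  refine le_trans (le_of_eq ?_) ((ENNReal.tsum_comp_le_tsum_of_injective hneg _).trans h1)
  refine tsum_congr fun m => ?_
  rw [hout, enorm_weight_rpow hq hp]

/-- The output at x depends only on g at ancestors of x, so the half-space of height ≥ -N can be
treated by itself: sum the ray estimate over its bottom level, then let N → ∞. -/
theorem opNorm_ancestorKernel_le (hP : IsHoroParent T P h) (hq : q ≠ 0)
    (hf : ∀ v, {y | P y = v}.ncard = q) (hp : 1 ≤ p) (c : ℕ → ℂ) :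
    opNorm p (ancestorKernel P h c) ≤
      opNorm p (fun n j : ℤ => weightedKernel q p c (n - j)) := by
  have hp0 : 0 < p := by linarith
  refine opNorm_le fun g => ?_
  set A : V → ℂ := fun x => g.sum fun w a => a * ancestorKernel P h c x w with hA
  refine ellNorm_le_of_tendsto hp (l := (Filter.atTop : Filter ℕ))
    (G := fun N x => if -(N : ℤ) ≤ h x then A x else 0) (fun N => ?_) fun x => ?_
  · rw [ellNorm_le_iff hp, ENNReal.mul_rpow_of_nonneg _ _ hp0.le, ellNorm_rpow hp]
    have h1 : ∀ F : V → ℂ, (fun x => ‖if -(N : ℤ) ≤ h x then F x else 0‖ₑ ^ p) =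
        fun x => if -(N : ℤ) ≤ h x then ‖F x‖ₑ ^ p else 0 := by
      intro F
      funext x
      split_ifs <;> simp [hp0]
    rw [h1, tsum_height_ge hP hq hf (-(N : ℤ)) (fun x => ‖A x‖ₑ ^ p)]
    calc _ ≤ ∑' ξ, opNorm p (fun n j : ℤ => weightedKernel q p c (n - j)) ^ p *
          (if h ξ = -(N : ℤ) then
            ∑' m : ℕ, ((q : ℝ≥0∞) ^ m)⁻¹ * ‖g (P^[m] ξ)‖ₑ ^ p else 0) := by
          refine ENNReal.tsum_le_tsum fun ξ => ?_
          split_ifs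
          · exact tsum_ray_le hP hq hp c g ξ
          · simp
      _ = opNorm p (fun n j : ℤ => weightedKernel q p c (n - j)) ^ p *
          ∑' x, (if -(N : ℤ) ≤ h x then ‖g x‖ₑ ^ p else 0) := by
          rw [ENNReal.tsum_mul_left,
            tsum_height_ge hP hq hf (-(N : ℤ)) (fun x => ‖g x‖ₑ ^ p)]
      _ ≤ _ := by
          gcongr with x
          split_ifs <;> simp
  · refine tendsto_const_nhds.congr' ?_
    filter_upwards [Filter.eventually_ge_atTop (-h x).toNat] with N hN
    rw [if_pos (by omega)]

/-- Hölder on each fibre: the p-th power of a sum of at most M terms is at most M^{p-1} times the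
sum of the p-th powers. -/
theorem ellNorm_mapDomain_le (hp : 1 ≤ p) {π : V → V} {M : ℕ} (hfin : ∀ v, {y | π y = v}.Finite)
    (hM : ∀ v, {y | π y = v}.ncard ≤ M) (f : V →₀ ℂ) :
    ellNorm p (f.mapDomain π) ≤ (M : ℝ≥0∞) ^ (1 - 1 / p) * ellNorm p f := by
  classical
  have hp0 : 0 < p := by linarith
  rw [ellNorm_le_iff hp, ENNReal.mul_rpow_of_nonneg _ _ hp0.le, ellNorm_rpow hp,
    ← ENNReal.rpow_mul, ← ENNReal.tsum_fiberwise (fun x => ‖f x‖ₑ ^ p) π, ← ENNReal.tsum_mul_left]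
  refine ENNReal.tsum_le_tsum fun v => ?_
  have hexp : (1 - 1 / p) * p = p - 1 := by field_simp
  rw [hexp]
  have hv : f.mapDomain π v = ∑ y ∈ (hfin v).toFinset, f y := by
    rw [Finsupp.mapDomain, Finsupp.sum_apply, Finsupp.sum]
    simp only [Finsupp.single_apply]
    rw [← Finset.sum_filter]
    refine Finset.sum_subset (fun y hy => ?_) fun y hy hy' => ?_
    · simpa using (Finset.mem_filter.1 hy).2
    · by_contra hne
      exact hy' (Finset.mem_filter.2 ⟨Finsupp.mem_support_iff.2 hne, by simpa using hy⟩)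
  have hsub : ∑' y : π ⁻¹' {v}, ‖f y‖ₑ ^ p = ∑ y ∈ (hfin v).toFinset, ‖f y‖ₑ ^ p := by
    rw [← Finset.tsum_subtype]
    have hset : (π ⁻¹' {v} : Set V) = {y | y ∈ (hfin v).toFinset} := by
      ext y; simp
    exact tsum_congr_set_coe (fun y => ‖f y‖ₑ ^ p) hset
  have hcard : (hfin v).toFinset.card ≤ M := by
    rw [← Set.ncard_eq_toFinset_card _ (hfin v)]
    exact hM v
  rw [hv, hsub]
  calc ‖∑ y ∈ (hfin v).toFinset, f y‖ₑ ^ p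
      ≤ (∑ y ∈ (hfin v).toFinset, ‖f y‖ₑ) ^ p := by
        gcongr; exact enorm_sum_le _ _
    _ ≤ ((hfin v).toFinset.card : ℝ≥0∞) ^ (p - 1) * ∑ y ∈ (hfin v).toFinset, ‖f y‖ₑ ^ p :=
        ENNReal.rpow_sum_le_const_mul_sum_rpow _ _ hp
    _ ≤ _ := by
        gcongr

theorem opNorm_comp_right_le (hp : 1 ≤ p) {π : V → V} {M : ℕ} (hfin : ∀ v, {y | π y = v}.Finite)
    (hM : ∀ v, {y | π y = v}.ncard ≤ M) (K : V → V → ℂ) :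
    opNorm p (fun x y => K x (π y)) ≤ (M : ℝ≥0∞) ^ (1 - 1 / p) * opNorm p K := by
  refine opNorm_le fun f => ?_
  have h1 : ∀ x, (f.sum fun y a => a * K x (π y)) =
      (f.mapDomain π).sum fun w a => a * K x w := by
    intro x
    rw [Finsupp.sum_mapDomain_index (by simp) (by intros; ring)]
  simp only [h1]
  refine (ellNorm_le_opNorm_mul hp K _).trans ?_
  rw [mul_right_comm, mul_comm]
  gcongr
  exact ellNorm_mapDomain_le hp hfin hM f

/-- The terms with j < j₀ vanish, since P^j y is not yet an ancestor of x. For j = j₀ + l the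
ancestor P^j y lies i₀ + l steps above x, and the sum telescopes from κ(i₀ + j₀) in steps of 2. -/
theorem tendsto_sum_ancestorKernel (hP : IsHoroParent T P h) (hc : T.Connected) {κ : ℕ → ℂ}
    (hκ : Filter.Tendsto κ Filter.atTop (nhds 0)) (x y : V) :
    Filter.Tendsto (fun J => ∑ j ∈ Finset.range J,
      ancestorKernel P h (fun i => κ (i + j) - κ (i + j + 2)) x (P^[j] y)) Filter.atTop
      (nhds (κ (T.dist y x))) := by
  obtain ⟨i₀, j₀, hd, hij⟩ := hP.exists_confluent hc x y
  have hterm : ∀ j, ancestorKernel P h (fun i => κ (i + j) - κ (i + j + 2)) x (P^[j] y) =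
      if j₀ ≤ j then κ (i₀ + j₀ + 2 * (j - j₀)) - κ (i₀ + j₀ + 2 * (j - j₀ + 1)) else 0 := by
    intro j
    by_cases hj : j₀ ≤ j
    · have hi : P^[i₀ + (j - j₀)] x = P^[j] y := (hij _ _).2 ⟨j - j₀, rfl, by omega⟩
      rw [if_pos hj, ancestorKernel, if_pos ⟨_, hi⟩, ← hi, hP.height_iterate]
      congr 2 <;> omega
    · rw [if_neg hj, ancestorKernel, if_neg]
      rintro ⟨i, hi⟩
      obtain ⟨l, -, hl⟩ := (hij _ _).1 hi
      omega
  rw [← Filter.tendsto_add_atTop_iff_nat j₀]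
  have hsum : ∀ L, ∑ j ∈ Finset.range (L + j₀),
      ancestorKernel P h (fun i => κ (i + j) - κ (i + j + 2)) x (P^[j] y) =
        κ (T.dist y x) - κ (i₀ + j₀ + 2 * L) := by
    intro L
    rw [add_comm L, Finset.sum_range_add, Finset.sum_eq_zero, zero_add]
    · have : ∀ l, ancestorKernel P h (fun i => κ (i + (j₀ + l)) - κ (i + (j₀ + l) + 2)) x
          (P^[j₀ + l] y) = κ (i₀ + j₀ + 2 * l) - κ (i₀ + j₀ + 2 * (l + 1)) := by
        intro l
        rw [hterm, if_pos (by omega), Nat.add_sub_cancel_left]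
      simp only [this]
      rw [Finset.sum_range_sub' (fun l => κ (i₀ + j₀ + 2 * l)), SimpleGraph.dist_comm, hd]
      rfl
    · intro j hj
      rw [hterm, if_neg (by simpa using hj)]
  simp only [hsum]
  have h2 : Filter.Tendsto (fun L => κ (i₀ + j₀ + 2 * L)) Filter.atTop (nhds 0) :=
    hκ.comp (Filter.tendsto_atTop_mono (fun L => by simp only [id]; omega) Filter.tendsto_id)
  simpa using tendsto_const_nhds.sub h2

end UpperBound

/-! ### Upper bound: one-sided truncation and summation over j. -/

section UpperBound

variable {V : Type*} {T : SimpleGraph V} {q : ℕ} {p : ℝ}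

theorem tsum_pow_sub (r : ℝ≥0∞) (m : ℕ) :
    ∑' n : ℕ, r ^ (n - m) = m + (1 - r)⁻¹ := by
  rw [← ENNReal.summable.sum_add_tsum_nat_add' (k := m)]
  simp only [Nat.add_sub_cancel, ENNReal.tsum_geometric]
  congr 1
  rw [Finset.sum_congr rfl fun n hn => by
    rw [Nat.sub_eq_zero_of_le (Finset.mem_range.1 hn).le, pow_zero]]
  simp

/-- The norm of a one-sided truncation of a convolution kernel with exponential decay on the
other side. -/
theorem opNorm_truncation_le (hp : 1 ≤ p) {r : ℝ} (hr0 : 0 ≤ r) (hr1 : r ≤ 1) {F : ℤ → ℂ}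
    (hF : ∀ d : ℕ, F (-(d : ℤ)) = (r : ℂ) ^ d * F d) (j : ℕ) :
    opNorm p (fun n m : ℤ => if 0 ≤ n - m then
        F (n - m + j) - (r : ℂ) * F (n - m + j + 2) else 0) ≤
      2 * (j + 2 + (1 - ENNReal.ofReal r)⁻¹) * opNorm p (fun n m : ℤ => F (n - m)) := by
  set B := opNorm p (fun n m : ℤ => F (n - m)) with hB
  have hshift : ∀ a : ℤ, opNorm p (fun n m : ℤ => F (n - m + a)) ≤ B := by
    intro a
    have := opNorm_reindex_le hp (Equiv.addRight a) (Equiv.refl ℤ) (fun n m : ℤ => F (n - m))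
    simpa [add_sub_right_comm] using this
  have hr : ‖(r : ℂ)‖ₑ = ENNReal.ofReal r := enorm_ofReal_of_nonneg hr0
  have hr' : ENNReal.ofReal r ≤ 1 := by simpa using hr1
  have hFB : ∀ e, ‖F e‖ₑ ≤ B := by
    intro e
    have h1 := ellNorm_column_le hp (fun n m : ℤ => F (n - m)) 0
    have h2 := enorm_le_ellNorm hp (fun n : ℤ => F (n - 0)) e
    simpa using h2.trans h1
  have hFneg : ∀ d : ℕ, ‖F (-(d : ℤ))‖ₑ ≤ ENNReal.ofReal r ^ d * B := by
    intro d
    rw [hF, enorm_mul, enorm_pow, hr]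
    gcongr
    exact hFB _
  have hFall : ∀ (e : ℤ) (k : ℕ), -(k : ℤ) ≥ e → ‖F e‖ₑ ≤ ENNReal.ofReal r ^ k * B := by
    intro e k hk
    obtain ⟨d, rfl⟩ : ∃ d : ℕ, e = -(d : ℤ) := ⟨(-e).toNat, by omega⟩
    refine (hFneg d).trans ?_
    gcongr ?_ * B
    exact pow_le_pow_of_le_one zero_le hr' (by omega)
  have hmain : opNorm p (fun n m : ℤ => F (n - m + j) - (r : ℂ) * F (n - m + j + 2)) ≤ 2 * B := by
    refine (opNorm_sub_le hp _ _).trans ?_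
    rw [two_mul]
    refine add_le_add (hshift j) ?_
    refine (opNorm_const_mul_le hp _ _).trans ?_
    rw [hr]
    have := hshift (j + 2)
    simp only [← add_assoc] at this
    exact (mul_le_mul' hr' this).trans (by rw [one_mul])
  -- Cutting off at d = 0 need not preserve boundedness in general. Here the discarded half has an
  -- ℓ^1 kernel, because F decays geometrically on the negative axis.
  have htail : opNorm p (fun n m : ℤ => if n - m < 0 then
        F (n - m + j) - (r : ℂ) * F (n - m + j + 2) else 0) ≤
      2 * (j + 1 + (1 - ENNReal.ofReal r)⁻¹) * B := by
    refine (opNorm_convolution_le hp (fun d : ℤ => if d < 0 then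
      F (d + j) - (r : ℂ) * F (d + j + 2) else 0)).trans ?_
    have hinj : Function.Injective fun n : ℕ => -(n : ℤ) - 1 := fun a b hab => by
      simp only at hab; omega
    rw [← hinj.tsum_eq]
    · have h1 : ∀ n : ℕ, ‖if -(n : ℤ) - 1 < 0 then F (-(n : ℤ) - 1 + j) -
          (r : ℂ) * F (-(n : ℤ) - 1 + j + 2) else 0‖ₑ ≤
            2 * B * ENNReal.ofReal r ^ (n - (j + 1)) := by
        intro n
        rw [if_pos (by omega)]
        refine (enorm_sub_le).trans ?_
        rw [enorm_mul, hr]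
        rw [show 2 * B * ENNReal.ofReal r ^ (n - (j + 1)) =
          ENNReal.ofReal r ^ (n - (j + 1)) * B + 1 * (ENNReal.ofReal r ^ (n - (j + 1)) * B) by ring]
        gcongr
        · by_cases hn : j + 1 ≤ n
          · exact hFall _ _ (by omega)
          · rw [Nat.sub_eq_zero_of_le (by omega), pow_zero, one_mul]
            exact hFB _
        · by_cases hn : j + 1 ≤ n
          · exact hFall _ _ (by omega)
          · rw [Nat.sub_eq_zero_of_le (by omega), pow_zero, one_mul]
            exact hFB _
      refine (ENNReal.tsum_le_tsum h1).trans (le_of_eq ?_)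
      rw [ENNReal.tsum_mul_left, tsum_pow_sub]
      push_cast
      ring
    · intro d hd
      by_cases hd0 : d < 0
      · exact ⟨(-d - 1).toNat, by simp only; omega⟩
      · exact absurd (by simp [hd0]) hd
  have hsplit : (fun n m : ℤ => if 0 ≤ n - m then
        F (n - m + j) - (r : ℂ) * F (n - m + j + 2) else 0) = fun n m : ℤ =>
      (F (n - m + j) - (r : ℂ) * F (n - m + j + 2)) - (if n - m < 0 then
        F (n - m + j) - (r : ℂ) * F (n - m + j + 2) else 0) := by
    funext n m
    by_cases h : 0 ≤ n - m
    · rw [if_pos h, if_neg (by omega), sub_zero]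
    · rw [if_neg h, if_pos (by omega), sub_self]
  rw [hsplit]
  refine (opNorm_sub_le hp _ _).trans ((add_le_add hmain htail).trans (le_of_eq ?_))
  ring

/-- The two conditions on F are the traits of q^{δd} a(d) that matter: a is even, and a is inverted
by differences of step 2. The j-th term carries q^{j(1-1/p)} from P^j and q^{-j/p} from the shift of
the weight, together r^j, with r < 1 because p < 2. -/
theorem exists_cvNorm_le (hq : 2 ≤ q) (hT : IsHomogeneousTree T q) (o : V) (hp : 1 ≤ p)
    (hp2 : p < 2) : ∃ C : ℝ≥0, 0 < C ∧ ∀ (k : V → ℂ) (F : ℤ → ℂ),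
      Filter.Tendsto (profile T o k) Filter.atTop (nhds 0) →
      (∀ d : ℕ, F (-(d : ℤ)) = (((q : ℝ) ^ (1 - 2 / p) : ℝ) : ℂ) ^ d * F d) →
      (∀ e : ℕ, (((q : ℝ) ^ ((e : ℝ) / p) : ℝ) : ℂ) *
        (profile T o k e - profile T o k (e + 2)) =
          F e - (((q : ℝ) ^ (1 - 2 / p) : ℝ) : ℂ) * F (e + 2)) →
      cvNorm T o p k ≤ C * opNorm p (fun n m : ℤ => F (n - m)) := by
  obtain ⟨P, h, hP⟩ := exists_isHoroParent hq hT o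
  have hf := hP.fiber_ncard hT
  have hq0 : q ≠ 0 := by omega
  have hqr : (0 : ℝ) < q := by positivity
  have hq1 : (1 : ℝ) < q := by exact_mod_cast hq
  have hp0 : 0 < p := by linarith
  set r : ℝ := (q : ℝ) ^ (1 - 2 / p) with hr
  have hr0 : 0 < r := Real.rpow_pos_of_pos hqr _
  have hr1 : r < 1 := Real.rpow_lt_one_of_one_lt_of_neg hq1 (by
    rw [sub_neg, one_lt_div hp0]; exact hp2)
  set D : ℝ≥0∞ := (1 - ENNReal.ofReal r)⁻¹ with hD
  have hDtop : D ≠ ∞ := by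
    rw [hD, ENNReal.inv_ne_top]
    exact (tsub_pos_of_lt (by simpa using hr1)).ne'
  set C : ℝ≥0∞ := ∑' j : ℕ, ENNReal.ofReal r ^ j * (2 * (j + 2 + D)) with hC
  have hCtop : C ≠ ∞ := by
    have h1 : ∀ j : ℕ, ENNReal.ofReal r ^ j * (2 * (j + 2 + D)) =
        ENNReal.ofReal (2 * (j ^ 1 * r ^ j) + (2 * (2 + D.toReal)) * r ^ j) := by
      intro j
      rw [← ENNReal.ofReal_toReal hDtop, ← ENNReal.ofReal_natCast j,
        ← ENNReal.ofReal_ofNat 2, ← ENNReal.ofReal_add (by positivity) (by positivity),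
        ← ENNReal.ofReal_add (by positivity) (by positivity), ← ENNReal.ofReal_mul (by positivity),
        ← ENNReal.ofReal_pow hr0.le, ← ENNReal.ofReal_mul (by positivity),
        ENNReal.toReal_ofReal ENNReal.toReal_nonneg]
      congr 1
      ring
    rw [hC]
    simp only [h1]
    refine Summable.tsum_ofReal_ne_top ?_
    have hn : ‖r‖ < 1 := by rwa [Real.norm_of_nonneg hr0.le]
    exact ((summable_pow_mul_geometric_of_norm_lt_one 1 hn).mul_left 2).add
      ((summable_geometric_of_norm_lt_one hn).mul_left _)
  -- The added 1 only makes positivity of the constant evident.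
  refine ⟨C.toNNReal + 1, by positivity, fun k F hκ hF hFb => ?_⟩
  set B := opNorm p (fun n m : ℤ => F (n - m)) with hB
  set κ := profile T o k with hκdef
  have hweight : ∀ j : ℕ, opNorm p (fun n m : ℤ =>
      weightedKernel q p (fun i => κ (i + j) - κ (i + j + 2)) (n - m)) ≤
        ENNReal.ofReal ((q : ℝ) ^ (-(j : ℝ) / p)) * (2 * (j + 2 + D) * B) := by
    intro j
    have h1 : (fun n m : ℤ => weightedKernel q p (fun i => κ (i + j) - κ (i + j + 2)) (n - m)) =
        fun n m : ℤ => (((q : ℝ) ^ (-(j : ℝ) / p) : ℝ) : ℂ) * (if 0 ≤ n - m then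
          F (n - m + j) - (r : ℂ) * F (n - m + j + 2) else 0) := by
      funext n m
      rw [weightedKernel]
      split_ifs with hnm
      · obtain ⟨i, hi⟩ := Int.eq_ofNat_of_zero_le hnm
        rw [hi, Int.toNat_natCast]
        have h2 := hFb (i + j)
        push_cast at h2 ⊢
        rw [← h2, ← mul_assoc]
        congr 1
        rw [← Complex.ofReal_mul, ← Real.rpow_add hqr]
        congr 2
        ring
      · rw [mul_zero]
    rw [h1]
    refine (opNorm_const_mul_le hp _ _).trans ?_
    rw [enorm_ofReal_of_nonneg (by positivity)]
    gcongr
    exact opNorm_truncation_le hp hr0.le hr1.le hF j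
  have hterm : ∀ j : ℕ, opNorm p (fun x y =>
      ancestorKernel P h (fun i => κ (i + j) - κ (i + j + 2)) x (P^[j] y)) ≤
        ENNReal.ofReal r ^ j * (2 * (j + 2 + D)) * B := by
    intro j
    refine (opNorm_comp_right_le hp (finite_iterate_fiber hq0 hf j)
      (fun v => (ncard_iterate_fiber hq0 hf j v).le) _).trans ?_
    refine (mul_le_mul_right ((opNorm_ancestorKernel_le hP hq0 hf hp _).trans (hweight j)) _).trans
      (le_of_eq ?_)
    rw [← mul_assoc, ← mul_assoc]
    congr 2
    rw [← ENNReal.ofReal_pow hr0.le, ← ENNReal.ofReal_natCast,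
      ENNReal.ofReal_rpow_of_pos (by positivity), ← ENNReal.ofReal_mul (by positivity)]
    congr 1
    rw [Nat.cast_pow, ← Real.rpow_natCast (q : ℝ), ← Real.rpow_mul hqr.le, ← Real.rpow_add hqr, hr,
      ← Real.rpow_natCast, ← Real.rpow_mul hqr.le]
    congr 1
    field_simp
    ring
  calc cvNorm T o p k ≤ C * B := by
        refine opNorm_le_of_tendsto hp (l := Filter.atTop) (G := fun J x y =>
          ∑ j ∈ Finset.range J,
            ancestorKernel P h (fun i => κ (i + j) - κ (i + j + 2)) x (P^[j] y))
          (fun J => ?_) fun x y => tendsto_sum_ancestorKernel hP hT.1.connected hκ x y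
        refine (opNorm_sum_le hp _ (fun j x y =>
          ancestorKernel P h (fun i => κ (i + j) - κ (i + j + 2)) x (P^[j] y))).trans
          ((Finset.sum_le_sum fun j _ => hterm j).trans ?_)
        rw [← Finset.sum_mul]
        gcongr
        exact ENNReal.sum_le_tsum _
    _ ≤ _ := by
        gcongr
        rw [ENNReal.coe_add, ENNReal.coe_toNNReal hCtop]
        exact le_self_add

end UpperBound

/-! ### Lower bound: functions constant on levels. -/

section LowerBound

variable {V : Type*} {T : SimpleGraph V} {q : ℕ} {p : ℝ} {P : V → V} {h : V → ℤ}

theorem hasSum_telescope_two {a : ℕ → ℂ} (ha : Filter.Tendsto a Filter.atTop (nhds 0))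
    (hs : Summable fun e => ‖a e - a (e + 2)‖) (d : ℕ) :
    HasSum (fun s => a (d + 2 * s) - a (d + 2 * s + 2)) (a d) := by
  have hinj : Function.Injective fun s : ℕ => d + 2 * s := fun s t hst => by
    simp only at hst; omega
  have hsum : Summable fun s => a (d + 2 * s) - a (d + 2 * s + 2) :=
    (hs.comp_injective hinj).of_norm
  refine (hsum.hasSum_iff_tendsto_nat).2 ?_
  have : ∀ n, ∑ s ∈ Finset.range n, (a (d + 2 * s) - a (d + 2 * s + 2)) =
      a d - a (d + 2 * n) := by
    intro n
    exact Finset.sum_range_sub' (fun s => a (d + 2 * s)) n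
  simp only [this]
  have h2 : Filter.Tendsto (fun n => a (d + 2 * n)) Filter.atTop (nhds 0) :=
    ha.comp (Filter.tendsto_atTop_mono (fun n => by simp only [id]; omega) Filter.tendsto_id)
  simpa using tendsto_const_nhds.sub h2

/-- The `j`-th contribution to the convolution of two levels below a vertex. -/
noncomputable def levelTerm (q : ℕ) (a : ℤ → ℂ) (D : ℤ) (l j : ℕ) : ℂ :=
  if D ≤ j then ((q : ℂ) ^ (j - l))⁻¹ * (a (2 * j - D) - a (2 * j - D + 2)) else 0

/-- As j runs over the integers ≥ max(D, 0), 2j - D runs over |D|, |D| + 2, …; the sum telescopes to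
a(|D|), and a is even. -/
theorem hasSum_levelTerm_limit {a : ℤ → ℂ} (heven : ∀ d, a (-d) = a d)
    (ha : Filter.Tendsto (fun d : ℕ => a d) Filter.atTop (nhds 0))
    (hs : Summable fun e : ℕ => ‖a e - a (e + 2)‖) (D : ℤ) :
    HasSum (fun j : ℕ => if D ≤ j then a (2 * j - D) - a (2 * j - D + 2) else 0) (a D) := by
  have h1 := hasSum_telescope_two ha (by exact_mod_cast hs) D.natAbs
  have habs : a (D.natAbs : ℤ) = a D := by
    rcases Int.natAbs_eq D with h | h
    · rw [← h]
    · conv_rhs => rw [h, heven]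
  rw [habs] at h1
  have hinj : Function.Injective fun s : ℕ => D.toNat + s := fun s t hst => by
    simp only at hst; omega
  rw [← hinj.hasSum_iff]
  · convert h1 using 2 with s
    simp only [Function.comp]
    rw [if_pos (by omega)]
    congr 2 <;> omega
  · intro j hj
    rw [if_neg]
    intro hD
    exact hj ⟨j - D.toNat, by simp only; omega⟩

theorem norm_levelTerm_le (hq : q ≠ 0) (a : ℤ → ℂ) (D : ℤ) (l j : ℕ) :
    ‖levelTerm q a D l j‖ ≤ ‖if D ≤ j then a (2 * j - D) - a (2 * j - D + 2) else 0‖ := by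
  unfold levelTerm
  split_ifs
  · rw [norm_mul, norm_inv, norm_pow, Complex.norm_natCast]
    refine mul_le_of_le_one_left (norm_nonneg _) (inv_le_one_of_one_le₀ (one_le_pow₀ ?_))
    exact_mod_cast Nat.one_le_iff_ne_zero.2 hq
  · simp

/-- For l ≥ j the natural subtraction j - l is 0 and the damping factor is 1; dominated convergence
does the rest. -/
theorem tendsto_tsum_levelTerm (hq : q ≠ 0) {a : ℤ → ℂ} (heven : ∀ d, a (-d) = a d)
    (ha : Filter.Tendsto (fun d : ℕ => a d) Filter.atTop (nhds 0))
    (hs : Summable fun e : ℕ => ‖a e - a (e + 2)‖) (D : ℤ) :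
    Filter.Tendsto (fun l => ∑' j, levelTerm q a D l j) Filter.atTop (nhds (a D)) := by
  have h1 := hasSum_levelTerm_limit heven ha hs D
  rw [← h1.tsum_eq]
  refine tendsto_tsum_of_dominated_convergence h1.summable.norm (fun j => ?_)
    (Filter.Eventually.of_forall fun l j => norm_levelTerm_le hq a D l j)
  refine tendsto_const_nhds.congr' ?_
  filter_upwards [Filter.eventually_ge_atTop j] with l hl
  rw [levelTerm, Nat.sub_eq_zero_of_le hl, pow_zero, inv_one, one_mul]

/-- For x at depth l and y at depth m below z, P^j y can be an ancestor of x only as P^i x with i =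
j + l - m. It remains to count such y in the telescoped kernel and convert differences of κ into
differences of a. -/
theorem sum_level_profile (hP : IsHoroParent T P h) (hc : T.Connected) (hq : q ≠ 0)
    (hf : ∀ v, {y | P y = v}.ncard = q) {κ : ℕ → ℂ}
    (hκ : Filter.Tendsto κ Filter.atTop (nhds 0)) {a : ℤ → ℂ} (heven : ∀ d, a (-d) = a d)
    (ha : Filter.Tendsto (fun d : ℕ => a d) Filter.atTop (nhds 0))
    (hs : Summable fun e : ℕ => ‖a e - a (e + 2)‖)
    (hb : ∀ e : ℕ, (((q : ℝ) ^ ((e : ℝ) / 2) : ℝ) : ℂ) * (κ e - κ (e + 2)) = a e - a (e + 2))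
    {l m : ℕ} {x z : V} (hx : P^[l] x = z) :
    ∑ y ∈ (finite_iterate_fiber hq hf m z).toFinset, κ (T.dist y x) =
      (((q : ℝ) ^ (((m : ℝ) - l) / 2) : ℝ) : ℂ) * ∑' j, levelTerm q a (m - l) m j := by
  classical
  have hq0 : (0 : ℝ) < q := by positivity
  set s := (finite_iterate_fiber hq hf m z).toFinset with hsdef
  have hmem : ∀ y, y ∈ s ↔ P^[m] y = z := by intro y; simp [hsdef]
  have hhx : h z = h x + l := by rw [← hx, hP.height_iterate]
  have hterm : ∀ j : ℕ, ∑ y ∈ s, ancestorKernel P h (fun i => κ (i + j) - κ (i + j + 2)) x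
      (P^[j] y) = (((q : ℝ) ^ (((m : ℝ) - l) / 2) : ℝ) : ℂ) * levelTerm q a (m - l) m j := by
    intro j
    by_cases hD : (m : ℤ) - l ≤ j
    · set i : ℕ := j + l - m with hi
      have hval : ∀ y ∈ s, ancestorKernel P h (fun i => κ (i + j) - κ (i + j + 2)) x
          (P^[j] y) = if P^[j] y = P^[i] x then κ (i + j) - κ (i + j + 2) else 0 := by
        intro y hy
        have hhy : h z = h y + m := by rw [← (hmem y).1 hy, hP.height_iterate]
        have hto : (h (P^[j] y) - h x).toNat = i := by rw [hP.height_iterate]; omega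
        unfold ancestorKernel
        by_cases he : P^[j] y = P^[i] x
        · rw [if_pos ⟨i, he.symm⟩, if_pos he, hto]
        · rw [if_neg he, if_neg]
          rintro ⟨i', hi'⟩
          have : i' = i := by
            rw [← hi', hP.height_iterate] at hto
            omega
          exact he (by rw [← hi', this])
      rw [Finset.sum_congr rfl hval, ← Finset.sum_filter, Finset.sum_const, nsmul_eq_mul]
      -- If j ≤ m the common ancestor is at or below z and has q^j descendants y; if j ≥ m it is at
      -- or above z and all q^m vertices y qualify.
      have hcard : (s.filter fun y => P^[j] y = P^[i] x).card = q ^ (min j m) := by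
        rcases le_total j m with hjm | hjm
        · rw [min_eq_left hjm, ← ncard_iterate_fiber hq hf j (P^[i] x), ← Set.ncard_coe_finset]
          congr 1
          ext y
          simp only [Finset.coe_filter, Set.mem_ofPred_eq, hmem]
          refine ⟨fun hy => hy.2, fun hy => ⟨?_, hy⟩⟩
          rw [show m = (m - j) + j by omega, Function.iterate_add_apply, hy,
            ← Function.iterate_add_apply, show m - j + i = l by omega, hx]
        · rw [min_eq_right hjm, ← ncard_iterate_fiber hq hf m z, ← Set.ncard_coe_finset]
          congr 1
          ext y
          simp only [Finset.coe_filter, Set.mem_ofPred_eq, hmem]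
          refine ⟨fun hy => hy.1, fun hy => ⟨hy, ?_⟩⟩
          rw [show j = (j - m) + m by omega, Function.iterate_add_apply, hy,
            show i = (j - m) + l by omega, Function.iterate_add_apply, hx]
      rw [hcard, levelTerm, if_pos hD]
      have hcast : (2 * (j : ℤ) - (m - l)) = ((i + j : ℕ) : ℤ) := by omega
      have hpow : ((q ^ (min j m) : ℕ) : ℂ) = (((q : ℝ) ^ (((m : ℝ) - l) / 2) : ℝ) : ℂ) *
          (((q : ℂ) ^ (j - m))⁻¹ * (((q : ℝ) ^ (((i + j : ℕ) : ℝ) / 2) : ℝ) : ℂ)) := by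
        have h1 : ((q ^ (min j m) : ℕ) : ℝ) = (q : ℝ) ^ (((m : ℝ) - l) / 2) *
            (((q : ℝ) ^ (j - m))⁻¹ * (q : ℝ) ^ (((i + j : ℕ) : ℝ) / 2)) := by
          rw [mul_left_comm, ← Real.rpow_add hq0, Nat.cast_pow, ← Real.rpow_natCast,
            ← Real.rpow_natCast, ← Real.rpow_neg hq0.le, ← Real.rpow_add hq0]
          congr 1
          have e1 : ((i + j : ℕ) : ℝ) = 2 * j - (m - l) := by exact_mod_cast hcast.symm
          rw [e1]
          rcases le_total j m with hjm | hjm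
          · rw [min_eq_left hjm, Nat.sub_eq_zero_of_le hjm]
            push_cast; ring
          · rw [min_eq_right hjm, Nat.cast_sub hjm]
            ring
        have h2 := congrArg (fun t : ℝ => (t : ℂ)) h1
        simpa only [Complex.ofReal_mul, Complex.ofReal_inv, Complex.ofReal_pow,
          Complex.ofReal_natCast] using h2
      rw [hcast, ← hb, hpow]
      ring
    · rw [levelTerm, if_neg hD, mul_zero]
      refine Finset.sum_eq_zero fun y hy => ?_
      have hhy : h z = h y + m := by rw [← (hmem y).1 hy, hP.height_iterate]
      rw [ancestorKernel, if_neg]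
      rintro ⟨i, hi⟩
      have := congrArg h hi
      rw [hP.height_iterate, hP.height_iterate] at this
      omega
  have hsum : Summable fun j => levelTerm q a (m - l) m j :=
    Summable.of_norm_bounded (hasSum_levelTerm_limit heven ha hs (m - l)).summable.norm
      (norm_levelTerm_le hq a _ m)
  have h1 : Filter.Tendsto (fun J => ∑ y ∈ s, ∑ j ∈ Finset.range J,
      ancestorKernel P h (fun i => κ (i + j) - κ (i + j + 2)) x (P^[j] y)) Filter.atTop
      (nhds (∑ y ∈ s, κ (T.dist y x))) :=
    tendsto_finsetSum _ fun y _ => tendsto_sum_ancestorKernel hP hc hκ x y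
  have h2 := (hsum.hasSum.tendsto_sum_nat).const_mul (((q : ℝ) ^ (((m : ℝ) - l) / 2) : ℝ) : ℂ)
  refine tendsto_nhds_unique h1 (h2.congr fun J => ?_)
  rw [Finset.sum_comm, Finset.mul_sum]
  exact Finset.sum_congr rfl fun j _ => (hterm j).symm

theorem tsum_levels (hq : q ≠ 0)
    (hf : ∀ v, {y | P y = v}.ncard = q) (z : V) (m : ℕ) (c : ℝ≥0∞) :
    ∑' y, (open Classical in if P^[m] y = z then c else 0) = (q : ℝ≥0∞) ^ m * c := by
  classical
  have := tsum_comp_iterate hq hf m (fun y => if y = z then c else 0)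
  rw [tsum_ite_eq] at this
  convert this

/-- Spread g over the levels below o, with the normalization that preserves the ℓ^p norm.
Convolution by k then gives, level by level, a truncated convolution on ℤ, which becomes the exact
one as the levels sink. -/
theorem opNorm_le_cvNorm (hq : 2 ≤ q) (hT : IsHomogeneousTree T q) (o : V) (hp : 1 ≤ p)
    {k : V → ℂ} {a : ℤ → ℂ} (hκ : Filter.Tendsto (profile T o k) Filter.atTop (nhds 0))
    (heven : ∀ d, a (-d) = a d)
    (ha : Filter.Tendsto (fun d : ℕ => a d) Filter.atTop (nhds 0))
    (hs : Summable fun e : ℕ => ‖a e - a (e + 2)‖)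
    (hb : ∀ e : ℕ, (((q : ℝ) ^ ((e : ℝ) / 2) : ℝ) : ℂ) *
      (profile T o k e - profile T o k (e + 2)) = a e - a (e + 2)) :
    opNorm p (fun n m : ℤ =>
      (((q : ℝ) ^ ((1 / p - 1 / 2) * ((n - m : ℤ) : ℝ)) : ℝ) : ℂ) * a (n - m)) ≤
        cvNorm T o p k := by
  classical
  obtain ⟨P, h, hP⟩ := exists_isHoroParent hq hT o
  have hf := hP.fiber_ncard hT
  have hq0 : q ≠ 0 := by omega
  have hqr : (0 : ℝ) < q := by positivity
  have hp0 : 0 < p := by linarith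
  set B := cvNorm T o p k with hB
  refine opNorm_le fun g => ?_
  obtain ⟨N₀, hN₀⟩ : ∃ N₀ : ℕ, ∀ n ∈ g.support, 0 ≤ n + N₀ := by
    obtain ⟨b, hb⟩ := g.support.bddBelow
    exact ⟨(-b).toNat, fun n hn => by have := hb hn; omega⟩
  let w : ℕ → ℂ := fun m => (((q : ℝ) ^ (-(m : ℝ) / p) : ℝ) : ℂ)
  -- The integer n is placed at depth n + N + N₀ below o. N₀ makes the depth nonnegative on the
  -- support of g, and N → ∞ removes the influence of o.
  let lev : ℕ → ℤ → ℕ := fun N n => (n + (N + N₀ : ℕ)).toNat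
  let out : ℕ → ℤ → ℂ := fun N n => g.sum fun n' b => b *
    ((((q : ℝ) ^ ((1 / p - 1 / 2) * ((n - n' : ℤ) : ℝ)) : ℝ) : ℂ) *
      ∑' j, levelTerm q a (n' - n) (lev N n') j)
  have hheight : ∀ m y, P^[m] y = o → h y = h o - m := by
    intro m y hy
    rw [← hy, hP.height_iterate]; ring
  -- For |n| ≤ N the truncation to ℕ in `lev` is harmless, and the window exhausts ℤ.
  refine ellNorm_le_of_tendsto hp (l := Filter.atTop)
    (G := fun (N : ℕ) n => if n ∈ Finset.Icc (-(N : ℤ)) N then out N n else 0) (fun N => ?_) fun n => ?_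
  · have hlev : ∀ n ∈ g.support, ((lev N n : ℕ) : ℤ) = n + N + N₀ := by
      intro n hn
      have := hN₀ n hn
      simp only [lev]; omega
    have hlev' : ∀ n ∈ Finset.Icc (-(N : ℤ)) N, ((lev N n : ℕ) : ℤ) = n + N + N₀ := by
      intro n hn
      have := (Finset.mem_Icc.1 hn).1
      simp only [lev]; omega
    let D : ℕ → Finset V := fun m => (finite_iterate_fiber hq0 hf m o).toFinset
    have hD : ∀ m y, y ∈ D m ↔ P^[m] y = o := by intro m y; simp [D]
    let f : V →₀ ℂ := ∑ n ∈ g.support, ∑ y ∈ D (lev N n), Finsupp.single y (w (lev N n) * g n)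
    have hfval : ∀ y, f y =
        ∑ n ∈ g.support, if P^[lev N n] y = o then w (lev N n) * g n else 0 := by
      intro y
      simp only [f, Finsupp.finsetSum_apply, Finsupp.single_apply, Finset.sum_ite_eq', hD]
    -- Different levels are disjoint because their heights differ; the level at depth m has q^m
    -- vertices, each weighted by q^{-m} in the p-th power.
    have hfnorm : ellNorm p f ^ p = ellNorm p g ^ p := by
      rw [ellNorm_rpow hp, ellNorm_rpow hp, tsum_eq_sum (s := g.support) (f := fun n => ‖g n‖ₑ ^ p)
        (fun n hn => by simp [Finsupp.notMem_support_iff.1 hn, hp0])]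
      have h1 : ∀ y, ‖f y‖ₑ ^ p = ∑ n ∈ g.support,
          if P^[lev N n] y = o then ((q : ℝ≥0∞) ^ lev N n)⁻¹ * ‖g n‖ₑ ^ p else 0 := by
        intro y
        rw [hfval]
        by_cases hy : ∃ n ∈ g.support, P^[lev N n] y = o
        · obtain ⟨n, hn, hy⟩ := hy
          have hne : ∀ n' ∈ g.support, n' ≠ n → P^[lev N n'] y ≠ o := by
            intro n' hn' hnn hy'
            have e1 := hheight _ _ hy
            have e2 := hheight _ _ hy'
            rw [hlev n hn] at e1
            rw [hlev n' hn'] at e2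
            omega
          rw [Finset.sum_eq_single n (fun n' hn' hnn => if_neg (hne n' hn' hnn))
              (fun hcon => absurd hn hcon),
            Finset.sum_eq_single n (fun n' hn' hnn => if_neg (hne n' hn' hnn))
              (fun hcon => absurd hn hcon), if_pos hy, if_pos hy, enorm_weight_rpow hq0 hp]
        · push Not at hy
          rw [Finset.sum_eq_zero fun n hn => if_neg (hy n hn),
            Finset.sum_eq_zero fun n hn => if_neg (hy n hn)]
          simp [hp0]
      simp only [h1]
      rw [Summable.tsum_finsetSum fun _ _ => ENNReal.summable]
      refine Finset.sum_congr rfl fun n _ => ?_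
      have := tsum_levels hq0 hf o (lev N n) (((q : ℝ≥0∞) ^ lev N n)⁻¹ * ‖g n‖ₑ ^ p)
      rw [← mul_assoc, ENNReal.mul_inv_cancel (by positivity) (by finiteness), one_mul] at this
      convert this
    have hconv : ∀ n ∈ Finset.Icc (-(N : ℤ)) N, ∀ x, P^[lev N n] x = o →
        (f.sum fun y b => b * treeKernel T o k x y) = w (lev N n) * out N n := by
      intro n hn x hx
      change Finsupp.linearCombination ℂ (treeKernel T o k x) f = _
      simp only [f, map_sum, Finsupp.linearCombination_single, smul_eq_mul]
      simp only [out, Finsupp.sum, Finset.mul_sum]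
      refine Finset.sum_congr rfl fun n' hn' => ?_
      simp only [treeKernel]
      rw [← Finset.mul_sum, sum_level_profile hP hT.1.connected hq0 hf hκ heven ha hs hb hx]
      have e1 := hlev' n hn
      have e2 := hlev n' hn'
      rw [show ((lev N n' : ℕ) : ℤ) - ((lev N n : ℕ) : ℤ) = n' - n by omega]
      have e1' : (lev N n : ℝ) = n + N + N₀ := by exact_mod_cast e1
      have e2' : (lev N n' : ℝ) = n' + N + N₀ := by exact_mod_cast e2
      have hw : w (lev N n') * (((q : ℝ) ^ (((lev N n' : ℝ) - lev N n) / 2) : ℝ) : ℂ) =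
          w (lev N n) * (((q : ℝ) ^ ((1 / p - 1 / 2) * ((n - n' : ℤ) : ℝ)) : ℝ) : ℂ) := by
        simp only [w]
        rw [← Complex.ofReal_mul, ← Complex.ofReal_mul, ← Real.rpow_add hqr, ← Real.rpow_add hqr,
          e1', e2']
        congr 2
        push_cast
        field_simp
        ring
      linear_combination (g n' * ∑' j, levelTerm q a (n' - n) (lev N n') j) * hw
    have hmain := ellNorm_le_opNorm_mul hp (treeKernel T o k) f
    rw [ellNorm_le_iff hp, ENNReal.mul_rpow_of_nonneg _ _ hp0.le, hfnorm,
      ← ENNReal.mul_rpow_of_nonneg _ _ hp0.le] at hmain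
    rw [ellNorm_le_iff hp]
    refine le_trans ?_ hmain
    rw [tsum_eq_sum (s := Finset.Icc (-(N : ℤ)) N) (fun n hn => by simp [hn, hp0])]
    set A : V → ℂ := fun x => f.sum fun y b => b * treeKernel T o k x y with hA
    have h2 : ∀ x, (∑ n ∈ Finset.Icc (-(N : ℤ)) N, if P^[lev N n] x = o then
        ((q : ℝ≥0∞) ^ lev N n)⁻¹ * ‖out N n‖ₑ ^ p else 0) ≤ ‖A x‖ₑ ^ p := by
      intro x
      by_cases hx : ∃ n ∈ Finset.Icc (-(N : ℤ)) N, P^[lev N n] x = o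
      · obtain ⟨n, hn, hx⟩ := hx
        have hne : ∀ n' ∈ Finset.Icc (-(N : ℤ)) N, n' ≠ n → P^[lev N n'] x ≠ o := by
          intro n' hn' hnn hx'
          have e1 := hheight _ _ hx
          have e2 := hheight _ _ hx'
          rw [hlev' n hn] at e1
          rw [hlev' n' hn'] at e2
          omega
        rw [Finset.sum_eq_single n (fun n' hn' hnn => if_neg (hne n' hn' hnn))
          (fun hcon => absurd hn hcon), if_pos hx, hA]
        simp only
        rw [hconv n hn x hx, enorm_weight_rpow hq0 hp]
      · push Not at hx
        rw [Finset.sum_eq_zero fun n hn => if_neg (hx n hn)]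
        exact bot_le
    refine le_trans (le_of_eq ?_) (ENNReal.tsum_le_tsum h2)
    rw [Summable.tsum_finsetSum fun _ _ => ENNReal.summable]
    refine Finset.sum_congr rfl fun n hn => ?_
    have := tsum_levels hq0 hf o (lev N n) (((q : ℝ≥0∞) ^ lev N n)⁻¹ * ‖out N n‖ₑ ^ p)
    rw [← mul_assoc, ENNReal.mul_inv_cancel (by positivity) (by finiteness), one_mul] at this
    rw [if_pos hn]
    convert this.symm
  · have hout : Filter.Tendsto (fun N => out N n) Filter.atTop (nhds (g.sum fun n' b => b *
        ((((q : ℝ) ^ ((1 / p - 1 / 2) * ((n - n' : ℤ) : ℝ)) : ℝ) : ℂ) * a (n - n')))) := by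
      refine tendsto_finsetSum _ fun n' _ => ?_
      refine Filter.Tendsto.const_mul _ (Filter.Tendsto.const_mul _ ?_)
      -- The level sum involves depth of source minus depth of target, the opposite of the
      -- convolution variable.
      rw [← heven, neg_sub]
      refine (tendsto_tsum_levelTerm hq0 heven ha hs (n' - n)).comp ?_
      refine Filter.tendsto_atTop.2 fun m => ?_
      filter_upwards [Filter.eventually_ge_atTop (m + n'.natAbs)] with N hN
      simp only [lev]; omega
    refine hout.congr' ?_
    filter_upwards [Filter.eventually_ge_atTop n.natAbs] with N hN
    rw [if_pos (Finset.mem_Icc.2 (by omega))]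

end LowerBound

/-! ### Spherical functions as Laurent polynomials in q^{iz}. -/

section SphericalFunctions

variable {q : ℕ}

/-- The function `z ↦ q ^ (i d z)`. -/
noncomputable def wave (q : ℕ) (d : ℤ) (z : ℂ) : ℂ := Complex.exp (Complex.I * d * z * Real.log q)

theorem wave_eq_zpow (d : ℤ) (z : ℂ) : wave q d z = wave q 1 z ^ d := by
  rw [wave, wave, ← Complex.exp_int_mul]
  congr 1
  push_cast
  ring

theorem wave_ne_zero (d : ℤ) (z : ℂ) : wave q d z ≠ 0 := Complex.exp_ne_zero _

theorem norm_wave (hq : q ≠ 0) (d : ℤ) (z : ℂ) : ‖wave q d z‖ = (q : ℝ) ^ (-(d * z.im)) := by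
  rw [wave, Complex.norm_exp, Real.rpow_def_of_pos (by positivity)]
  congr 1
  have : Complex.I * d * z * Real.log q = ((d * Real.log q : ℝ) : ℂ) * (Complex.I * z) := by
    push_cast; ring
  rw [this, Complex.re_ofReal_mul]
  simp
  ring

/-- The coefficients of the spherical functions in the characters `q ^ (i d z)`. -/
noncomputable def sphericalCoeff (q : ℕ) (n : ℕ) (d : ℤ) : ℂ :=
  (if d.natAbs ≤ n ∧ (2 : ℤ) ∣ n - d then 1 else 0) -
    (if d.natAbs + 2 ≤ n ∧ (2 : ℤ) ∣ n - d then (q : ℂ)⁻¹ else 0)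

theorem sum_parity_eq {m n : ℕ} (hmn : m ≤ n) (h2 : 2 ∣ n - m) (X : ℤ → ℂ) :
    ∑ d ∈ Finset.Icc (-(n : ℤ)) n, (if d.natAbs ≤ m ∧ (2 : ℤ) ∣ n - d then X d else 0) =
      ∑ i ∈ Finset.range (m + 1), X (m - 2 * i) := by
  rw [← Finset.sum_filter]
  symm
  refine Finset.sum_nbij (fun i : ℕ => (m : ℤ) - 2 * i) ?_ ?_ ?_ (fun _ _ => rfl)
  · intro i hi
    have := Finset.mem_range.1 hi
    refine Finset.mem_filter.2 ⟨Finset.mem_Icc.2 ?_, ?_, ?_⟩ <;> omega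
  · intro i _ j _ hij
    simp only at hij
    omega
  · intro d hd
    have hd := Finset.mem_filter.1 (Finset.mem_coe.1 hd)
    refine ⟨((m - d) / 2).toNat, Finset.mem_coe.2 (Finset.mem_range.2 ?_), ?_⟩
    · omega
    · simp only
      omega

/-- The Chebyshev-type sum `w ^ m + w ^ (m - 2) + ⋯ + w ^ (-m)`. -/
noncomputable def chebSum (w : ℂ) (m : ℕ) : ℂ :=
  ∑ i ∈ Finset.range (m + 1), w ^ ((m : ℤ) - 2 * i)

theorem sub_inv_mul_chebSum {w : ℂ} (hw : w ≠ 0) (m : ℕ) :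
    (w - w⁻¹) * chebSum w m = w ^ (m + 1) - (w ^ (m + 1))⁻¹ := by
  induction m with
  | zero => simp [chebSum]
  | succ m ih =>
    have h1 : chebSum w (m + 1) = w * chebSum w m + (w ^ (m + 1))⁻¹ := by
      rw [chebSum, Finset.sum_range_succ, chebSum, Finset.mul_sum]
      congr 1
      · refine Finset.sum_congr rfl fun i _ => ?_
        rw [← zpow_one_add₀ hw]
        congr 1
        push_cast
        ring
      · rw [show (((m + 1 : ℕ) : ℤ) - 2 * ((m + 1 : ℕ) : ℤ)) = -((m + 1 : ℕ) : ℤ) by ring,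
          zpow_neg, zpow_natCast]
    rw [h1, mul_add, mul_left_comm, ih]
    field_simp
    ring

theorem chebSum_one (m : ℕ) : chebSum 1 m = m + 1 := by simp [chebSum]

theorem chebSum_neg_one (m : ℕ) : chebSum (-1) m = (-1) ^ m * (m + 1) := by
  have : ∀ i : ℕ, (-1 : ℂ) ^ ((m : ℤ) - 2 * i) = (-1) ^ m := by
    intro i
    rw [zpow_sub₀ (by norm_num), zpow_mul]
    simp
  simp only [chebSum, this]
  simp
  ring

/-- The second sum in the spherical function at distance `n`. -/
noncomputable def chebTail (w : ℂ) (n : ℕ) : ℂ := if 2 ≤ n then chebSum w (n - 2) else 0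

theorem sum_sphericalCoeff_mul_wave (n : ℕ) (z : ℂ) :
    ∑ d ∈ Finset.Icc (-(n : ℤ)) n, sphericalCoeff q n d * wave q d z =
      chebSum (wave q 1 z) n - (q : ℂ)⁻¹ * chebTail (wave q 1 z) n := by
  simp only [sphericalCoeff, sub_mul, Finset.sum_sub_distrib]
  congr 1
  · simp only [ite_mul, one_mul, zero_mul]
    rw [sum_parity_eq le_rfl (by simp) (fun d => wave q d z), chebSum]
    exact Finset.sum_congr rfl fun i _ => wave_eq_zpow _ _
  · rw [chebTail]
    split_ifs with hn
    · have h1 : ∀ d : ℤ, (if d.natAbs + 2 ≤ n ∧ (2 : ℤ) ∣ n - d then (q : ℂ)⁻¹ else 0) *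
          wave q d z = (q : ℂ)⁻¹ *
            if d.natAbs ≤ n - 2 ∧ (2 : ℤ) ∣ n - d then wave q d z else 0 := by
        intro d
        have : (d.natAbs + 2 ≤ n ∧ (2 : ℤ) ∣ n - d) ↔ (d.natAbs ≤ n - 2 ∧ (2 : ℤ) ∣ n - d) := by
          refine and_congr_left fun _ => by omega
        simp only [this]
        split_ifs <;> simp
      simp only [h1]
      rw [← Finset.mul_sum, sum_parity_eq (m := n - 2) (by omega) (by omega) (fun d => wave q d z),
        chebSum]
      congr 1
      exact Finset.sum_congr rfl fun i _ => wave_eq_zpow _ _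
    · rw [mul_zero]
      refine Finset.sum_eq_zero fun d _ => ?_
      rw [if_neg (by omega), zero_mul]

theorem log_pos (hq : 2 ≤ q) : 0 < Real.log q := Real.log_pos (by exact_mod_cast hq)

theorem tau_pos (hq : 2 ≤ q) : 0 < tau q := div_pos (by positivity) (log_pos hq)

theorem natCast_cpow_I_mul (hq : 2 ≤ q) (z : ℂ) :
    (q : ℂ) ^ (Complex.I * z) = wave q 1 z := by
  rw [Complex.cpow_def_of_ne_zero (by norm_cast; omega), wave, ← Complex.natCast_log]
  congr 1
  push_cast
  ring

theorem wave_one_int_mul_tau (hq : 2 ≤ q) (j : ℤ) : wave q 1 (j * (tau q : ℂ)) = 1 := by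
  have hL : ((Real.log q : ℝ) : ℂ) ≠ 0 := by exact_mod_cast (log_pos hq).ne'
  rw [wave, Complex.exp_eq_one_iff]
  refine ⟨j, ?_⟩
  rw [tau]
  push_cast at hL ⊢
  field_simp

theorem wave_one_half_tau (hq : 2 ≤ q) : wave q 1 ((tau q : ℂ) / 2) = -1 := by
  have hL : ((Real.log q : ℝ) : ℂ) ≠ 0 := by exact_mod_cast (log_pos hq).ne'
  rw [wave, ← Complex.exp_pi_mul_I]
  congr 1
  rw [tau]
  push_cast at hL ⊢
  field_simp

theorem wave_add (d : ℤ) (z w : ℂ) : wave q d (z + w) = wave q d z * wave q d w := by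
  rw [wave, wave, wave, ← Complex.exp_add]
  congr 1
  ring

/-- Away from the two exceptional lattices the denominator w - w⁻¹ of the c-function, w = q^{iz}, is
invertible. -/
theorem wave_one_sq_ne_one (hq : 2 ≤ q) {z : ℂ} (h1 : ¬ ∃ j : ℤ, z = j * (tau q : ℂ))
    (h2 : ¬ ∃ j : ℤ, z = (tau q : ℂ) / 2 + j * (tau q : ℂ)) : wave q 1 z ^ 2 ≠ 1 := by
  have hL : ((Real.log q : ℝ) : ℂ) ≠ 0 := by exact_mod_cast (log_pos hq).ne'
  intro h
  rw [wave, ← Complex.exp_nat_mul, Complex.exp_eq_one_iff] at h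
  obtain ⟨k, hk⟩ := h
  have hz : z = k * (tau q : ℂ) / 2 := by
    rw [tau]
    push_cast at hL hk ⊢
    have : Complex.I * (2 * (z * Complex.log q)) = Complex.I * (k * (2 * Real.pi)) := by
      linear_combination hk
    have := mul_left_cancel₀ Complex.I_ne_zero this
    field_simp
    linear_combination this / 2
  rcases Int.even_or_odd' k with ⟨j, rfl | rfl⟩
  · exact h1 ⟨j, by rw [hz]; push_cast; ring⟩
  · exact h2 ⟨j, by rw [hz]; push_cast; ring⟩

/-- A square root of `q` through which the powers of `q` with exponents in `ℤ / 2` are expressed. -/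
theorem exists_sqrt (hq : 2 ≤ q) : ∃ s : ℂ, s ≠ 0 ∧ s ^ 2 = q ∧ (q : ℂ) ^ (1 / 2 : ℂ) = s ∧
    (q : ℂ) ^ (-(1 / 2) : ℂ) = s⁻¹ ∧ (∀ n : ℕ, (q : ℂ) ^ (-(n : ℂ) / 2) = (s ^ n)⁻¹) ∧
    ∀ n : ℕ, (((q : ℝ) ^ ((n : ℝ) / 2) : ℝ) : ℂ) = s ^ n := by
  have hq0 : (q : ℂ) ≠ 0 := by norm_cast; omega
  have hs : ((q : ℂ) ^ (1 / 2 : ℂ)) ^ 2 = q := by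
    rw [← Complex.cpow_nat_mul]; norm_num
  refine ⟨(q : ℂ) ^ (1 / 2 : ℂ), ?_, hs, rfl, Complex.cpow_neg _ _, fun n => ?_, fun n => ?_⟩
  · rw [Complex.cpow_ne_zero_iff]; exact Or.inl hq0
  · rw [← Complex.cpow_nat_mul, ← Complex.cpow_neg]
    congr 1
    ring
  · rw [← Complex.cpow_nat_mul, Complex.ofReal_cpow (by positivity)]
    push_cast
    congr 1
    ring

/-- With w = q^{iz}, the two c-function terms combine over the denominator w - w⁻¹ into (w^{n+1} -
w^{-n-1}) - q⁻¹(w^{n-1} - w^{1-n}) for n ≥ 1, a combination of two Chebyshev sums. The exceptional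
points correspond to w = ±1. -/
theorem sphereCard_mul_sphericalFun (hq : 2 ≤ q) (z : ℂ) (n : ℕ) :
    (sphereCard q n : ℂ) * sphericalFun q z n = (((q : ℝ) ^ ((n : ℝ) / 2) : ℝ) : ℂ) *
      ∑ d ∈ Finset.Icc (-(n : ℤ)) n, sphericalCoeff q n d * wave q d z := by
  have hq0 : (q : ℂ) ≠ 0 := by norm_cast; omega
  have hq1 : (q : ℂ) + 1 ≠ 0 := by norm_cast
  obtain ⟨s, hs0, hs2, hs, hs', hsn, hsn'⟩ := exists_sqrt hq
  rw [sum_sphericalCoeff_mul_wave, hsn']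
  have hcard : ∀ m : ℕ, (sphereCard q (m + 1) : ℂ) = (q + 1) * (s ^ m) ^ 2 := by
    intro m
    simp only [sphereCard, Nat.add_eq_zero_iff, one_ne_zero, and_false, if_false,
      Nat.add_sub_cancel]
    push_cast
    rw [← hs2]
    ring
  -- Both exceptional lattices at once, with ε = w = ±1.
  have hflat : ∀ ε : ℂ, ε ^ 2 = 1 → (∀ m, chebSum ε m = ε ^ m * (m + 1)) →
      (sphereCard q n : ℂ) * ((1 + ((q : ℂ) - 1) / ((q : ℂ) + 1) * n) * (s ^ n)⁻¹ * ε ^ n) =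
        s ^ n * (chebSum ε n - (q : ℂ)⁻¹ * chebTail ε n) := by
    intro ε hε hch
    rcases n with _ | _ | n
    · simp [sphereCard, chebTail, hch]
    · rw [hcard, hch, chebTail, if_neg (by omega)]
      push_cast
      field_simp
      rw [← hs2]
      ring
    · rw [hcard, hch, chebTail, if_pos (by omega), show n + 1 + 1 - 2 = n by omega, hch,
        show ε ^ (n + 1 + 1) = ε ^ n by rw [add_assoc, pow_add, hε, mul_one], ← hs2]
      rw [← hs2] at hq0 hq1
      push_cast
      field_simp
      ring
  unfold sphericalFun
  split_ifs with h1 h2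
  · obtain ⟨j, rfl⟩ := h1
    rw [wave_one_int_mul_tau hq, hsn]
    have := hflat 1 (by norm_num) (fun m => by rw [chebSum_one]; simp)
    simpa using this
  · obtain ⟨j, rfl⟩ := h2
    rw [wave_add, wave_one_int_mul_tau hq, wave_one_half_tau hq, mul_one, hsn]
    exact hflat (-1) (by norm_num) chebSum_neg_one
  · set w := wave q 1 z with hw
    have hw0 : w ≠ 0 := wave_ne_zero _ _
    have hw2 : w ^ 2 ≠ 1 := wave_one_sq_ne_one hq h1 h2
    have hww : w - w⁻¹ ≠ 0 := by
      intro h0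
      apply hw2
      field_simp at h0
      linear_combination h0
    have hww2 : w ^ 2 - 1 ≠ 0 := sub_ne_zero.2 hw2
    have hww3 : 1 - w ^ 2 ≠ 0 := sub_ne_zero.2 hw2.symm
    have hIz : (q : ℂ) ^ (Complex.I * z) = w := natCast_cpow_I_mul hq z
    have hIz' : (q : ℂ) ^ (-(Complex.I * z)) = w⁻¹ := by rw [Complex.cpow_neg, hIz]
    have hc1 : cFun q z = s / (q + 1) * ((s * w - s⁻¹ * w⁻¹) / (w - w⁻¹)) := by
      rw [cFun, hs, Complex.cpow_add _ _ hq0, hs, hIz, sub_eq_add_neg (-(1 / 2) : ℂ),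
        Complex.cpow_add _ _ hq0, hs', hIz']
    have hc2 : cFun q (-z) = s / (q + 1) * ((s * w⁻¹ - s⁻¹ * w) / (w⁻¹ - w)) := by
      rw [cFun, hs, mul_neg, Complex.cpow_add _ _ hq0, hs, hIz', sub_neg_eq_add,
        Complex.cpow_add _ _ hq0, hs', neg_neg, hIz]
    have hp1 : (q : ℂ) ^ ((Complex.I * z - 1 / 2) * n) = w ^ n * (s ^ n)⁻¹ := by
      rw [mul_comm _ (n : ℂ), Complex.cpow_nat_mul, sub_eq_add_neg, Complex.cpow_add _ _ hq0, hIz,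
        hs', mul_pow, inv_pow]
    have hp2 : (q : ℂ) ^ ((-(Complex.I * z) - 1 / 2) * n) = (w ^ n)⁻¹ * (s ^ n)⁻¹ := by
      rw [mul_comm _ (n : ℂ), Complex.cpow_nat_mul, sub_eq_add_neg, Complex.cpow_add _ _ hq0, hIz',
        hs', mul_pow, inv_pow, inv_pow]
    rw [hc1, hc2, hp1, hp2]
    have hinv : w⁻¹ - w ≠ 0 := by rw [← neg_sub]; exact neg_ne_zero.2 hww
    -- At n = 0 the sphere has one point, not (q + 1)/q, and the second Chebyshev sum is absent.
    rcases n with _ | n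
    · simp only [sphereCard, chebTail, chebSum]
      rw [← hs2] at hq1 ⊢
      simp
      field_simp
      rw [show (1 - w ^ 2) = -(w ^ 2 - 1) by ring]
      field_simp
      ring
    · have hA := sub_inv_mul_chebSum hw0 (n + 1)
      have hB : (w - w⁻¹) * chebTail w (n + 1) = w ^ n - (w ^ n)⁻¹ := by
        rcases n with _ | n
        · simp [chebTail]
        · rw [chebTail, if_pos (by omega)]
          exact sub_inv_mul_chebSum hw0 n
      apply mul_left_cancel₀ hww
      have hR : (w - w⁻¹) * (s ^ (n + 1) * (chebSum w (n + 1) - (q : ℂ)⁻¹ * chebTail w (n + 1))) =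
          s ^ (n + 1) * ((w ^ (n + 1 + 1) - (w ^ (n + 1 + 1))⁻¹) -
            (q : ℂ)⁻¹ * (w ^ n - (w ^ n)⁻¹)) := by
        rw [← hA, ← hB]; ring
      rw [hR, hcard]
      have e1 : (s * w⁻¹ - s⁻¹ * w) / (w⁻¹ - w) = -((s * w⁻¹ - s⁻¹ * w) / (w - w⁻¹)) := by
        rw [← neg_sub w, div_neg]
      rw [e1]
      have e2 : ∀ A B C D : ℂ, (w - w⁻¹) * (C * (D * (A / (w - w⁻¹)) * (w ^ (n + 1) * (s ^ (n + 1))⁻¹) +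
          D * -(B / (w - w⁻¹)) * ((w ^ (n + 1))⁻¹ * (s ^ (n + 1))⁻¹))) =
          C * D * (s ^ (n + 1))⁻¹ * (A * w ^ (n + 1) - B * (w ^ (n + 1))⁻¹) := by
        intro A B C D
        field_simp
        ring
      rw [e2, ← hs2]
      rw [← hs2] at hq1
      simp only [pow_succ, mul_inv]
      field_simp
      ring

end SphericalFunctions

/-! ### The Abel transform and its inversion. -/

section AbelTransform

variable {q : ℕ} {κ : ℕ → ℂ}

/-- The normalization `q ^ (n / 2) * κ n` of a profile. -/
noncomputable def normProfile (q : ℕ) (κ : ℕ → ℂ) (n : ℕ) : ℂ :=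
  (((q : ℝ) ^ ((n : ℝ) / 2) : ℝ) : ℂ) * κ n

/-- The Abel transform of a radial function with profile `κ`: the coefficients of its spherical
transform in the characters `q ^ (i d z)`. -/
noncomputable def abelTransform (q : ℕ) (κ : ℕ → ℂ) (d : ℤ) : ℂ :=
  ∑' n, normProfile q κ n * sphericalCoeff q n d

theorem norm_sphericalCoeff_le (hq : q ≠ 0) (n : ℕ) (d : ℤ) : ‖sphericalCoeff q n d‖ ≤ 1 := by
  have hq1 : (1 : ℝ) ≤ q := by exact_mod_cast Nat.one_le_iff_ne_zero.2 hq
  have hinv : (q : ℝ)⁻¹ ≤ 1 := inv_le_one_of_one_le₀ hq1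
  have hinv0 : 0 ≤ (q : ℝ)⁻¹ := by positivity
  unfold sphericalCoeff
  split_ifs with h1 h2 h2
  · have : (1 : ℂ) - (q : ℂ)⁻¹ = ((1 - (q : ℝ)⁻¹ : ℝ) : ℂ) := by push_cast; ring
    rw [this, Complex.norm_real, Real.norm_of_nonneg (by linarith)]
    linarith
  · simp
  · omega
  · simp

theorem sphericalCoeff_neg (n : ℕ) (d : ℤ) : sphericalCoeff q n (-d) = sphericalCoeff q n d := by
  unfold sphericalCoeff
  have h1 : ((2 : ℤ) ∣ n - -d) ↔ ((2 : ℤ) ∣ n - d) := by omega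
  simp only [Int.natAbs_neg, h1]

theorem sphericalCoeff_eq_zero {n : ℕ} {d : ℤ} (h : n < d.natAbs) : sphericalCoeff q n d = 0 := by
  unfold sphericalCoeff
  rw [if_neg (by omega), if_neg (by omega), sub_zero]

theorem summable_normProfile_mul_coeff (hq : q ≠ 0) (hs : Summable fun n => ‖normProfile q κ n‖)
    (d : ℤ) : Summable fun n => normProfile q κ n * sphericalCoeff q n d :=
  Summable.of_norm_bounded hs fun n => by
    rw [norm_mul]
    exact mul_le_of_le_one_right (norm_nonneg _) (norm_sphericalCoeff_le hq n d)

theorem abelTransform_neg (d : ℤ) : abelTransform q κ (-d) = abelTransform q κ d := by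
  simp only [abelTransform, sphericalCoeff_neg]

/-- Coefficients at d and d + 2 agree except where n crosses one of the two thresholds; hence the
Abel transform has a local inverse. -/
theorem sphericalCoeff_sub (e n : ℕ) : sphericalCoeff q n e - sphericalCoeff q n (e + 2) =
    (if n = e then 1 else 0) - (if n = e + 2 then (q : ℂ)⁻¹ else 0) := by
  unfold sphericalCoeff
  have h1 : ((e : ℤ) + 2).natAbs = e + 2 := by omega
  have h3 : ((2 : ℤ) ∣ n - ((e : ℤ) + 2)) ↔ ((2 : ℤ) ∣ n - e) := by omega
  simp only [h1, h3, Int.natAbs_natCast]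
  by_cases hd : (2 : ℤ) ∣ n - e
  · rcases lt_trichotomy n e with hn | hn | hn
    · rw [if_neg (by omega), if_neg (by omega), if_neg (by omega), if_neg (by omega),
        if_neg (by omega), if_neg (by omega)]
      ring
    · rw [if_pos (by omega), if_neg (by omega), if_neg (by omega), if_neg (by omega),
        if_pos (by omega), if_neg (by omega)]
      ring
    · rcases lt_trichotomy n (e + 2) with hn2 | hn2 | hn2
      · omega
      · rw [if_pos (by omega), if_pos (by omega), if_pos (by omega), if_neg (by omega),
          if_neg (by omega), if_pos (by omega)]
        ring
      · rw [if_pos (by omega), if_pos (by omega), if_pos (by omega), if_pos (by omega),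
          if_neg (by omega), if_neg (by omega)]
        ring
  · rw [if_neg (by omega), if_neg (by omega), if_neg (by omega), if_neg (by omega),
        if_neg (by omega), if_neg (by omega)]
    ring

/-- Only n = e and n = e + 2 survive, and q^{(e+2)/2} q⁻¹ = q^{e/2}. Both comparisons of norms rest
on this identity. -/
theorem abelTransform_sub (hq : q ≠ 0) (hs : Summable fun n => ‖normProfile q κ n‖) (e : ℕ) :
    (((q : ℝ) ^ ((e : ℝ) / 2) : ℝ) : ℂ) * (κ e - κ (e + 2)) =
      abelTransform q κ e - abelTransform q κ (e + 2) := by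
  have hqr : (0 : ℝ) < q := by positivity
  have hqc : (q : ℂ) ≠ 0 := by exact_mod_cast hq
  rw [abelTransform, abelTransform, ← (summable_normProfile_mul_coeff hq hs _).tsum_sub
    (summable_normProfile_mul_coeff hq hs _)]
  simp only [← mul_sub, sphericalCoeff_sub]
  rw [tsum_eq_sum (s := {e, e + 2})]
  · rw [Finset.sum_pair (by omega), if_pos rfl, if_neg (by omega), if_neg (by omega), if_pos rfl]
    have hpow : (((q : ℝ) ^ (((e + 2 : ℕ) : ℝ) / 2) : ℝ) : ℂ) =
        (((q : ℝ) ^ ((e : ℝ) / 2) : ℝ) : ℂ) * q := by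
      rw [show ((e + 2 : ℕ) : ℝ) / 2 = (e : ℝ) / 2 + 1 by push_cast; ring, Real.rpow_add hqr,
        Real.rpow_one]
      push_cast
      ring
    simp only [normProfile]
    rw [hpow]
    field_simp
    ring
  · intro n hn
    simp only [Finset.mem_insert, Finset.mem_singleton, not_or] at hn
    rw [if_neg hn.1, if_neg hn.2, sub_zero, mul_zero]

theorem norm_le_norm_normProfile (hq : q ≠ 0) (n : ℕ) : ‖κ n‖ ≤ ‖normProfile q κ n‖ := by
  have hq1 : (1 : ℝ) ≤ q := by exact_mod_cast Nat.one_le_iff_ne_zero.2 hq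
  rw [normProfile, norm_mul, Complex.norm_real, Real.norm_of_nonneg (by positivity)]
  exact le_mul_of_one_le_left (norm_nonneg _) (Real.one_le_rpow hq1 (by positivity))

theorem tendsto_profile_zero (hq : q ≠ 0) (hs : Summable fun n => ‖normProfile q κ n‖) :
    Filter.Tendsto κ Filter.atTop (nhds 0) :=
  squeeze_zero_norm (norm_le_norm_normProfile hq) hs.tendsto_atTop_zero

theorem tendsto_abelTransform_zero (hq : q ≠ 0) (hs : Summable fun n => ‖normProfile q κ n‖) :
    Filter.Tendsto (fun d : ℕ => abelTransform q κ d) Filter.atTop (nhds 0) := by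
  have h := tendsto_tsum_of_dominated_convergence (𝓕 := Filter.atTop)
    (f := fun (d : ℕ) n => normProfile q κ n * sphericalCoeff q n d) (g := fun _ => 0) hs
    (fun n => ?_) (Filter.Eventually.of_forall fun d n => ?_)
  · rw [tsum_zero] at h
    exact h
  · refine tendsto_const_nhds.congr' ?_
    filter_upwards [Filter.eventually_gt_atTop n] with d hd
    rw [sphericalCoeff_eq_zero (by simpa using hd), mul_zero]
  · rw [norm_mul]
    exact mul_le_of_le_one_right (norm_nonneg _) (norm_sphericalCoeff_le hq n d)

theorem summable_abelTransform_sub (hq : q ≠ 0) (hs : Summable fun n => ‖normProfile q κ n‖) :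
    Summable fun e : ℕ => ‖abelTransform q κ e - abelTransform q κ (e + 2)‖ := by
  have hq1 : (1 : ℝ) ≤ q := by exact_mod_cast Nat.one_le_iff_ne_zero.2 hq
  refine Summable.of_nonneg_of_le (fun _ => norm_nonneg _) (fun e => ?_)
    (hs.add ((summable_nat_add_iff 2).2 hs))
  rw [← abelTransform_sub hq hs, mul_sub]
  refine (norm_sub_le _ _).trans (add_le_add le_rfl ?_)
  rw [normProfile, norm_mul, norm_mul, Complex.norm_real, Complex.norm_real,
    Real.norm_of_nonneg (by positivity), Real.norm_of_nonneg (by positivity)]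
  gcongr
  omega

/-- Fubini for the double series in (n, d), supported on |d| ≤ n. The choice of X covers both
evaluation at z and pairing with a test function. -/
theorem hasSum_abelTransform_mul (hq : q ≠ 0) (hs : Summable fun n => ‖normProfile q κ n‖)
    {X : ℤ → ℂ}
    (hX : Summable fun n : ℕ => ‖normProfile q κ n‖ * ∑ d ∈ Finset.Icc (-(n : ℤ)) n, ‖X d‖) :
    Summable (fun d => abelTransform q κ d * X d) ∧
      HasSum (fun n : ℕ => normProfile q κ n *
        ∑ d ∈ Finset.Icc (-(n : ℤ)) n, sphericalCoeff q n d * X d)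
        (∑' d, abelTransform q κ d * X d) := by
  let G : ℕ × ℤ → ℂ := fun x => normProfile q κ x.1 * sphericalCoeff q x.1 x.2 * X x.2
  have hG0 : ∀ n : ℕ, ∀ d ∉ Finset.Icc (-(n : ℤ)) n, G (n, d) = 0 := by
    intro n d hd
    simp only [G]
    rw [sphericalCoeff_eq_zero, mul_zero, zero_mul]
    rw [Finset.mem_Icc] at hd
    omega
  have hGn : Summable G := by
    refine Summable.of_norm ((summable_prod_of_nonneg fun _ => norm_nonneg _).2 ⟨fun n => ?_, ?_⟩)
    · exact summable_of_ne_finset_zero (s := Finset.Icc (-(n : ℤ)) n) fun d hd => by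
        rw [hG0 n d hd, norm_zero]
    · refine Summable.of_nonneg_of_le (fun n => tsum_nonneg fun _ => norm_nonneg _)
        (fun n => ?_) hX
      rw [tsum_eq_sum (s := Finset.Icc (-(n : ℤ)) n) fun d hd => by rw [hG0 n d hd, norm_zero],
        Finset.mul_sum]
      refine Finset.sum_le_sum fun d _ => ?_
      simp only [G]
      rw [norm_mul, norm_mul]
      gcongr
      exact mul_le_of_le_one_right (norm_nonneg _) (norm_sphericalCoeff_le hq n d)
  have h1 : HasSum (fun n : ℕ => normProfile q κ n *
      ∑ d ∈ Finset.Icc (-(n : ℤ)) n, sphericalCoeff q n d * X d) (∑' x, G x) := by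
    refine hGn.hasSum.prod_fiberwise fun n => ?_
    rw [Finset.mul_sum]
    convert hasSum_sum_of_ne_finset_zero (L := .unconditional ℤ) (hG0 n) using 1
    exact Finset.sum_congr rfl fun d _ => by simp only [G]; ring
  have h2 : HasSum (fun d => abelTransform q κ d * X d) (∑' x, G x) := by
    have := (Equiv.prodComm ℤ ℕ).hasSum_iff.2 hGn.hasSum
    refine this.prod_fiberwise fun d => ?_
    exact (summable_normProfile_mul_coeff hq hs d).hasSum.mul_right (X d)
  exact ⟨h2.summable, by rwa [h2.tsum_eq]⟩

theorem summable_normProfile_mul_sum {B C ρ σ : ℝ} (hB : ∀ n, ‖normProfile q κ n‖ ≤ B * ρ ^ n)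
    {X : ℤ → ℂ} (hC : ∀ d, ‖X d‖ ≤ C * σ ^ d.natAbs) (hρ : 0 ≤ ρ) (hσ : 1 ≤ σ) (hρσ : ρ * σ < 1) :
    Summable fun n : ℕ => ‖normProfile q κ n‖ * ∑ d ∈ Finset.Icc (-(n : ℤ)) n, ‖X d‖ := by
  have hC0 : 0 ≤ C := by simpa using (norm_nonneg _).trans (hC 0)
  have hB0 : 0 ≤ B := by simpa using (norm_nonneg _).trans (hB 0)
  have hn : ‖ρ * σ‖ < 1 := by rwa [Real.norm_of_nonneg (by positivity)]
  refine Summable.of_nonneg_of_le (fun n => by positivity) (fun n => ?_)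
    (((summable_pow_mul_geometric_of_norm_lt_one 1 hn).mul_left (2 * (B * C))).add
      ((summable_geometric_of_norm_lt_one hn).mul_left (B * C)))
  have h1 : ∑ d ∈ Finset.Icc (-(n : ℤ)) n, ‖X d‖ ≤ (2 * n + 1) * (C * σ ^ n) := by
    have : ∀ d ∈ Finset.Icc (-(n : ℤ)) n, ‖X d‖ ≤ C * σ ^ n := by
      intro d hd
      refine (hC d).trans ?_
      gcongr
      rw [Finset.mem_Icc] at hd
      omega
    refine (Finset.sum_le_card_nsmul _ _ _ this).trans (le_of_eq ?_)
    rw [Int.card_Icc, nsmul_eq_mul]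
    congr 1
    have : ((n : ℤ) + 1 - -(n : ℤ)).toNat = 2 * n + 1 := by omega
    rw [this]
    push_cast
    ring
  calc _ ≤ B * ρ ^ n * ((2 * n + 1) * (C * σ ^ n)) := by
        gcongr
        exact hB n
    _ = _ := by rw [mul_pow]; ring

/-- Only n ≥ |d| contribute, which leaves a geometric tail. -/
theorem norm_abelTransform_le (hq : q ≠ 0) {B ρ : ℝ} (hB : ∀ n, ‖normProfile q κ n‖ ≤ B * ρ ^ n)
    (hρ : 0 ≤ ρ) (hρ1 : ρ < 1) (d : ℤ) :
    ‖abelTransform q κ d‖ ≤ B * (1 - ρ)⁻¹ * ρ ^ d.natAbs := by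
  have h1 : HasSum (fun n : ℕ => if d.natAbs ≤ n then B * ρ ^ n else 0)
      (B * (1 - ρ)⁻¹ * ρ ^ d.natAbs) := by
    have hinj : Function.Injective fun n : ℕ => n + d.natAbs := add_left_injective _
    rw [← hinj.hasSum_iff]
    · have h2 := (hasSum_geometric_of_lt_one hρ hρ1).mul_left (B * ρ ^ d.natAbs)
      have e1 : ((fun n : ℕ => if d.natAbs ≤ n then B * ρ ^ n else 0) ∘ fun n => n + d.natAbs) =
          fun n => B * ρ ^ d.natAbs * ρ ^ n := by
        funext n
        simp only [Function.comp]
        rw [if_pos (by omega), pow_add]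
        ring
      rwa [e1, mul_right_comm]
    · intro n hn
      rw [if_neg]
      intro hle
      exact hn ⟨n - d.natAbs, by simp only; omega⟩
  refine tsum_of_norm_bounded h1 fun n => ?_
  split_ifs with hn
  · rw [norm_mul]
    exact (mul_le_of_le_one_right (norm_nonneg _) (norm_sphericalCoeff_le hq n d)).trans (hB n)
  · rw [sphericalCoeff_eq_zero (by omega), mul_zero, norm_zero]

theorem summable_norm_normProfile {B ρ : ℝ} (hB : ∀ n, ‖normProfile q κ n‖ ≤ B * ρ ^ n)
    (hρ : 0 ≤ ρ) (hρ1 : ρ < 1) : Summable fun n => ‖normProfile q κ n‖ :=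
  Summable.of_nonneg_of_le (fun _ => norm_nonneg _) hB
    ((summable_geometric_of_lt_one hρ hρ1).mul_left B)

end AbelTransform

/-! ### Fourier coefficients on the torus. -/

section Integrals

variable {q : ℕ}

theorem continuous_wave (d : ℤ) : Continuous fun s : ℝ => wave q d s := by
  unfold wave
  fun_prop

theorem wave_tau (hq : 2 ≤ q) (d : ℤ) : wave q d (tau q) = 1 := by
  rw [wave_eq_zpow]
  have := wave_one_int_mul_tau hq 1
  simp only [Int.cast_one, one_mul] at this
  rw [this, one_zpow]

theorem wave_add_tau (hq : 2 ≤ q) (d : ℤ) (z : ℂ) : wave q d (z + tau q) = wave q d z := by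
  rw [wave_add, wave_tau hq, mul_one]

theorem hasDerivAt_wave (d : ℤ) (s : ℝ) :
    HasDerivAt (fun s : ℝ => wave q d s) (Complex.I * d * Real.log q * wave q d s) s := by
  have h1 : HasDerivAt (fun z : ℂ => wave q d z) (Complex.I * d * Real.log q * wave q d s) (s : ℂ) := by
    unfold wave
    have h2 : HasDerivAt (fun z : ℂ => Complex.I * d * z * Real.log q)
        (Complex.I * d * Real.log q) (s : ℂ) := by
      have := ((hasDerivAt_id (s : ℂ)).const_mul (Complex.I * d)).mul_const ((Real.log q : ℝ) : ℂ)
      simpa using this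
    exact h2.cexp.congr_deriv (by ring)
  exact h1.comp_ofReal

/-- The Fourier coefficients of a function on `ℝ / τℤ`. -/
noncomputable def waveIntegral (q : ℕ) (ψ : ℝ → ℂ) (d : ℤ) : ℂ :=
  ∫ s in (-(tau q) / 2)..(tau q / 2), wave q d s * ψ s

/-- Integration by parts. -/
theorem waveIntegral_deriv (hq : 2 ≤ q) {ψ ψ' : ℝ → ℂ} (hψ : ∀ s, HasDerivAt ψ (ψ' s) s)
    (hψ' : Continuous ψ') (hper : Function.Periodic ψ (tau q)) (d : ℤ) :
    waveIntegral q ψ' d = -(Complex.I * d * Real.log q) * waveIntegral q ψ d := by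
  have hψc : Continuous ψ := continuous_iff_continuousAt.2 fun s => (hψ s).continuousAt
  have h1 := intervalIntegral.integral_mul_deriv_eq_deriv_mul (a := -(tau q) / 2)
    (b := tau q / 2) (u := fun s : ℝ => wave q d s)
    (u' := fun s : ℝ => Complex.I * d * Real.log q * wave q d s) (v := ψ) (v' := ψ')
    (fun s _ => hasDerivAt_wave d s) (fun s _ => hψ s)
    ((continuous_const.mul (continuous_wave d)).intervalIntegrable _ _)
    (hψ'.intervalIntegrable _ _)
  have e1 : ψ (tau q / 2) = ψ (-(tau q) / 2) := by
    rw [← hper (-(tau q) / 2)]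
    congr 1
    ring
  have e2 : wave q d ((tau q / 2 : ℝ) : ℂ) = wave q d ((-(tau q) / 2 : ℝ) : ℂ) := by
    rw [← wave_add_tau hq d ((-(tau q) / 2 : ℝ) : ℂ)]
    congr 1
    push_cast
    ring
  rw [waveIntegral, h1, e1, e2, sub_self, zero_sub, neg_mul, waveIntegral,
    ← intervalIntegral.integral_const_mul]
  congr 1
  refine intervalIntegral.integral_congr fun s _ => ?_
  ring

theorem norm_waveIntegral_le (hq : 2 ≤ q) {ψ : ℝ → ℂ} {M : ℝ} (hM : ∀ s, ‖ψ s‖ ≤ M) (d : ℤ) :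
    ‖waveIntegral q ψ d‖ ≤ tau q * M := by
  have := intervalIntegral.norm_integral_le_of_norm_le_const (a := -(tau q) / 2) (b := tau q / 2)
    (f := fun s : ℝ => wave q d s * ψ s) (C := M) (fun s _ => by
      rw [norm_mul, norm_wave (by omega), Complex.ofReal_im, mul_zero, neg_zero, Real.rpow_zero,
        one_mul]
      exact hM s)
  rw [show tau q / 2 - -(tau q) / 2 = tau q by ring, abs_of_pos (tau_pos hq), mul_comm] at this
  exact this

theorem integral_wave (hq : 2 ≤ q) (d : ℤ) :
    ∫ s in (-(tau q) / 2)..(tau q / 2), wave q d (s : ℂ) = if d = 0 then (tau q : ℂ) else 0 := by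
  split_ifs with hd
  · subst hd
    simp [wave]
    ring
  -- Orthogonality from integration by parts against the constant 1: its derivative vanishes while d
  -- log q ≠ 0.
  · have h := waveIntegral_deriv hq (ψ := fun _ => 1) (ψ' := fun _ => 0)
      (fun s => hasDerivAt_const s 1) continuous_const (fun _ => rfl) d
    have h0 : waveIntegral q (fun _ => 0) d = 0 := by simp [waveIntegral]
    have h1 : waveIntegral q (fun _ => 1) d =
        ∫ s in (-(tau q) / 2)..(tau q / 2), wave q d (s : ℂ) := by simp [waveIntegral]
    rw [h0, h1] at h
    have hL : ((Real.log q : ℝ) : ℂ) ≠ 0 := by exact_mod_cast (log_pos hq).ne'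
    have hd' : (d : ℂ) ≠ 0 := by exact_mod_cast hd
    exact (mul_eq_zero.1 h.symm).resolve_left
      (neg_ne_zero.2 (mul_ne_zero (mul_ne_zero Complex.I_ne_zero hd') hL))

theorem waveIntegral_wave (hq : 2 ≤ q) (e d : ℤ) :
    waveIntegral q (fun s => wave q e s) d = if d = -e then (tau q : ℂ) else 0 := by
  have : ∀ s : ℝ, wave q d s * wave q e s = wave q (d + e) s := by
    intro s
    rw [wave_eq_zpow, wave_eq_zpow e, wave_eq_zpow (d + e), zpow_add₀ (wave_ne_zero _ _)]
  rw [waveIntegral]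
  simp only [this]
  rw [integral_wave hq]
  simp only [eq_neg_iff_add_eq_zero]

theorem integral_sphericalFun_mul (hq : 2 ≤ q) {ψ : ℝ → ℂ} (hψ : Continuous ψ) (n : ℕ) :
    (sphereCard q n : ℂ) * ∫ s in (-(tau q) / 2)..(tau q / 2), sphericalFun q (s : ℂ) n * ψ s =
      (((q : ℝ) ^ ((n : ℝ) / 2) : ℝ) : ℂ) *
        ∑ d ∈ Finset.Icc (-(n : ℤ)) n, sphericalCoeff q n d * waveIntegral q ψ d := by
  rw [← intervalIntegral.integral_const_mul]
  simp only [← mul_assoc, sphereCard_mul_sphericalFun hq]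
  simp only [mul_assoc, intervalIntegral.integral_const_mul, Finset.sum_mul]
  congr 1
  rw [intervalIntegral.integral_finsetSum]
  · simp only [intervalIntegral.integral_const_mul, waveIntegral]
  · intro d _
    exact (continuous_const.mul ((continuous_wave d).mul hψ)).intervalIntegrable _ _

end Integrals

/-! ### The spherical transform in the sense of distributions. -/

section SphericalTransform

variable {V : Type*} {T : SimpleGraph V} {q : ℕ} {o : V} {k : V → ℂ}

theorem summable_radial_mul_iff (hT : IsHomogeneousTree T q) (hk : IsRadial T o k) {Φ Y : ℕ → ℂ}
    (hΦ : ∀ n, (sphereCard q n : ℂ) * Φ n = (((q : ℝ) ^ ((n : ℝ) / 2) : ℝ) : ℂ) * Y n) :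
    Summable (fun x => k x * Φ (T.dist o x)) ↔
      Summable fun n => ‖normProfile q (profile T o k) n * Y n‖ := by
  have h1 : (fun x => k x * Φ (T.dist o x)) =
      fun x => (fun n => profile T o k n * Φ n) (T.dist o x) := by
    funext x
    simp only [profile_dist hk]
  rw [h1]
  refine (summable_radial_iff hT o (fun n => profile T o k n * Φ n)).trans ?_
  refine summable_congr fun n => ?_
  rw [← Complex.norm_natCast, ← norm_mul, normProfile, mul_left_comm, hΦ]
  congr 1
  ring

theorem hasSum_radial_mul (hT : IsHomogeneousTree T q) (hk : IsRadial T o k) {Φ Y : ℕ → ℂ}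
    (hΦ : ∀ n, (sphereCard q n : ℂ) * Φ n = (((q : ℝ) ^ ((n : ℝ) / 2) : ℝ) : ℂ) * Y n)
    (hY : Summable fun n => normProfile q (profile T o k) n * Y n) :
    HasSum (fun x => k x * Φ (T.dist o x)) (∑' n, normProfile q (profile T o k) n * Y n) := by
  have h1 : (fun x => k x * Φ (T.dist o x)) =
      fun x => (fun n => profile T o k n * Φ n) (T.dist o x) := by
    funext x
    simp only [profile_dist hk]
  have h2 : ∀ n, (sphereCard q n : ℂ) * (profile T o k n * Φ n) =
      normProfile q (profile T o k) n * Y n := by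
    intro n
    rw [normProfile, mul_left_comm, hΦ]
    ring
  have h3 : Summable fun n => (sphereCard q n : ℝ) * ‖profile T o k n * Φ n‖ := by
    refine hY.norm.congr fun n => ?_
    rw [← h2, norm_mul, Complex.norm_natCast]
  have h4 := hasSum_radial hT o h3
  simp only [h2] at h4
  rwa [h1]

theorem sum_coeff_mul_waveIntegral_wave (hq : 2 ≤ q) (n : ℕ) (d : ℤ) :
    ∑ e ∈ Finset.Icc (-(n : ℤ)) n, sphericalCoeff q n e *
      waveIntegral q (fun s => wave q d s) e = tau q * sphericalCoeff q n d := by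
  simp only [waveIntegral_wave hq]
  rw [Finset.sum_eq_single (-d)]
  · rw [if_pos rfl, sphericalCoeff_neg, mul_comm]
  · intro e _ he
    rw [if_neg he, mul_zero]
  · intro hd
    rw [sphericalCoeff_eq_zero, zero_mul]
    rw [Finset.mem_Icc] at hd
    omega

theorem hasSum_character {m : ℂ → ℂ} (h : IsSphericalTransform T o q k m) (d : ℤ) :
    HasSum (fun x : V => k x * ∫ s in (-(tau q) / 2)..(tau q / 2),
      sphericalFun q (s : ℂ) (T.dist o x) * wave q d s) (waveIntegral q (fun s => m s) d) := by
  have h1 := h (character q d)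
  have h2 : (∫ s in (-(tau q) / 2)..(tau q / 2), m (s : ℂ) * wave q d s) =
      waveIntegral q (fun s => m s) d := by
    simp only [waveIntegral, mul_comm]
  rwa [← h2]

/-- An unconditionally convergent complex series converges absolutely, so testing on the characters
d = 0 and d = 1 already bounds every term of the profile. -/
theorem summable_normProfile_of_transform (hq : 2 ≤ q) (hT : IsHomogeneousTree T q)
    (hk : IsRadial T o k) {m : ℂ → ℂ} (h : IsSphericalTransform T o q k m) :
    Summable fun n => ‖normProfile q (profile T o k) n‖ := by
  have hsum : ∀ d : ℤ, Summable fun n =>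
      ‖normProfile q (profile T o k) n * (tau q * sphericalCoeff q n d)‖ := by
    intro d
    have h1 := (hasSum_character h d).summable
    rw [summable_radial_mul_iff hT hk (Φ := fun n => ∫ s in (-(tau q) / 2)..(tau q / 2),
      sphericalFun q (s : ℂ) n * wave q d s)
      (integral_sphericalFun_mul hq (continuous_wave d))] at h1
    simpa only [sum_coeff_mul_waveIntegral_wave hq] using h1
  have hq2 : (2 : ℝ) ≤ q := by exact_mod_cast hq
  -- The parity of n decides which of d = 0, 1 contributes; that coefficient is 1 or 1 - 1/q ≥ 1/2.
  have hcoef : ∀ n : ℕ, 1 / 2 ≤ ‖sphericalCoeff q n 0‖ + ‖sphericalCoeff q n 1‖ := by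
    intro n
    have hinv : (1 / 2 : ℝ) ≤ ‖(1 : ℂ) - (q : ℂ)⁻¹‖ := by
      have h1 := norm_sub_norm_le (1 : ℂ) (q : ℂ)⁻¹
      rw [norm_one, norm_inv, Complex.norm_natCast] at h1
      have : (q : ℝ)⁻¹ ≤ 2⁻¹ := inv_anti₀ (by norm_num) hq2
      linarith
    rcases Nat.even_or_odd' n with ⟨j, rfl | rfl⟩
    · refine le_add_of_le_of_nonneg ?_ (norm_nonneg _)
      rw [sphericalCoeff, if_pos (by omega)]
      split_ifs
      · exact hinv
      · norm_num
    · refine le_add_of_nonneg_of_le (norm_nonneg _) ?_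
      rw [sphericalCoeff, if_pos (by omega)]
      split_ifs
      · exact hinv
      · norm_num
  have hτ := tau_pos hq
  refine Summable.of_nonneg_of_le (fun _ => norm_nonneg _) (fun n => ?_)
    (((hsum 0).add (hsum 1)).mul_left (2 / tau q))
  rw [norm_mul, norm_mul, norm_mul, norm_mul, Complex.norm_real, Real.norm_of_nonneg hτ.le]
  have := mul_le_mul_of_nonneg_left (hcoef n) (norm_nonneg (normProfile q (profile T o k) n))
  field_simp
  linarith

theorem waveIntegral_transform (hq : 2 ≤ q) (hT : IsHomogeneousTree T q)
    (hk : IsRadial T o k) {m : ℂ → ℂ} (h : IsSphericalTransform T o q k m) (d : ℤ) :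
    waveIntegral q (fun s => m s) d = tau q * abelTransform q (profile T o k) d := by
  have hq0 : q ≠ 0 := by omega
  have hs := summable_normProfile_of_transform hq hT hk h
  have h1 := hasSum_radial_mul hT hk (Φ := fun n => ∫ s in (-(tau q) / 2)..(tau q / 2),
      sphericalFun q (s : ℂ) n * wave q d s)
      (integral_sphericalFun_mul hq (continuous_wave d)) (by
        simp only [sum_coeff_mul_waveIntegral_wave hq, mul_left_comm _ (tau q : ℂ)]
        exact (summable_normProfile_mul_coeff hq0 hs d).mul_left _)
  rw [(hasSum_character h d).unique h1]
  simp only [sum_coeff_mul_waveIntegral_wave hq, mul_left_comm _ (tau q : ℂ)]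
  rw [tsum_mul_left, abelTransform]

end SphericalTransform

/-! ### Contour shifts and boundary values in the strip. -/

section Strip

variable {q : ℕ} {m : ℂ → ℂ} {t : ℝ}

theorem isOpen_strip (t : ℝ) : IsOpen (strip t) :=
  isOpen_lt Complex.continuous_im.abs continuous_const

theorem wave_mul_I (hq : q ≠ 0) (d : ℤ) (v : ℝ) :
    wave q d (v * Complex.I) = (((q : ℝ) ^ (-(d * v)) : ℝ) : ℂ) := by
  rw [Real.rpow_def_of_pos (by positivity), Complex.ofReal_exp, wave]
  congr 1
  push_cast
  linear_combination (d * v * Complex.log q) * Complex.I_mul_I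

theorem add_mul_I_mem_strip {s v : ℝ} (hv : |v| < t) : (s : ℂ) + v * Complex.I ∈ strip t := by
  simpa [strip] using hv

theorem continuous_comp_line (hm : DifferentiableOn ℂ m (strip t)) {v : ℝ} (hv : |v| < t) :
    Continuous fun s : ℝ => m (s + v * Complex.I) :=
  hm.continuousOn.comp_continuous (by fun_prop) fun _ => add_mul_I_mem_strip hv

/-- Cauchy's theorem on a rectangle of width τ: the vertical sides cancel by periodicity, and
q^{idz} picks up the factor q^{-dv} on the line Im z = v. -/
theorem waveIntegral_shift (hq : 2 ≤ q) (hm : IsHolomorphicWeylInvariant q t m) {v : ℝ}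
    (hv : |v| < t) (d : ℤ) :
    waveIntegral q (fun s => m (s + v * Complex.I)) d =
      (((q : ℝ) ^ (d * v) : ℝ) : ℂ) * waveIntegral q (fun s => m s) d := by
  have hq0 : q ≠ 0 := by omega
  have hqr : (0 : ℝ) < q := by positivity
  set f : ℂ → ℂ := fun z => wave q d z * m z with hf
  have hfd : DifferentiableOn ℂ f (strip t) := by
    refine DifferentiableOn.mul ?_ hm.1
    unfold wave
    fun_prop
  have hrect := Complex.integral_boundary_rect_eq_zero_of_differentiableOn f
    ((-(tau q) / 2 : ℝ) : ℂ) (((tau q / 2 : ℝ) : ℂ) + v * Complex.I) (hfd.mono (by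
      intro z hz
      rw [Complex.mem_reProdIm] at hz
      have h2 := hz.2
      simp only [Complex.ofReal_im, Complex.add_im, Complex.mul_im, Complex.ofReal_re,
        Complex.I_im, Complex.I_re, mul_one, mul_zero, add_zero, zero_add] at h2
      have h3 := Set.abs_sub_left_of_mem_uIcc h2
      rw [sub_zero, sub_zero] at h3
      exact h3.trans_lt hv))
  simp only [Complex.ofReal_im, Complex.add_im, Complex.mul_im, Complex.ofReal_re,
    Complex.I_im, Complex.I_re, mul_one, mul_zero, add_zero, zero_add, Complex.add_re,
    Complex.mul_re, sub_zero, Complex.ofReal_zero, zero_mul] at hrect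
  have hside : (∫ y in (0 : ℝ)..v, f (((tau q / 2 : ℝ) : ℂ) + y * Complex.I)) =
      ∫ y in (0 : ℝ)..v, f (((-(tau q) / 2 : ℝ) : ℂ) + y * Complex.I) := by
    refine intervalIntegral.integral_congr fun y hy => ?_
    have hy' := Set.abs_sub_left_of_mem_uIcc hy
    rw [sub_zero, sub_zero] at hy'
    have hmem := add_mul_I_mem_strip (s := -(tau q) / 2) (hy'.trans_lt hv)
    have he : ((tau q / 2 : ℝ) : ℂ) + y * Complex.I =
        ((-(tau q) / 2 : ℝ) : ℂ) + y * Complex.I + tau q := by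
      push_cast; ring
    simp only [hf]
    rw [he, wave_add_tau hq, (hm.2 _ hmem).2]
  rw [hside, add_sub_cancel_right, sub_eq_zero] at hrect
  have h1 : (∫ s in (-(tau q) / 2)..(tau q / 2), f ((s : ℂ) + v * Complex.I)) =
      (((q : ℝ) ^ (-(d * v)) : ℝ) : ℂ) * waveIntegral q (fun s => m (s + v * Complex.I)) d := by
    rw [waveIntegral, ← intervalIntegral.integral_const_mul]
    refine intervalIntegral.integral_congr fun s _ => ?_
    simp only [hf]
    rw [wave_add, wave_mul_I hq0]
    ring
  rw [h1] at hrect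
  have h2 : (∫ s in (-(tau q) / 2)..(tau q / 2), f (s : ℂ)) = waveIntegral q (fun s => m s) d :=
    rfl
  rw [← h2, hrect, ← mul_assoc, ← Complex.ofReal_mul, ← Real.rpow_add hqr]
  simp

/-- Test the boundary value on characters, where the shift formula makes the limit v → t explicit.
-/
theorem invFourier_boundaryValue (hq : 2 ≤ q) (ht : 0 < t) (hm : IsHolomorphicWeylInvariant q t m)
    {u : TorusDistribution (tau q)} (hu : IsBoundaryValue q m t u) (d : ℤ) :
    invFourier q u d = (((q : ℝ) ^ (t * d) : ℝ) : ℂ) *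
      ((tau q : ℂ)⁻¹ * waveIntegral q (fun s => m s) d) := by
  have hqr : (0 : ℝ) < q := by positivity
  have h1 := hu (character q d)
  have h2 : Filter.Tendsto (fun v : ℝ => (((q : ℝ) ^ (d * v) : ℝ) : ℂ) *
      waveIntegral q (fun s => m s) d) (nhdsWithin t (Set.Iio t))
      (nhds ((((q : ℝ) ^ (d * t) : ℝ) : ℂ) * waveIntegral q (fun s => m s) d)) := by
    refine Filter.Tendsto.mono_left ?_ nhdsWithin_le_nhds
    have : Continuous fun v : ℝ => (((q : ℝ) ^ (d * v) : ℝ) : ℂ) *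
        waveIntegral q (fun s => m s) d := by
      refine Continuous.mul (Complex.continuous_ofReal.comp ?_) continuous_const
      exact Continuous.rpow continuous_const (continuous_const.mul continuous_id)
        fun _ => Or.inl hqr.ne'
    exact this.tendsto t
  have h3 := tendsto_nhds_unique (h2.congr' ?_) h1
  · rw [invFourier, ← h3, mul_comm t]
    ring
  · have hmem : Set.Ioo (-t) t ∈ nhdsWithin t (Set.Iio t) :=
      Ioo_mem_nhdsLT (by linarith)
    filter_upwards [hmem] with v hv
    rw [← waveIntegral_shift hq hm (abs_lt.2 hv)]
    exact intervalIntegral.integral_congr fun s _ => mul_comm _ _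

/-- On the horizontal line through z the function is continuous and periodic with summable Fourier
coefficients, so its Fourier series converges to it pointwise. -/
theorem hasSum_fourier_of_holomorphic (hq : 2 ≤ q) (hm : IsHolomorphicWeylInvariant q t m)
    {a : ℤ → ℂ} (heven : ∀ d, a (-d) = a d)
    (ha : ∀ d, waveIntegral q (fun s => m s) d = tau q * a d) {z : ℂ} (hz : z ∈ strip t)
    (hs : Summable fun d => a d * wave q d z) : HasSum (fun d => a d * wave q d z) (m z) := by
  have hq0 : q ≠ 0 := by omega
  have hτ := tau_pos hq
  have hτ' : (tau q : ℂ) ≠ 0 := by exact_mod_cast hτ.ne'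
  have hL : ((Real.log q : ℝ) : ℂ) ≠ 0 := by exact_mod_cast (log_pos hq).ne'
  have : Fact (0 < tau q) := ⟨hτ⟩
  have hv : |z.im| < t := hz
  let g : ℝ → ℂ := fun s => m (s + z.im * Complex.I)
  have hgc : Continuous g := continuous_comp_line hm.1 hv
  have hgp : Function.Periodic g (tau q) := by
    intro s
    have := (hm.2 _ (add_mul_I_mem_strip (s := s) hv)).2
    simp only [g]
    rw [← this]
    congr 1
    push_cast; ring
  let G : C(AddCircle (tau q), ℂ) := ⟨hgp.lift, continuous_coinduced_dom.2 hgc⟩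
  have hG : ∀ s : ℝ, G (s : AddCircle (tau q)) = g s := fun s => rfl
  have hfour : ∀ (n : ℤ) (s : ℝ), (fourier n (s : AddCircle (tau q)) : ℂ) = wave q n s := by
    intro n s
    rw [fourier_coe_apply, wave]
    congr 1
    have hpi : (Real.pi : ℂ) ≠ 0 := by exact_mod_cast Real.pi_ne_zero
    rw [tau]
    push_cast at hL ⊢
    field_simp
  have hcoef : ∀ d, fourierCoeff G d = a d * wave q d (z.im * Complex.I) := by
    intro d
    rw [fourierCoeff_eq_intervalIntegral _ _ (-(tau q) / 2),
      show -(tau q) / 2 + tau q = tau q / 2 by ring]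
    simp only [hG, hfour, smul_eq_mul]
    -- The d-th Fourier coefficient integrates against the character of index -d; evenness of a
    -- restores the sign.
    have h1 := waveIntegral_shift hq hm hv (-d)
    rw [ha, heven] at h1
    change (1 / tau q) • waveIntegral q g (-d) = _
    rw [h1, wave_mul_I hq0, Complex.real_smul]
    push_cast
    field_simp
  have hz' : z = z.re + z.im * Complex.I := (Complex.re_add_im z).symm
  have hterm : ∀ d, a d * wave q d z =
      fourierCoeff G d • (fourier d (z.re : AddCircle (tau q)) : ℂ) := by
    intro d
    rw [hcoef, hfour, smul_eq_mul]
    conv_lhs => rw [hz', wave_add]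
    ring
  have hsum : Summable (fourierCoeff G) := by
    refine Summable.of_norm ?_
    refine hs.norm.congr fun d => ?_
    rw [hterm, norm_smul, hfour, norm_wave hq0]
    simp
  have h2 := has_pointwise_sum_fourier_series_of_summable hsum (z.re : AddCircle (tau q))
  rw [hG] at h2
  simp only [hterm]
  convert h2 using 2

end Strip

/-! ### Decay of the Fourier coefficients of test functions. -/

section TestFunctions

variable {q : ℕ}

theorem norm_waveIntegral_mul_sq_le (hq : 2 ≤ q) (ψ : TestFun (tau q)) {M : ℝ}
    (hM : ∀ s : ℝ, ‖iteratedDeriv 2 (ψ : ℝ → ℂ) s‖ ≤ M) (d : ℤ) :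
    ‖waveIntegral q ψ d‖ * (d * Real.log q) ^ 2 ≤ tau q * M := by
  obtain ⟨hsm, hper⟩ := ψ.2
  obtain ⟨hd1, hsm1⟩ := contDiff_infty_iff_deriv.1 hsm
  obtain ⟨hd2, hsm2⟩ := contDiff_infty_iff_deriv.1 hsm1
  have hper1 : Function.Periodic (deriv (ψ : ℝ → ℂ)) (tau q) := by
    intro s
    rw [← deriv_comp_add_const]
    congr 1
    funext r
    exact hper r
  have h1 := waveIntegral_deriv hq (fun s => (hd1 s).hasDerivAt) hsm1.continuous hper d
  have h2 := waveIntegral_deriv hq (fun s => (hd2 s).hasDerivAt) hsm2.continuous hper1 d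
  have h3 : iteratedDeriv 2 (ψ : ℝ → ℂ) = deriv (deriv (ψ : ℝ → ℂ)) := by
    rw [iteratedDeriv_succ, iteratedDeriv_one]
  rw [h3] at hM
  refine le_trans (le_of_eq ?_) (norm_waveIntegral_le hq hM d)
  rw [h2, h1]
  simp only [norm_mul, norm_neg, Complex.norm_I, one_mul, Complex.norm_real, Complex.norm_intCast,
    Real.norm_eq_abs]
  rw [← sq_abs, abs_mul]
  ring

/-- The decay of the Fourier coefficients of a test function. -/
noncomputable def fourierDecay (q : ℕ) (d : ℤ) : ℝ :=
  (if d = 0 then tau q else 0) + tau q / Real.log q ^ 2 * (1 / (d : ℝ) ^ 2)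

theorem summable_fourierDecay : Summable (fourierDecay q) :=
  (summable_of_ne_finset_zero (s := {0}) fun d hd => if_neg (by simpa using hd)).add
    ((Real.summable_one_div_int_pow.2 (by norm_num)).mul_left _)

theorem norm_waveIntegral_le_fourierDecay (hq : 2 ≤ q) (ψ : TestFun (tau q)) {M : ℝ}
    (hM : ∀ j ≤ 2, ∀ s : ℝ, ‖iteratedDeriv j (ψ : ℝ → ℂ) s‖ ≤ M) (d : ℤ) :
    ‖waveIntegral q ψ d‖ ≤ M * fourierDecay q d := by
  have hL := log_pos hq
  unfold fourierDecay
  -- At d = 0 the term 1/d² has the value 0, so the bound there comes from the separate summand τ.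
  split_ifs with hd
  · subst hd
    have := norm_waveIntegral_le hq (ψ := ψ) (fun s => by simpa using hM 0 (by norm_num) s) 0
    simpa [mul_comm] using this
  · have hd' : (d : ℝ) ≠ 0 := by exact_mod_cast hd
    have h1 := norm_waveIntegral_mul_sq_le hq ψ (hM 2 le_rfl) d
    have h2 : 0 < ((d : ℝ) * Real.log q) ^ 2 := by positivity
    rw [zero_add, ← mul_le_mul_iff_left₀ h2]
    refine h1.trans (le_of_eq ?_)
    field_simp

theorem exists_bound_iteratedDeriv (hq : 2 ≤ q) (ψ : TestFun (tau q)) :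
    ∃ M : ℝ, ∀ j ≤ 2, ∀ s : ℝ, ‖iteratedDeriv j (ψ : ℝ → ℂ) s‖ ≤ M := by
  obtain ⟨hsm, hper⟩ := ψ.2
  have hj : ∀ j : ℕ, ∃ M : ℝ, ∀ s : ℝ, ‖iteratedDeriv j (ψ : ℝ → ℂ) s‖ ≤ M := by
    intro j
    have hp : Function.Periodic (iteratedDeriv j (ψ : ℝ → ℂ)) (tau q) := by
      intro s
      have h1 := congrFun (iteratedDeriv_comp_add_const j (ψ : ℝ → ℂ) (tau q)) s
      rw [← h1]
      congr 1
      funext r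
      exact hper r
    have hc : Continuous (iteratedDeriv j (ψ : ℝ → ℂ)) :=
      hsm.continuous_iteratedDeriv j (by exact_mod_cast le_top)
    obtain ⟨M, hM⟩ := (hp.isBounded_of_continuous (tau_pos hq).ne' hc).exists_norm_le
    exact ⟨M, fun s => hM _ ⟨s, rfl⟩⟩
  choose M hM using hj
  refine ⟨max (M 0) (max (M 1) (M 2)), fun j hj s => (hM j s).trans ?_⟩
  interval_cases j <;> simp

end TestFunctions

/-! ### The transform as a character series: holomorphy and boundary value. -/

section AbelSeries

variable {q : ℕ} {κ : ℕ → ℂ} {t B : ℝ}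

/-- The spherical transform, as a series of characters. -/
noncomputable def abelSeries (q : ℕ) (κ : ℕ → ℂ) (z : ℂ) : ℂ :=
  ∑' d, abelTransform q κ d * wave q d z

theorem norm_wave_le (hq : 2 ≤ q) {s : ℝ} {z : ℂ} (hz : |z.im| ≤ s) (d : ℤ) :
    ‖wave q d z‖ ≤ ((q : ℝ) ^ s) ^ d.natAbs := by
  have hq1 : (1 : ℝ) ≤ q := by exact_mod_cast (by omega : 1 ≤ q)
  rw [norm_wave (by omega), ← Real.rpow_natCast, ← Real.rpow_mul (by positivity)]
  refine Real.rpow_le_rpow_of_exponent_le hq1 ?_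
  have h1 : ((d.natAbs : ℕ) : ℝ) = |(d : ℝ)| := by
    rw [Nat.cast_natAbs]; push_cast; rfl
  rw [h1]
  calc -(d * z.im) ≤ |d * z.im| := neg_le_abs _
    _ = |z.im| * |(d : ℝ)| := by rw [abs_mul, mul_comm]
    _ ≤ _ := by gcongr

theorem rpow_neg_nonneg_lt_one (hq : 2 ≤ q) (ht : 0 < t) :
    0 < (q : ℝ) ^ (-t) ∧ (q : ℝ) ^ (-t) < 1 := by
  have hq1 : (1 : ℝ) < q := by exact_mod_cast hq
  exact ⟨by positivity, Real.rpow_lt_one_of_one_lt_of_neg hq1 (by linarith)⟩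

theorem rpow_neg_mul_rpow_lt_one (hq : 2 ≤ q) {s : ℝ} (hs : s < t) :
    (q : ℝ) ^ (-t) * (q : ℝ) ^ s < 1 := by
  have hq1 : (1 : ℝ) < q := by exact_mod_cast hq
  rw [← Real.rpow_add (by positivity)]
  exact Real.rpow_lt_one_of_one_lt_of_neg hq1 (by linarith)

theorem summable_normProfile_mul_wave (hq : 2 ≤ q)
    (hB : ∀ n, ‖normProfile q κ n‖ ≤ B * ((q : ℝ) ^ (-t)) ^ n) {X : ℤ → ℂ} {C s : ℝ}
    (hs : 0 ≤ s) (hst : s < t) (hX : ∀ d, ‖X d‖ ≤ C * ((q : ℝ) ^ s) ^ d.natAbs) :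
    Summable fun n : ℕ => ‖normProfile q κ n‖ * ∑ d ∈ Finset.Icc (-(n : ℤ)) n, ‖X d‖ :=
  summable_normProfile_mul_sum hB hX (by positivity)
    (Real.one_le_rpow (by exact_mod_cast (by omega : 1 ≤ q)) hs) (rpow_neg_mul_rpow_lt_one hq hst)

theorem summable_norm_abelTransform_mul (hq : 2 ≤ q) (ht : 0 < t)
    (hB : ∀ n, ‖normProfile q κ n‖ ≤ B * ((q : ℝ) ^ (-t)) ^ n) {X : ℤ → ℂ} {C s : ℝ}
    (hs : 0 ≤ s) (hst : s < t) (hX : ∀ d, ‖X d‖ ≤ C * ((q : ℝ) ^ s) ^ d.natAbs) :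
    Summable (fun d => abelTransform q κ d * X d) ∧
      HasSum (fun n : ℕ => normProfile q κ n *
        ∑ d ∈ Finset.Icc (-(n : ℤ)) n, sphericalCoeff q n d * X d)
        (∑' d, abelTransform q κ d * X d) := by
  obtain ⟨h0, h1⟩ := rpow_neg_nonneg_lt_one hq ht
  exact hasSum_abelTransform_mul (by omega) (summable_norm_normProfile hB h0.le h1)
    (summable_normProfile_mul_wave hq hB hs hst hX)

theorem hasSum_abelSeries (hq : 2 ≤ q) (ht : 0 < t)
    (hB : ∀ n, ‖normProfile q κ n‖ ≤ B * ((q : ℝ) ^ (-t)) ^ n) {z : ℂ} (hz : z ∈ strip t) :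
    Summable (fun d => abelTransform q κ d * wave q d z) ∧
      HasSum (fun n : ℕ => normProfile q κ n *
        ∑ d ∈ Finset.Icc (-(n : ℤ)) n, sphericalCoeff q n d * wave q d z) (abelSeries q κ z) :=
  summable_norm_abelTransform_mul hq ht hB (abs_nonneg z.im) hz
    (C := 1) fun d => by rw [one_mul]; exact norm_wave_le hq le_rfl d

theorem hasSum_sphericalFun {V : Type*} {T : SimpleGraph V} {o : V} {k : V → ℂ} (hq : 2 ≤ q)
    (hT : IsHomogeneousTree T q) (hk : IsRadial T o k) (ht : 0 < t)
    (hB : ∀ n, ‖normProfile q (profile T o k) n‖ ≤ B * ((q : ℝ) ^ (-t)) ^ n) {z : ℂ}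
    (hz : z ∈ strip t) :
    HasSum (fun x => k x * sphericalFun q z (T.dist o x)) (abelSeries q (profile T o k) z) := by
  have h1 := (hasSum_abelSeries hq ht hB hz).2
  rw [← h1.tsum_eq]
  exact hasSum_radial_mul hT hk (fun n => sphereCard_mul_sphericalFun hq z n) h1.summable

/-- Each smaller strip has a uniform summable majorant; evenness is that of the Abel transform. -/
theorem isHolomorphicWeylInvariant_abelSeries (hq : 2 ≤ q) (ht : 0 < t)
    (hB : ∀ n, ‖normProfile q κ n‖ ≤ B * ((q : ℝ) ^ (-t)) ^ n) :
    IsHolomorphicWeylInvariant q t (abelSeries q κ) := by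
  refine ⟨fun z hz => ?_, fun z _ => ⟨?_, ?_⟩⟩
  · obtain ⟨s, hs1, hs2⟩ := exists_between (show |z.im| < t from hz)
    have hs0 : 0 ≤ s := (abs_nonneg _).trans hs1.le
    have h1 := (summable_norm_abelTransform_mul hq ht hB hs0 hs2
      (X := fun d => ((((q : ℝ) ^ s) ^ d.natAbs : ℝ) : ℂ)) (C := 1) fun d => by
        rw [one_mul, Complex.norm_real, Real.norm_of_nonneg (by positivity)]).1.norm
    have h2 : DifferentiableOn ℂ (abelSeries q κ) (strip s) := by
      refine Complex.differentiableOn_tsum_of_summable_norm h1 (fun d => ?_) (isOpen_strip s)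
        fun d w hw => ?_
      · unfold wave
        fun_prop
      · rw [norm_mul, norm_mul]
        gcongr
        rw [Complex.norm_real, Real.norm_of_nonneg (by positivity)]
        exact norm_wave_le hq (le_of_lt hw) d
    exact (h2.differentiableAt ((isOpen_strip s).mem_nhds hs1)).differentiableWithinAt
  · rw [abelSeries, ← (Equiv.neg ℤ).tsum_eq, abelSeries]
    refine tsum_congr fun d => ?_
    rw [Equiv.neg_apply, abelTransform_neg]
    congr 1
    simp only [wave]
    congr 1
    push_cast
    ring
  · simp only [abelSeries, wave_add_tau hq]

theorem integral_abelSeries_mul (hq : 2 ≤ q) (ht : 0 < t)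
    (hB : ∀ n, ‖normProfile q κ n‖ ≤ B * ((q : ℝ) ^ (-t)) ^ n) {ψ : ℝ → ℂ} (hψ : Continuous ψ)
    {M : ℝ} (hM : ∀ s, ‖ψ s‖ ≤ M) {v : ℝ} (hv : |v| < t) :
    ∫ s in (-(tau q) / 2)..(tau q / 2), abelSeries q κ (s + v * Complex.I) * ψ s =
      ∑' d, abelTransform q κ d * ((((q : ℝ) ^ (-(d * v)) : ℝ) : ℂ) * waveIntegral q ψ d) := by
  have hq0 : q ≠ 0 := by omega
  have h1 := (summable_norm_abelTransform_mul hq ht hB (abs_nonneg v) hv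
      (X := fun d => ((((q : ℝ) ^ |v|) ^ d.natAbs : ℝ) : ℂ)) (C := 1) fun d => by
        rw [one_mul, Complex.norm_real, Real.norm_of_nonneg (by positivity)]).1.norm
  have h2 := intervalIntegral.hasSum_integral_of_dominated_convergence
    (μ := MeasureTheory.volume) (a := -(tau q) / 2) (b := tau q / 2)
    (F := fun (d : ℤ) (s : ℝ) => abelTransform q κ d * wave q d (s + v * Complex.I) * ψ s)
    (f := fun s => abelSeries q κ (s + v * Complex.I) * ψ s)
    (fun d _ => ‖abelTransform q κ d * ((((q : ℝ) ^ |v|) ^ d.natAbs : ℝ) : ℂ)‖ * M)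
    (fun d => ?_) (fun d => Filter.Eventually.of_forall fun s _ => ?_)
    (Filter.Eventually.of_forall fun s _ => h1.mul_right M) intervalIntegrable_const
    (Filter.Eventually.of_forall fun s _ => ?_)
  · rw [← h2.tsum_eq]
    refine tsum_congr fun d => ?_
    rw [waveIntegral, ← intervalIntegral.integral_const_mul, ← intervalIntegral.integral_const_mul]
    refine intervalIntegral.integral_congr fun s _ => ?_
    rw [wave_add, wave_mul_I hq0]
    ring
  · refine Continuous.aestronglyMeasurable ?_
    unfold wave
    fun_prop
  · rw [norm_mul, norm_mul, norm_mul]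
    gcongr
    · rw [Complex.norm_real, Real.norm_of_nonneg (by positivity)]
      exact norm_wave_le hq (by simp) d
    · exact hM s
  · exact (hasSum_abelSeries hq ht hB (add_mul_I_mem_strip hv)).1.hasSum.mul_right (ψ s)

/-- The decay q^{-t|d|} of the coefficients absorbs the growth of the characters up to and including
the edge |v| = t. -/
theorem norm_abelTransform_mul_rpow_le (hq : 2 ≤ q) (ht : 0 < t)
    (hB : ∀ n, ‖normProfile q κ n‖ ≤ B * ((q : ℝ) ^ (-t)) ^ n) {v : ℝ} (hv : |v| ≤ t) (d : ℤ) :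
    ‖abelTransform q κ d‖ * (q : ℝ) ^ (-(d * v)) ≤ B * (1 - (q : ℝ) ^ (-t))⁻¹ := by
  obtain ⟨h0, h1⟩ := rpow_neg_nonneg_lt_one hq ht
  have hq0 : q ≠ 0 := by omega
  have hqr : (0 : ℝ) < q := by positivity
  have h2 := norm_abelTransform_le hq0 hB h0.le h1 d
  have h3 : (q : ℝ) ^ (-(d * v)) ≤ ((q : ℝ) ^ t) ^ d.natAbs := by
    have := norm_wave_le hq (z := v * Complex.I) (s := t) (by simpa using hv) d
    rwa [wave_mul_I hq0, Complex.norm_real, Real.norm_of_nonneg (by positivity)] at this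
  have h4 : ((q : ℝ) ^ (-t)) ^ d.natAbs * ((q : ℝ) ^ t) ^ d.natAbs = 1 := by
    rw [← mul_pow, ← Real.rpow_add hqr]
    simp
  calc _ ≤ (B * (1 - (q : ℝ) ^ (-t))⁻¹ * ((q : ℝ) ^ (-t)) ^ d.natAbs) *
        ((q : ℝ) ^ t) ^ d.natAbs :=
        mul_le_mul h2 h3 (by positivity) ((norm_nonneg _).trans h2)
    _ = _ := by rw [mul_assoc, h4, mul_one]

/-- The coefficients stay bounded up to the edge, and a test function contributes O(d⁻²) through two
derivatives. So the edge series defines a distribution, and dominated convergence gives the limit.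
-/
theorem exists_boundaryValue (hq : 2 ≤ q) (ht : 0 < t)
    (hB : ∀ n, ‖normProfile q κ n‖ ≤ B * ((q : ℝ) ^ (-t)) ^ n) :
    ∃ u : TorusDistribution (tau q), IsBoundaryValue q (abelSeries q κ) t u := by
  set A : ℝ := B * (1 - (q : ℝ) ^ (-t))⁻¹ with hA
  have hterm : ∀ (ψ : TestFun (tau q)) (M : ℝ),
      (∀ j ≤ 2, ∀ s : ℝ, ‖iteratedDeriv j (ψ : ℝ → ℂ) s‖ ≤ M) → ∀ v : ℝ, |v| ≤ t → ∀ d : ℤ,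
      ‖abelTransform q κ d * ((((q : ℝ) ^ (-(d * v)) : ℝ) : ℂ) * waveIntegral q ψ d)‖ ≤
        A * (M * fourierDecay q d) := by
    intro ψ M hM v hv d
    rw [← mul_assoc, norm_mul, norm_mul, Complex.norm_real, Real.norm_of_nonneg (by positivity)]
    have h1 := norm_abelTransform_mul_rpow_le hq ht hB hv d
    refine mul_le_mul h1 (norm_waveIntegral_le_fourierDecay hq ψ hM d) (norm_nonneg _) ?_
    exact le_trans (by positivity) h1
  have hbsum : ∀ M : ℝ, Summable fun d => A * (M * fourierDecay q d) :=
    fun M => (summable_fourierDecay.mul_left M).mul_left A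
  have htt : |t| ≤ t := (abs_of_pos ht).le
  have hsum : ∀ ψ : TestFun (tau q), Summable fun d : ℤ => abelTransform q κ d *
      ((((q : ℝ) ^ (-(d * t)) : ℝ) : ℂ) * waveIntegral q ψ d) := by
    intro ψ
    obtain ⟨M, hM⟩ := exists_bound_iteratedDeriv hq ψ
    exact Summable.of_norm_bounded (hbsum M) (hterm ψ M hM t htt)
  have hint : ∀ (ψ : TestFun (tau q)) (d : ℤ), IntervalIntegrable
      (fun s : ℝ => wave q d s * (ψ : ℝ → ℂ) s) MeasureTheory.volume (-(tau q) / 2) (tau q / 2) :=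
    fun ψ d => ((continuous_wave d).mul ψ.2.1.continuous).intervalIntegrable _ _
  let U : TestFun (tau q) →ₗ[ℂ] ℂ :=
    { toFun := fun ψ => ∑' d : ℤ, abelTransform q κ d *
        ((((q : ℝ) ^ (-(d * t)) : ℝ) : ℂ) * waveIntegral q ψ d)
      map_add' := fun ψ χ => by
        rw [← (hsum ψ).tsum_add (hsum χ)]
        refine tsum_congr fun d => ?_
        have : waveIntegral q (ψ + χ : TestFun (tau q)) d =
            waveIntegral q ψ d + waveIntegral q χ d := by
          rw [waveIntegral, waveIntegral, waveIntegral,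
            ← intervalIntegral.integral_add (hint ψ d) (hint χ d)]
          exact intervalIntegral.integral_congr fun s _ => mul_add _ _ _
        rw [this]
        ring
      map_smul' := fun c ψ => by
        rw [RingHom.id_apply, smul_eq_mul, ← tsum_mul_left]
        refine tsum_congr fun d => ?_
        have : waveIntegral q (c • ψ : TestFun (tau q)) d = c * waveIntegral q ψ d := by
          rw [waveIntegral, waveIntegral, ← intervalIntegral.integral_const_mul]
          exact intervalIntegral.integral_congr fun s _ => mul_left_comm _ _ _
        rw [this]
        ring }
  refine ⟨⟨U, 2, A * ∑' d, fourierDecay q d, fun ψ M hM => ?_⟩, fun ψ => ?_⟩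
  · have h1 := tsum_of_norm_bounded (hbsum M).hasSum (hterm ψ M hM t htt)
    refine h1.trans (le_of_eq ?_)
    rw [tsum_mul_left, tsum_mul_left]
    ring
  · obtain ⟨M, hM⟩ := exists_bound_iteratedDeriv hq ψ
    have hmem : Set.Ioo (-t) t ∈ nhdsWithin t (Set.Iio t) := Ioo_mem_nhdsLT (by linarith)
    have h1 : Filter.Tendsto (fun v : ℝ => ∑' d : ℤ, abelTransform q κ d *
        ((((q : ℝ) ^ (-(d * v)) : ℝ) : ℂ) * waveIntegral q ψ d)) (nhdsWithin t (Set.Iio t))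
        (nhds (U ψ)) := by
      refine tendsto_tsum_of_dominated_convergence (hbsum M) (fun d => ?_) ?_
      · refine Filter.Tendsto.const_mul _ (Filter.Tendsto.mul_const _ ?_)
        refine Filter.Tendsto.mono_left ?_ nhdsWithin_le_nhds
        have hqr : (q : ℝ) ≠ 0 := by norm_cast; omega
        have : Continuous fun v : ℝ => (((q : ℝ) ^ (-(d * v)) : ℝ) : ℂ) :=
          Complex.continuous_ofReal.comp (Continuous.rpow continuous_const
            (continuous_const.mul continuous_id).neg fun _ => Or.inl hqr)
        exact this.tendsto t
      · filter_upwards [hmem] with v hv d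
        exact hterm ψ M hM v (abs_lt.2 hv).le d
    refine h1.congr' ?_
    filter_upwards [hmem] with v hv
    exact (integral_abelSeries_mul hq ht hB ψ.2.1.continuous
      (fun s => by simpa using hM 0 (by norm_num) s) (abs_lt.2 hv)).symm

theorem isSphericalTransform_abelSeries {V : Type*} {T : SimpleGraph V} {o : V} {k : V → ℂ}
    (hq : 2 ≤ q) (hT : IsHomogeneousTree T q) (hk : IsRadial T o k) (ht : 0 < t)
    (hB : ∀ n, ‖normProfile q (profile T o k) n‖ ≤ B * ((q : ℝ) ^ (-t)) ^ n) :
    IsSphericalTransform T o q k (abelSeries q (profile T o k)) := by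
  intro ψ
  obtain ⟨M, hM⟩ := exists_bound_iteratedDeriv hq ψ
  have hM0 : ∀ s, ‖(ψ : ℝ → ℂ) s‖ ≤ M := fun s => by simpa using hM 0 (by norm_num) s
  have h1 := (summable_norm_abelTransform_mul hq ht hB le_rfl ht (X := waveIntegral q ψ)
    (C := tau q * M) fun d => by simpa using norm_waveIntegral_le hq hM0 d).2
  have h2 := integral_abelSeries_mul hq ht hB ψ.2.1.continuous hM0 (v := 0) (by simpa using ht)
  simp only [Complex.ofReal_zero, zero_mul, add_zero, mul_zero, neg_zero, Real.rpow_zero,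
    Complex.ofReal_one, one_mul] at h2
  rw [h2, ← h1.tsum_eq]
  exact hasSum_radial_mul hT hk
    (Φ := fun n => ∫ s in (-(tau q) / 2)..(tau q / 2), sphericalFun q (s : ℂ) n * (ψ : ℝ → ℂ) s)
    (integral_sphericalFun_mul hq ψ.2.1.continuous) h1.summable

end AbelSeries

/-! ### Assembly: p < 2, then duality. -/

section Multipliers

variable {V : Type*} {T : SimpleGraph V} {q : ℕ} {o : V} {k : V → ℂ} {p : ℝ}

theorem delta_of_lt_two (hp : 1 ≤ p) (hp2 : p < 2) : delta p = 1 / p - 1 / 2 ∧ 0 < delta p := by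
  have h : 0 < 1 / p - 1 / 2 := sub_pos.2 (one_div_lt_one_div_of_lt (by linarith) hp2)
  rw [delta, abs_of_pos h]
  exact ⟨rfl, h⟩

/-- Convolving k with the point mass at o bounds k in ℓ^p; the sphere of radius n has at least q^n
points, so |κ(n)| ≤ B q^{-n/p}. -/
theorem norm_normProfile_le_of_memCv (hq : 2 ≤ q) (hT : IsHomogeneousTree T q) (hp : 1 ≤ p)
    (hk : MemCv T o p k) (n : ℕ) : ‖normProfile q (profile T o k) n‖ ≤
      (cvNorm T o p k).toReal * ((q : ℝ) ^ (-(1 / p - 1 / 2))) ^ n := by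
  have hp0 : 0 < p := by linarith
  have hqr : (0 : ℝ) < q := by positivity
  set κ := profile T o k
  set B := cvNorm T o p k
  have h1 : ellNorm p (fun x => κ (T.dist o x)) ≤ B :=
    ellNorm_column_le hp (treeKernel T o k) o
  rw [ellNorm_le_iff hp, tsum_radial_enorm hT o fun n => ‖κ n‖ₑ ^ p] at h1
  have h2 : ((q ^ n : ℕ) : ℝ≥0∞) * ‖κ n‖ₑ ^ p ≤ B ^ p :=
    (mul_le_mul_left (Nat.cast_le.2 (pow_le_sphereCard n)) _).trans
      ((ENNReal.le_tsum n).trans h1)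
  have h3 : (q : ℝ) ^ ((n : ℝ) / p) * ‖κ n‖ ≤ B.toReal := by
    have h4 := ENNReal.toReal_mono (ENNReal.rpow_ne_top_of_nonneg hp0.le hk.2.ne) h2
    rw [ENNReal.toReal_mul, ← ENNReal.toReal_rpow, ← ENNReal.toReal_rpow, toReal_enorm,
      ENNReal.toReal_natCast] at h4
    rw [← Real.rpow_le_rpow_iff (z := p) (by positivity) ENNReal.toReal_nonneg hp0,
      Real.mul_rpow (by positivity) (norm_nonneg _), ← Real.rpow_mul hqr.le,
      div_mul_cancel₀ _ hp0.ne', Real.rpow_natCast]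
    exact_mod_cast h4
  rw [normProfile, norm_mul, Complex.norm_real, Real.norm_of_nonneg (by positivity),
    ← Real.rpow_natCast, ← Real.rpow_mul hqr.le]
  have h5 : (q : ℝ) ^ ((n : ℝ) / 2) =
      (q : ℝ) ^ ((n : ℝ) / p) * (q : ℝ) ^ (-(1 / p - 1 / 2) * n) := by
    rw [← Real.rpow_add hqr]
    congr 1
    ring
  rw [h5, mul_right_comm]
  gcongr

/-- Identifies the convolution kernel on ℤ that both norm inequalities concern, for any extension
and boundary value. -/
theorem invFourier_eq_abelTransform (hq : 2 ≤ q) (hT : IsHomogeneousTree T q)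
    (hk : IsRadial T o k) {t : ℝ} (ht : 0 < t) {m : ℂ → ℂ} {u : TorusDistribution (tau q)}
    (hm : SphericalTransformExtends T o q k t m) (hu : IsBoundaryValue q m t u) (d : ℤ) :
    invFourier q u d =
      (((q : ℝ) ^ (t * d) : ℝ) : ℂ) * abelTransform q (profile T o k) d := by
  have hτ : (tau q : ℂ) ≠ 0 := by exact_mod_cast (tau_pos hq).ne'
  rw [invFourier_boundaryValue hq ht hm.2 hu, waveIntegral_transform hq hT hk hm.1,
    inv_mul_cancel_left₀ hτ]

theorem mpNorm_le_cvNorm (hq : 2 ≤ q) (hT : IsHomogeneousTree T q) (hp : 1 ≤ p) (hp2 : p < 2)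
    (hk : IsRadial T o k) {m : ℂ → ℂ} {u : TorusDistribution (tau q)}
    (hm : SphericalTransformExtends T o q k (delta p) m)
    (hu : IsBoundaryValue q m (delta p) u) : mpNorm q p u ≤ cvNorm T o p k := by
  have hq0 : q ≠ 0 := by omega
  obtain ⟨hδ, hδ0⟩ := delta_of_lt_two hp hp2
  have hs := summable_normProfile_of_transform hq hT hk hm.1
  have h := opNorm_le_cvNorm hq hT o hp (tendsto_profile_zero hq0 hs) abelTransform_neg
    (tendsto_abelTransform_zero hq0 hs) (summable_abelTransform_sub hq0 hs)
    (abelTransform_sub hq0 hs)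
  rw [← hδ] at h
  simp only [mpNorm, invFourier_eq_abelTransform hq hT hk hδ0 hm hu]
  exact h

theorem exists_cvNorm_le_mpNorm (hq : 2 ≤ q) (hT : IsHomogeneousTree T q) (o : V) (hp : 1 ≤ p)
    (hp2 : p < 2) : ∃ C : ℝ≥0, 0 < C ∧ ∀ k : V → ℂ, IsRadial T o k →
      ∀ (m : ℂ → ℂ) (u : TorusDistribution (tau q)),
        SphericalTransformExtends T o q k (delta p) m → IsBoundaryValue q m (delta p) u →
        cvNorm T o p k ≤ C * mpNorm q p u := by
  have hq0 : q ≠ 0 := by omega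
  have hqr : (0 : ℝ) < q := by positivity
  have hp0 : 0 < p := by linarith
  obtain ⟨hδ, hδ0⟩ := delta_of_lt_two hp hp2
  obtain ⟨C, hC, h⟩ := exists_cvNorm_le hq hT o hp hp2
  refine ⟨C, hC, fun k hk m u hm hu => h k (invFourier q u) ?_ (fun d => ?_) fun e => ?_⟩
  · exact tendsto_profile_zero hq0 (summable_normProfile_of_transform hq hT hk hm.1)
  -- Evenness of a gives F(-d) = q^{-2δd} F(d), and -2δ = 1 - 2/p.
  · simp only [invFourier_eq_abelTransform hq hT hk hδ0 hm hu, abelTransform_neg]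
    rw [← mul_assoc, ← Complex.ofReal_pow, ← Complex.ofReal_mul, ← Real.rpow_natCast,
      ← Real.rpow_mul hqr.le, ← Real.rpow_add hqr, hδ]
    congr 3
    push_cast
    ring
  · have h1 := abelTransform_sub hq0 (summable_normProfile_of_transform hq hT hk hm.1) e
    simp only [invFourier_eq_abelTransform hq hT hk hδ0 hm hu]
    rw [← mul_assoc, ← Complex.ofReal_mul, ← Real.rpow_add hqr]
    have e1 : (q : ℝ) ^ ((e : ℝ) / p) =
        (q : ℝ) ^ (delta p * ((e : ℤ) : ℝ)) * (q : ℝ) ^ ((e : ℝ) / 2) := by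
      rw [← Real.rpow_add hqr, hδ]
      congr 1
      push_cast
      ring
    have e2 : 1 - 2 / p + delta p * (((e : ℤ) + 2 : ℤ) : ℝ) = delta p * ((e : ℤ) : ℝ) := by
      rw [hδ]
      push_cast
      ring
    rw [e1, e2, ← mul_sub, ← h1]
    push_cast
    ring

theorem multiplier_theorem_of_lt_two (hq : 2 ≤ q) (hT : IsHomogeneousTree T q) (o : V)
    (hp : 1 ≤ p) (hp2 : p < 2) :
    (∀ k : V → ℂ, IsRadial T o k → (MemCv T o p k ↔
        ∃ (m : ℂ → ℂ) (u : TorusDistribution (tau q)),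
          SphericalTransformExtends T o q k (delta p) m ∧
          IsBoundaryValue q m (delta p) u ∧ MemMp q p u)) ∧
    ∃ c C : ℝ≥0, 0 < c ∧ 0 < C ∧ ∀ k : V → ℂ, IsRadial T o k →
        ∀ (m : ℂ → ℂ) (u : TorusDistribution (tau q)),
          SphericalTransformExtends T o q k (delta p) m →
          IsBoundaryValue q m (delta p) u → MemMp q p u →
          (∀ z ∈ strip (delta p),
            HasSum (fun x : V => k x * sphericalFun q z (T.dist o x)) (m z)) ∧
          (c : ℝ≥0∞) * mpNorm q p u ≤ cvNorm T o p k ∧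
          cvNorm T o p k ≤ (C : ℝ≥0∞) * mpNorm q p u := by
  obtain ⟨hδ, hδ0⟩ := delta_of_lt_two hp hp2
  obtain ⟨C, hC, hCv⟩ := exists_cvNorm_le_mpNorm hq hT o hp hp2
  have hdecay : ∀ k, MemCv T o p k → ∀ n, ‖normProfile q (profile T o k) n‖ ≤
      (cvNorm T o p k).toReal * ((q : ℝ) ^ (-delta p)) ^ n := by
    intro k hk n
    rw [hδ]
    exact norm_normProfile_le_of_memCv hq hT hp hk n
  have hmem : ∀ k : V → ℂ, IsRadial T o k → ∀ (m : ℂ → ℂ) (u : TorusDistribution (tau q)),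
      SphericalTransformExtends T o q k (delta p) m → IsBoundaryValue q m (delta p) u →
      MemMp q p u → MemCv T o p k := fun k hk m u hm hu hmp =>
    ⟨hk, (hCv k hk m u hm hu).trans_lt (ENNReal.mul_lt_top ENNReal.coe_lt_top hmp)⟩
  refine ⟨fun k hk => ⟨fun hcv => ?_, fun ⟨m, u, hm, hu, hmp⟩ => hmem k hk m u hm hu hmp⟩,
    1, C, one_pos, hC, fun k hk m u hm hu hmp => ⟨fun z hz => ?_, ?_, hCv k hk m u hm hu⟩⟩
  · obtain ⟨u, hu⟩ := exists_boundaryValue hq hδ0 (hdecay k hcv)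
    have hm : SphericalTransformExtends T o q k (delta p) (abelSeries q (profile T o k)) :=
      ⟨isSphericalTransform_abelSeries hq hT hk hδ0 (hdecay k hcv),
        isHolomorphicWeylInvariant_abelSeries hq hδ0 (hdecay k hcv)⟩
    exact ⟨_, u, hm, hu, (mpNorm_le_cvNorm hq hT hp hp2 hk hm hu).trans_lt hcv.2⟩
  -- The extension is arbitrary here. Membership in Cv_p, already deduced from it, gives the decay
  -- that makes its Fourier series converge, and that series is the spherical one.
  · have hB := hdecay k (hmem k hk m u hm hu hmp)
    have h1 := hasSum_fourier_of_holomorphic hq hm.2 abelTransform_neg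
      (waveIntegral_transform hq hT hk hm.1) hz (hasSum_abelSeries hq hδ0 hB hz).1
    have h2 := hasSum_sphericalFun hq hT hk hδ0 hB hz
    rwa [abelSeries, h1.tsum_eq] at h2
  · rw [ENNReal.coe_one, one_mul]
    exact mpNorm_le_cvNorm hq hT hp hp2 hk hm hu

theorem delta_eq_of_holderConjugate {p' : ℝ} (h : p.HolderConjugate p') : delta p = delta p' := by
  have h1 : 1 / p = 1 - 1 / p' := by
    have := h.inv_add_inv_eq_one
    simp only [one_div]
    linarith
  rw [delta, delta, h1, ← abs_neg]
  congr 1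
  ring

/-- The kernel on the tree is symmetric because the distance is. -/
theorem cvNorm_eq_of_holderConjugate {p' : ℝ} (h : p.HolderConjugate p') (k : V → ℂ) :
    cvNorm T o p k = cvNorm T o p' k := by
  rw [cvNorm, opNorm_eq_opNorm_transpose h, cvNorm]
  congr 1
  funext x y
  rw [treeKernel, treeKernel, SimpleGraph.dist_comm]

/-- The transposed convolution on ℤ is conjugate to the original under n ↦ -n, an isometry. -/
theorem mpNorm_eq_of_holderConjugate {p' : ℝ} (h : p.HolderConjugate p')
    (u : TorusDistribution (tau q)) : mpNorm q p u = mpNorm q p' u := by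
  have key : ∀ {r r' : ℝ}, r.HolderConjugate r' → mpNorm q r u ≤ mpNorm q r' u := by
    intro r r' hr
    refine (opNorm_le_opNorm_transpose hr _).trans ?_
    refine le_trans (le_of_eq ?_) (opNorm_reindex_le hr.symm.lt.le (Equiv.neg ℤ) (Equiv.neg ℤ)
      fun n j : ℤ => invFourier q u (n - j))
    congr 1
    funext n j
    simp only [Equiv.neg_apply]
    congr 1
    ring
  exact le_antisymm (key h) (key h.symm)

end Multipliers

end HomTree

theorem theorem4p3 {V : Type*} (T : SimpleGraph V) (q : ℕ) (hq : 2 ≤ q)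
    (hT : HomTree.IsHomogeneousTree T q) (o : V) (p : ℝ) (hp : 1 ≤ p) (hp2 : p ≠ 2) :
    (∀ k : V → ℂ, HomTree.IsRadial T o k →
      (HomTree.MemCv T o p k ↔
        ∃ (m : ℂ → ℂ) (u : HomTree.TorusDistribution (HomTree.tau q)),
          HomTree.SphericalTransformExtends T o q k (HomTree.delta p) m ∧
          HomTree.IsBoundaryValue q m (HomTree.delta p) u ∧
          HomTree.MemMp q p u)) ∧
    ∃ c C : ℝ≥0, 0 < c ∧ 0 < C ∧
      ∀ k : V → ℂ, HomTree.IsRadial T o k →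
        ∀ (m : ℂ → ℂ) (u : HomTree.TorusDistribution (HomTree.tau q)),
          HomTree.SphericalTransformExtends T o q k (HomTree.delta p) m →
          HomTree.IsBoundaryValue q m (HomTree.delta p) u →
          HomTree.MemMp q p u →
          (∀ z ∈ HomTree.strip (HomTree.delta p),
            HasSum (fun x : V => k x * HomTree.sphericalFun q z (T.dist o x)) (m z)) ∧
          (c : ℝ≥0∞) * HomTree.mpNorm q p u ≤ HomTree.cvNorm T o p k ∧
          HomTree.cvNorm T o p k ≤ (C : ℝ≥0∞) * HomTree.mpNorm q p u := by
  rcases lt_or_gt_of_ne hp2 with h | h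
  · exact HomTree.multiplier_theorem_of_lt_two hq hT o hp h
  -- For p > 2 the conjugate exponent is below 2, and every quantity in the statement is the same
  -- for both.
  · have hpp' : p.HolderConjugate p.conjExponent :=
      Real.HolderConjugate.conjExponent (by linarith)
    have h2 : p.conjExponent < 2 := by
      rw [Real.conjExponent, div_lt_iff₀ (by linarith)]
      linarith
    have := HomTree.multiplier_theorem_of_lt_two hq hT o hpp'.symm.lt.le h2
    simpa only [HomTree.MemCv, HomTree.MemMp, HomTree.delta_eq_of_holderConjugate hpp',
      HomTree.cvNorm_eq_of_holderConjugate hpp',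
      HomTree.mpNorm_eq_of_holderConjugate hpp'] using this
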